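/- **Theorem.** Let $G=(V,E)$ be a finite simple undirected graph with rational edge weights (lengths) and without a cycle of negative total weight, where, as usual for shortest paths in undirected graphs, a cycle is allowed to traverse an edge back and forth (so that this means that no edge has negative weight). For $u,v\in V$ let the geodesic interval $I_G[u,v]$ be the set of vertices that lie on at least one shortest $u$–$v$ path, where the length of a path is the sum of its edge weights. Consider the following problem. The input consists of such a graph $G$ with its weights, a set $T$ of unordered pairs of vertices, integers $k,p,q\ge 0$, and a set $Z\subseteq V$ such that $|Z|\le p$ and every connected component of $G-Z$ contains at most $q$ terminal vertices, that is, vertices belonging to some pair in $T$. The question is whether there is a set $S\subseteq V$ with $|S|\le k$ such that $S\cap I_G[u,v]\neq\emptyset$ for every $\{u,v\}\in T$. This problem is fixed-parameter tractable with parameter $k+p+q$: there are a computable function $f:\mathbb N\to\mathbb N$, a constant $c$, and an algorithm (a program for a random access machine with logarithmic cost) that decides every such input correctly in time at most $f(k+p+q)\cdot N^{c}$, where $N$ is the length of the input in binary. -/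

import Mathlib

/-! ### Machine model: random access machine with logarithmic cost -/

namespace RAM

/-- The memory: every integer address holds one integer. -/
abbrev Mem := ℤ → ℤ

/-- The arithmetic and comparison operations of the machine. -/
inductive BinOp
  | add | sub | mul | div | eq | lt

/-- Division rounds down; a comparison returns `1` if it holds and `0` otherwise. -/
def BinOp.eval : BinOp → ℤ → ℤ → ℤ
  | .add, a, b => a + b
  | .sub, a, b => a - b
  | .mul, a, b => a * b
  | .div, a, b => Int.fdiv a b
  | .eq, a, b => if a = b then 1 else 0
  | .lt, a, b => if a < b then 1 else 0

/-- Expressions: constants, the content of the cell whose address is the value of an expression,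
and binary operations. -/
inductive Term
  | const (z : ℤ)
  | load (a : Term)
  | op (o : BinOp) (a b : Term)

def Term.eval (M : Mem) : Term → ℤ
  | .const z => z
  | .load a => M (a.eval M)
  | .op o a b => o.eval (a.eval M) (b.eval M)

/-- The logarithmic cost of handling the integer `z`: one more than its binary length. -/
def len (z : ℤ) : ℕ := z.natAbs.size + 1

/-- Evaluating an expression costs, for every operation and every memory access, the lengths of
the integers (operands, address, content) that are handled. -/
def Term.cost (M : Mem) : Term → ℕ
  | .const z => len z
  | .load a => a.cost M + len (a.eval M) + len (M (a.eval M))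
  | .op _ a b => a.cost M + b.cost M + len (a.eval M) + len (b.eval M)

/-- Programs. `store a e` writes the value of `e` into the cell whose address is the value of `a`;
tests succeed on nonzero values. -/
inductive Program
  | skip
  | store (a e : Term)
  | seq (P Q : Program)
  | cond (e : Term) (P Q : Program)
  | loop (e : Term) (P : Program)

/-- `Exec P M M' t`: started on memory `M`, the program `P` halts with memory `M'` after spending
time `t`. -/
inductive Exec : Program → Mem → Mem → ℕ → Prop
  | skip (M : Mem) : Exec .skip M M 1
  | store (a e : Term) (M : Mem) :
      Exec (.store a e) M (Function.update M (a.eval M) (e.eval M))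
        (a.cost M + e.cost M + len (a.eval M) + len (e.eval M))
  | seq {P Q : Program} {M M₁ M₂ : Mem} {s t : ℕ} :
      Exec P M M₁ s → Exec Q M₁ M₂ t → Exec (.seq P Q) M M₂ (s + t)
  | cond_true {e : Term} {P Q : Program} {M M₁ : Mem} {t : ℕ} :
      e.eval M ≠ 0 → Exec P M M₁ t → Exec (.cond e P Q) M M₁ (e.cost M + len (e.eval M) + t)
  | cond_false {e : Term} {P Q : Program} {M M₁ : Mem} {t : ℕ} :
      e.eval M = 0 → Exec Q M M₁ t → Exec (.cond e P Q) M M₁ (e.cost M + len (e.eval M) + t)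
  | loop_true {e : Term} {P : Program} {M M₁ M₂ : Mem} {s t : ℕ} :
      e.eval M ≠ 0 → Exec P M M₁ s → Exec (.loop e P) M₁ M₂ t →
        Exec (.loop e P) M M₂ (e.cost M + len (e.eval M) + s + t)
  | loop_false {e : Term} {P : Program} {M : Mem} :
      e.eval M = 0 → Exec (.loop e P) M M (e.cost M + len (e.eval M))

/-- The initial memory on input `l`: the entries of `l` are in the cells `0, 1, 2, …`, and all
other cells hold `0`. -/
def inputMem (l : List ℤ) : Mem := fun a => if 0 ≤ a then l.getD a.toNat 0 else 0

/-- The size of an input: the total length of its entries in binary. -/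
def inputSize (l : List ℤ) : ℕ := (l.map len).sum

/-- The decision problem `yes` on instances of type `α`, given to the machine through `encode`, is
fixed-parameter tractable with respect to the parameter `κ`: for some computable `f` and some
constant `c`, one program halts on every instance `x` within time `f (κ x) * |x| ^ c` and leaves in
the cell `0` the answer `1` if `x` is a yes-instance, and `0` otherwise. -/
def FixedParameterTractable {α : Type} (encode : α → List ℤ) (κ : α → ℕ) (yes : α → Prop) : Prop :=
  ∃ (P : Program) (f : ℕ → ℕ) (c : ℕ), Computable f ∧
    ∀ x : α, ∃ (M : Mem) (t : ℕ), Exec P (inputMem (encode x)) M t ∧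
      t ≤ f (κ x) * inputSize (encode x) ^ c ∧
      (yes x → M 0 = 1) ∧ (¬ yes x → M 0 = 0)

end RAM

/-! ### Geodesic intervals in edge-weighted graphs -/

section Graphs

variable {V : Type} (G : SimpleGraph V) (w : Sym2 V → ℚ)

/-- The length of a walk. -/
def walkWeight {u v : V} (P : G.Walk u v) : ℚ := (P.edges.map w).sum

/-- No cycle has negative total weight. A cycle may run through an edge back and forth, as usual
for shortest paths in an undirected graph: every closed walk counts. -/
def NoNegativeCycle : Prop := ∀ (v : V) (C : G.Walk v v), 0 ≤ walkWeight G w C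

/-- `P` is a shortest `u`–`v` path. -/
def IsShortestPath {u v : V} (P : G.Walk u v) : Prop :=
  P.IsPath ∧ ∀ Q : G.Walk u v, Q.IsPath → walkWeight G w P ≤ walkWeight G w Q

/-- The geodesic interval: the vertices on at least one shortest `u`–`v` path. -/
def geodesicInterval (u v : V) : Set V :=
  {x | ∃ P : G.Walk u v, IsShortestPath G w P ∧ x ∈ P.support}

/-- The vertices occurring in a pair of `T`. -/
def terminals (T : Finset (Sym2 V)) : Set V := {v | ∃ e ∈ T, v ∈ e}

/-- The graph obtained by deleting the vertices of `Z`. -/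
def deleteVertices (Z : Finset V) : SimpleGraph {v : V // v ∉ Z} :=
  G.comap Subtype.val

end Graphs

/-! ### The problem -/

/-- An edge-weighted graph `G` on the vertices `0, …, n - 1`, a set `T` of vertex pairs, an integer
`k`, and a set `Z` of at most `p` vertices such that every connected component of `G - Z` contains
at most `q` terminal vertices. Only the weights of edges of `G` matter. -/
structure SeparatedInstance where
  n : ℕ
  G : SimpleGraph (Fin n)
  w : Sym2 (Fin n) → ℚ
  T : Finset (Sym2 (Fin n))
  k : ℕ
  Z : Finset (Fin n)
  p : ℕ
  q : ℕ
  noNegativeCycle : NoNegativeCycle G w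
  card_Z_le : Z.card ≤ p
  terminals_le : ∀ C : (deleteVertices G Z).ConnectedComponent,
    {v | v ∈ C.supp ∧ v.val ∈ terminals T}.ncard ≤ q

namespace SeparatedInstance

/-- Some set of at most `k` vertices meets the geodesic interval of every pair in `T`. -/
def IsYes (I : SeparatedInstance) : Prop :=
  ∃ S : Finset (Fin I.n), S.card ≤ I.k ∧
    ∀ u v : Fin I.n, s(u, v) ∈ I.T → ∃ x ∈ S, x ∈ geodesicInterval I.G I.w u v

open Classical in
/-- The input given to the machine: `n, k, p, q`, then the adjacency matrix, where an edge is
given as `1` with the numerator and the denominator of its weight, then the matrix of `T`, then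
the indicator vector of `Z`. -/
noncomputable def encode (I : SeparatedInstance) : List ℤ :=
  [(I.n : ℤ), (I.k : ℤ), (I.p : ℤ), (I.q : ℤ)]
  ++ (List.finRange I.n).flatMap (fun u => (List.finRange I.n).flatMap fun v =>
      if I.G.Adj u v then [1, (I.w s(u, v)).num, ((I.w s(u, v)).den : ℤ)] else [0, 0, 1])
  ++ (List.finRange I.n).flatMap (fun u => (List.finRange I.n).map fun v =>
      if s(u, v) ∈ I.T then 1 else 0)
  ++ (List.finRange I.n).map (fun u => if u ∈ I.Z then 1 else 0)

/-- The parameter `k + p + q`. -/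
def parameter (I : SeparatedInstance) : ℕ := I.k + I.p + I.q

end SeparatedInstance

/-! Call a pair in `T` a constraint; a solution must hit the interval of each. The separator `Z`
cuts every interval into few pieces. If `x` lies on a shortest `u`–`v` path, the part before `x`
either contains some `a ∈ Z`, or stays in one component of `G - Z`, and then `a = u`; likewise there
is `b` on the part after `x`. The atom of `(a, b)` consists of the vertices of the interval of `a`
and `b` to which `a` and `b` are attached in the same way. It contains `x` and lies inside the
interval of `u` and `v` (`exists_mem_localInterval`, `geodesicInterval_subset`). An atom through `x`
is determined by two vertices among `Z` and the terminals in the component of `x`, so at most `(p +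
q)²` different atoms contain `x`, over all pairs together (`card_anchors_le`).

This bounds a branching. Keep `k` candidate sets, initially all of `V`, with the `i`-th solution
vertex in the `i`-th set. If every constraint contains a whole candidate set, one arbitrary vertex
from each set gives a solution. Otherwise take a constraint that contains none, guess which solution
vertex hits it and in which atom, and intersect that candidate set with the atom. A correct guess
adds one to the number of atoms around the solution vertices that contain the corresponding
candidate sets, because that set was not inside the atom before. Hence `k (p + q)² + 1` rounds
suffice, each with at most `(k + 1)(p + 1)²` guesses, and all guess sequences can be tried
(`exists_code`, `exists_accepts_iff`, `exists_goodGuess_iff`).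

Computing the intervals needs care, because edges of weight zero are allowed: `d(u,x) + d(x,v) =
d(u,v)` only puts `x` on a shortest walk, which may repeat vertices. The correct criterion asks in
addition that no vertex `c ≠ x` lies on all shortest walks from `x` to `u` and on all those from `x`
to `v`, which can be read off the distances in `G` and in `G - c` (`mem_geodesicInterval_of_forall`,
`mem_geodesicInterval_iff`).

The rest is an explicit program with a correctness proof. A single number `X` bounds the bit length
of all memory entries and the number of rounds of every loop; the time is then a fixed polynomial in
`X`, and `X` can be taken as a function of the parameter times the cube of the input size plus one
(`enough`). -/

/-! ### Shortest walks -/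

section ShortestWalks

open SimpleGraph

variable {V : Type} {G : SimpleGraph V} {w : Sym2 V → ℚ}

@[simp] lemma walkWeight_nil {u : V} : walkWeight G w (Walk.nil : G.Walk u u) = 0 := rfl

@[simp] lemma walkWeight_cons {u v x : V} (h : G.Adj u v) (P : G.Walk v x) :
    walkWeight G w (Walk.cons h P) = w s(u, v) + walkWeight G w P := by
  simp [walkWeight]

@[simp] lemma walkWeight_append {u v x : V} (P : G.Walk u v) (Q : G.Walk v x) :
    walkWeight G w (P.append Q) = walkWeight G w P + walkWeight G w Q := by
  simp [walkWeight, Walk.edges_append]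

@[simp] lemma walkWeight_reverse {u v : V} (P : G.Walk u v) :
    walkWeight G w P.reverse = walkWeight G w P := by
  simp [walkWeight, List.sum_reverse]

/-- An edge run through back and forth is a closed walk of twice its weight. -/
lemma NoNegativeCycle.weight_nonneg (h : NoNegativeCycle G w) {u v : V} (huv : G.Adj u v) :
    0 ≤ w s(u, v) := by
  have := h u (Walk.cons huv (Walk.cons huv.symm Walk.nil))
  simp only [walkWeight_cons, walkWeight_nil, Sym2.eq_swap (a := v)] at this
  linarith

lemma NoNegativeCycle.walkWeight_nonneg (h : NoNegativeCycle G w) {u v : V} (P : G.Walk u v) :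
    0 ≤ walkWeight G w P := by
  induction P with
  | nil => simp
  | cons e P ih => simpa using add_nonneg (h.weight_nonneg e) ih

lemma NoNegativeCycle.walkWeight_bypass_le [DecidableEq V] (h : NoNegativeCycle G w) {u v : V}
    (P : G.Walk u v) :
    walkWeight G w P.bypass ≤ walkWeight G w P := by
  refine List.Sublist.sum_le_sum (P.edges_bypass_sublist_edges.map w) ?_
  intro a ha
  obtain ⟨e, he, rfl⟩ := List.mem_map.1 ha
  induction e with
  | _ x y => exact h.weight_nonneg (P.adj_of_mem_edges he)

/-- `P` has the least weight among all walks with the same ends. -/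
def IsShortestWalk (G : SimpleGraph V) (w : Sym2 V → ℚ) {u v : V} (P : G.Walk u v) : Prop :=
  ∀ Q : G.Walk u v, walkWeight G w P ≤ walkWeight G w Q

/-- Cutting loops out of a walk only drops nonnegative weights, so a shortest path also competes
with walks. Minimality among walks passes to subwalks and survives gluing without disjointness
conditions; being a path is a separate matter because of edges of weight zero. -/
lemma isShortestPath_iff (h : NoNegativeCycle G w) {u v : V} {P : G.Walk u v} :
    IsShortestPath G w P ↔ P.IsPath ∧ IsShortestWalk G w P := by
  classical
  refine and_congr_right fun _ => ⟨fun hP Q => ?_, fun hP Q _ => hP Q⟩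
  exact (hP _ Q.bypass_isPath).trans (h.walkWeight_bypass_le Q)

lemma IsShortestWalk.reverse {u v : V} {P : G.Walk u v} (hP : IsShortestWalk G w P) :
    IsShortestWalk G w P.reverse := fun Q => by
  simpa using hP Q.reverse

lemma IsShortestWalk.of_append_left {u v x : V} {P : G.Walk u v} {Q : G.Walk v x}
    (h : IsShortestWalk G w (P.append Q)) : IsShortestWalk G w P := fun R => by
  simpa using h (R.append Q)

lemma IsShortestWalk.of_append_right {u v x : V} {P : G.Walk u v} {Q : G.Walk v x}
    (h : IsShortestWalk G w (P.append Q)) : IsShortestWalk G w Q := fun R => by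
  simpa using h (P.append R)

lemma isPath_append {u v x : V} {P : G.Walk u v} {Q : G.Walk v x} (hP : P.IsPath) (hQ : Q.IsPath)
    (h : ∀ y ∈ P.support, y ∈ Q.support → y = v) : (P.append Q).IsPath := by
  induction P with
  | nil => simpa
  | cons e P ih =>
    rw [Walk.cons_append, Walk.cons_isPath_iff]
    rw [Walk.cons_isPath_iff] at hP
    refine ⟨ih hP.1 hQ fun y hy => h y (by simp [hy]), fun hu => ?_⟩
    rcases (Walk.mem_support_append_iff _ _).1 hu with hu | hu
    · exact hP.2 hu
    · have := h _ (by simp) hu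
      subst this
      exact hP.2 (by simp)

/-- A walk that ends in a set `K` has a first vertex in `K`. -/
lemma exists_append_first_mem (K : Set V) {x b : V} (Q : G.Walk x b) (hb : b ∈ K) :
    ∃ p, ∃ (Q₁ : G.Walk x p) (Q₂ : G.Walk p b), Q = Q₁.append Q₂ ∧ p ∈ K ∧
      ∀ y ∈ Q₁.support, y ∈ K → y = p := by
  induction Q with
  | nil => exact ⟨_, Walk.nil, Walk.nil, rfl, hb, by simp⟩
  | @cons u v _ e Q ih =>
    by_cases hu : u ∈ K
    · exact ⟨u, Walk.nil, Walk.cons e Q, rfl, hu, by simp⟩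
    · obtain ⟨p, Q₁, Q₂, rfl, hp, h⟩ := ih hb
      refine ⟨p, Walk.cons e Q₁, Q₂, rfl, hp, fun y hy hyK => ?_⟩
      rcases List.mem_cons.1 (by simpa using hy) with rfl | hy
      · exact absurd hyK hu
      · exact h y hy hyK

lemma mem_right_of_not_mem_left {u v p q : V} {A : G.Walk u p} {B : G.Walk p v}
    (h : q ∈ (A.append B).support) : q ∈ A.support ∨ q ∈ B.support :=
  (Walk.mem_support_append_iff _ _).1 h

lemma eq_of_mem_of_isPath_append {u v p y : V} {A : G.Walk u p} {B : G.Walk p v}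
    (h : (A.append B).IsPath) (hA : y ∈ A.support) (hB : y ∈ B.support) : y = p := by
  by_contra hne
  exact h.ne_of_mem_support_of_append hne hA hB rfl

/-- A part of a shortest path can be replaced by another shortest path that does not meet the rest
of the path. -/
lemma IsShortestPath.exists_replace (h : NoNegativeCycle G w) {u v p q : V} {P : G.Walk u v}
    (hP : IsShortestPath G w P) {R : G.Walk p q} (hR : R.IsPath) (hR' : IsShortestWalk G w R)
    (hp : p ∈ P.support) (hq : q ∈ P.support)
    (hRP : ∀ y ∈ R.support, y ∈ P.support → y = p ∨ y = q) :
    ∃ P' : G.Walk u v, IsShortestPath G w P' ∧ R.support ⊆ P'.support := by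
  rw [isShortestPath_iff h] at hP
  obtain ⟨A, B, rfl⟩ := Walk.mem_support_iff_exists_append.1 hp
  -- The case where `p` comes before `q` on the path, which is cut into `A`, `B`, `C`. The other
  -- order is reduced to it by reversing `R`.
  have key : ∀ {p q : V} (R : G.Walk p q) (A : G.Walk u p) (B : G.Walk p q) (C : G.Walk q v),
      (A.append (B.append C)).IsPath → IsShortestWalk G w (A.append (B.append C)) →
      R.IsPath → IsShortestWalk G w R →
      (∀ y ∈ R.support, y ∈ (A.append (B.append C)).support → y = p ∨ y = q) →
      ∃ P' : G.Walk u v, IsShortestPath G w P' ∧ R.support ⊆ P'.support := by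
    clear * - h
    intro p q R A B C hP hS hR hR' hRP
    by_cases hpq : p = q
    · subst hpq
      refine ⟨_, (isShortestPath_iff h).2 ⟨hP, hS⟩, ?_⟩
      obtain rfl := (Walk.isPath_iff_nil.1 hR).eq_nil
      simp [Walk.mem_support_append_iff]
    have hBC := hP.of_append_right
    refine ⟨A.append (R.append C), (isShortestPath_iff h).2 ⟨?_, fun Q => ?_⟩, ?_⟩
    · have hp : p ∉ C.support := fun hp =>
        hpq (eq_of_mem_of_isPath_append hBC (by simp) hp)
      have hq : q ∉ A.support := fun hq =>
        hpq (eq_of_mem_of_isPath_append hP hq (by simp [Walk.mem_support_append_iff])).symm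
      refine isPath_append hP.of_append_left (isPath_append hR hBC.of_append_right ?_) ?_
      · intro y hy hyC
        rcases hRP y hy (by simp [Walk.mem_support_append_iff, hyC]) with rfl | rfl
        · exact absurd hyC hp
        · rfl
      · intro y hyA hy
        rcases (Walk.mem_support_append_iff _ _).1 hy with hy | hy
        · rcases hRP y hy (by simp [Walk.mem_support_append_iff, hyA]) with rfl | rfl
          · rfl
          · exact absurd hyA hq
        · exact eq_of_mem_of_isPath_append hP hyA (by simp [Walk.mem_support_append_iff, hy])
    · have h1 := hS Q
      have h2 := hR' B
      simp only [walkWeight_append] at h1 ⊢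
      linarith
    · intro y hy
      simp [Walk.mem_support_append_iff, hy]
  rcases mem_right_of_not_mem_left hq with hq | hq
  · obtain ⟨A, C, rfl⟩ := Walk.mem_support_iff_exists_append.1 hq
    rw [← Walk.append_assoc] at hP
    obtain ⟨P', h1, h2⟩ := key R.reverse A C B hP.1 hP.2 hR.reverse hR'.reverse (by
      intro y hy hy'
      rw [Walk.append_assoc] at hy'
      exact (hRP y (by simpa using hy) hy').symm)
    exact ⟨P', h1, by simpa using h2⟩
  · obtain ⟨B, C, rfl⟩ := Walk.mem_support_iff_exists_append.1 hq
    exact key R A B C hP.1 hP.2 hR hR' hRP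

/-- A geodesic interval between two vertices of a shortest path is contained in the interval
between the ends of the path. -/
lemma geodesicInterval_subset (h : NoNegativeCycle G w) {u v a b : V} {P : G.Walk u v}
    (hP : IsShortestPath G w P) (ha : a ∈ P.support) (hb : b ∈ P.support) :
    geodesicInterval G w a b ⊆ geodesicInterval G w u v := by
  rintro x ⟨Q, hQ, hx⟩
  by_cases hxP : x ∈ P.support
  · exact ⟨P, hP, hxP⟩
  rw [isShortestPath_iff h] at hQ
  obtain ⟨Q₁, Q₂, rfl⟩ := Walk.mem_support_iff_exists_append.1 hx
  -- The walk `Q` as a whole may meet `P` outside the part between `a` and `b`, so it cannot simply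
  -- be inserted. Only the piece of `Q` around `x` up to the nearest vertices `p`, `q` of `P` on
  -- both sides is used; inside, it does not meet `P`.
  obtain ⟨p, A₁, B₁, h1, hp, hA⟩ := exists_append_first_mem {y | y ∈ P.support} Q₁.reverse ha
  obtain ⟨q, A₂, B₂, rfl, hq, hA'⟩ := exists_append_first_mem {y | y ∈ P.support} Q₂ hb
  obtain rfl : Q₁ = B₁.reverse.append A₁.reverse := by
    rw [← Walk.reverse_append, ← h1, Walk.reverse_reverse]
  rw [← Walk.append_assoc, Walk.append_assoc (p := A₁.reverse)] at hQ
  have h2 := hQ.1.of_append_right.of_append_left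
  have h3 := hQ.2.of_append_right.of_append_left
  obtain ⟨P', hP', hs⟩ := hP.exists_replace h h2 h3 hp hq (by
    intro y hy hyP
    rcases mem_right_of_not_mem_left hy with hy | hy
    · exact Or.inl (hA y (by simpa using hy) hyP)
    · exact Or.inr (hA' y hy hyP))
  exact ⟨P', hP', hs (by simp [Walk.mem_support_append_iff])⟩

/-- A vertex lies in an interval if it lies on shortest walks between the ends and no other vertex
separates it from both ends with respect to shortest walks. -/
lemma mem_geodesicInterval_of_forall (h : NoNegativeCycle G w) {u v x : V}
    (A : G.Walk u x) (B : G.Walk x v) (hAB : IsShortestWalk G w (A.append B))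
    (hc : ∀ c, c ≠ x → (∃ Q : G.Walk x u, IsShortestWalk G w Q ∧ c ∉ Q.support) ∨
      ∃ Q : G.Walk x v, IsShortestWalk G w Q ∧ c ∉ Q.support) :
    x ∈ geodesicInterval G w u v := by
  classical
  -- Choose a shortest `u`–`v` path together with a walk of weight zero from `x` to it, with as few
  -- edges as possible. The claim is that `x` then lies on the path.
  let good : ℕ → Prop := fun m => ∃ (P : G.Walk u v) (p : V) (Q : G.Walk x p),
    IsShortestPath G w P ∧ p ∈ P.support ∧ walkWeight G w Q = 0 ∧ Q.length = m
  have hgood : ∃ m, good m := by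
    have hA : IsShortestWalk G w A.bypass := fun R =>
      (h.walkWeight_bypass_le A).trans (hAB.of_append_left R)
    have hB : IsShortestWalk G w B.bypass := fun R =>
      (h.walkWeight_bypass_le B).trans (hAB.of_append_right R)
    have hAB' : walkWeight G w A.bypass + walkWeight G w B.bypass ≤
        walkWeight G w (A.append B) := by
      simpa using add_le_add (h.walkWeight_bypass_le A) (h.walkWeight_bypass_le B)
    have hA' := A.bypass_isPath
    have hB' := B.bypass_isPath
    generalize A.bypass = A' at *
    generalize B.bypass = B' at *
    -- Let `y` be the first vertex of `A'` met when coming from `v` along `B'`. Skipping the detour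
    -- from `y` to `x` and back leaves a path, and by minimality the detour has weight zero; so `x`
    -- is joined to this path by a walk of weight zero.
    obtain ⟨y, B₁, B₂, h1, hy, hyA⟩ :=
      exists_append_first_mem {y | y ∈ A'.support} B'.reverse (by simp)
    obtain rfl : B' = B₂.reverse.append B₁.reverse := by
      rw [← Walk.reverse_append, ← h1, Walk.reverse_reverse]
    obtain ⟨A₁, A₂, rfl⟩ := Walk.mem_support_iff_exists_append.1 hy
    have h2 : walkWeight G w A₂ ≤ walkWeight G w B₂ := by
      simpa using hA.of_append_right B₂
    have h3 := hAB (A₁.append B₁.reverse)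
    have h4 := h.walkWeight_nonneg A₂
    have h6 := h.walkWeight_nonneg B₂
    simp only [walkWeight_append, walkWeight_reverse] at h3 hAB'
    refine ⟨_, A₁.append B₁.reverse, y, B₂.reverse, (isShortestPath_iff h).2 ⟨?_, fun R => ?_⟩, by
      simp [Walk.mem_support_append_iff], by simp only [walkWeight_reverse]; linarith, rfl⟩
    · refine isPath_append hA'.of_append_left hB'.of_append_right fun z hz hz' => ?_
      exact hyA z (by simpa using hz') (by simp [Walk.mem_support_append_iff, hz])
    · have := hAB R
      simp only [walkWeight_append, walkWeight_reverse] at this ⊢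
      linarith
  obtain ⟨P, p, Q, hP, hp, hQ0, hQl⟩ := Nat.find_spec hgood
  have hmin : ∀ m, good m → Nat.find hgood ≤ m := fun m hm => Nat.find_min' hgood hm
  rw [← hQl] at hmin
  clear hQl hgood hAB
  by_cases hxP : x ∈ P.support
  · exact ⟨P, hP, hxP⟩
  exfalso
  -- Stopping at the first vertex on `P` and removing loops makes `Q` no longer and keeps its weight
  -- zero.
  obtain ⟨p, Q, hQ, hp, hQP, hQ0, hmin⟩ : ∃ (p : V) (Q : G.Walk x p), Q.IsPath ∧ p ∈ P.support ∧
      (∀ y ∈ Q.support, y ∈ P.support → y = p) ∧ walkWeight G w Q = 0 ∧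
      ∀ m, good m → Q.length ≤ m := by
    obtain ⟨p', Q₁, Q₂, rfl, hp', hfirst⟩ := exists_append_first_mem {y | y ∈ P.support} Q hp
    have h1 := h.walkWeight_nonneg Q₁
    have h2 := h.walkWeight_nonneg Q₂
    have h3 := h.walkWeight_nonneg Q₁.bypass
    have h4 := h.walkWeight_bypass_le Q₁
    rw [walkWeight_append] at hQ0
    refine ⟨p', Q₁.bypass, Q₁.bypass_isPath, hp',
      fun y hy => hfirst y (Q₁.support_bypass_subset_support hy), by linarith, fun m hm => ?_⟩
    have h5 := hmin m hm
    have h6 := Q₁.length_bypass_le_length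
    rw [Walk.length_append] at h5
    omega
  have hpx : p ≠ x := fun e => hxP (e ▸ hp)
  obtain ⟨t, W, hW, hpW, ht⟩ : ∃ (t : V) (W : G.Walk x t), IsShortestWalk G w W ∧
      p ∉ W.support ∧ t ∈ P.support := by
    rcases hc p hpx with ⟨W, hW, hpW⟩ | ⟨W, hW, hpW⟩
    · exact ⟨u, W, hW, hpW, by simp⟩
    · exact ⟨v, W, hW, hpW, by simp⟩
  obtain ⟨q, W₁, W₂, rfl, hq, hW₁⟩ := exists_append_first_mem {y | y ∈ P.support} W ht
  replace hW := hW.of_append_left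
  replace hpW : p ∉ W₁.support := fun hp' => hpW (by simp [Walk.mem_support_append_iff, hp'])
  -- The walk `W₁` leaves `Q` for the last time at `y` and reaches `P` at `q`, never passing `p`.
  -- Going from `q` back to `y` and on along `Q` to `p` yields a path that meets `P` only in its
  -- ends; it is shortest since the part of `Q` has weight zero. Rerouting `P` along it brings `y`
  -- onto the path, and `y` is closer to `x` on `Q` than `p`.
  obtain ⟨y, C, D, h1, hy, hC⟩ :=
    exists_append_first_mem {y | y ∈ Q.support} W₁.reverse (by simp)
  obtain rfl : W₁ = D.reverse.append C.reverse := by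
    rw [← Walk.reverse_append, ← h1, Walk.reverse_reverse]
  obtain ⟨Q₁, Q₂, rfl⟩ := Walk.mem_support_iff_exists_append.1 hy
  have hyp : y ≠ p := by
    rintro rfl
    exact hpW (by simp [Walk.mem_support_append_iff])
  have h01 := h.walkWeight_nonneg Q₁
  have h02 := h.walkWeight_nonneg Q₂
  rw [walkWeight_append] at hQ0
  have hCC := h.walkWeight_bypass_le C
  obtain ⟨P', hP', hs⟩ := hP.exists_replace h (R := C.bypass.append Q₂)
    (isPath_append C.bypass_isPath hQ.of_append_right fun z hz hz' =>
      hC z (C.support_bypass_subset_support hz) (by simp [Walk.mem_support_append_iff, hz']))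
    (fun R => by
      have := hW.of_append_right (Q₂.append R.reverse)
      simp only [walkWeight_append, walkWeight_reverse] at this ⊢
      linarith) hq hp (by
      intro z hz hzP
      rcases mem_right_of_not_mem_left hz with hz | hz
      · refine Or.inl (hW₁ z ?_ hzP)
        have := C.support_bypass_subset_support hz
        simp [Walk.mem_support_append_iff, this]
      · exact Or.inr (hQP z (by simp [Walk.mem_support_append_iff, hz]) hzP))
  have := hmin Q₁.length ⟨P', y, Q₁, hP', hs (by simp [Walk.mem_support_append_iff]),
    by linarith, rfl⟩
  rw [Walk.length_append] at this
  have h7 : Q₂.length = 0 := by omega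
  exact hyp (Walk.eq_of_length_eq_zero h7)

/-- No vertex other than `x` separates a vertex `x` of an interval from both ends. -/
lemma exists_shortest_avoiding (h : NoNegativeCycle G w) {u v x : V}
    (hx : x ∈ geodesicInterval G w u v) :
    ∃ (A : G.Walk u x) (B : G.Walk x v), IsShortestWalk G w (A.append B) ∧
      ∀ c, c ≠ x → c ∉ A.support ∨ c ∉ B.support := by
  obtain ⟨P, hP, hx⟩ := hx
  rw [isShortestPath_iff h] at hP
  obtain ⟨A, B, rfl⟩ := Walk.mem_support_iff_exists_append.1 hx
  refine ⟨A, B, hP.2, fun c hc => ?_⟩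
  by_contra! hcon
  exact hc (eq_of_mem_of_isPath_append hP.1 hcon.1 hcon.2)

/-! ### Atoms: pieces of intervals determined by the separator -/

/-- A part of a shortest path that starts outside `Z` reaches `x` outside `Z` or meets `Z`. -/
lemma reachable_deleteVertices (Z : Finset V) {u x : V} (A : G.Walk u x)
    (hA : ∀ z ∈ A.support, z ∉ Z) :
    (deleteVertices G Z).Reachable ⟨u, hA u (by simp)⟩ ⟨x, hA x (by simp)⟩ := by
  induction A with
  | nil => rfl
  | @cons a b c e A ih =>
    have h1 : (deleteVertices G Z).Adj ⟨a, hA a (by simp)⟩ ⟨b, hA b (by simp)⟩ := e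
    exact h1.reachable.trans (ih fun z hz => hA z (by simp [hz]))

/-- The vertex `a` is in `Z` or in the same component of `G - Z` as `x`. -/
def InOrConnected (G : SimpleGraph V) (Z : Finset V) (a x : V) : Prop :=
  a ∈ Z ∨ ∃ (ha : a ∉ Z) (hx : x ∉ Z), (deleteVertices G Z).Reachable ⟨a, ha⟩ ⟨x, hx⟩

/-- The vertices of an interval for which each end is in `Z` or in their own component. -/
def localInterval (G : SimpleGraph V) (w : Sym2 V → ℚ) (Z : Finset V) (a b : V) : Set V :=
  {x | x ∈ geodesicInterval G w a b ∧ InOrConnected G Z a x ∧ InOrConnected G Z b x}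

/-- Any vertex of `Z` on the part before `x` can serve as `a`; if there is none, this part connects
`u` to `x` in `G - Z` and `a = u`. The same choice after `x` gives `b`. The subpath from `a` to `b`
is again shortest and contains `x`, and `geodesicInterval_subset` gives the inclusion. -/
lemma exists_mem_localInterval (h : NoNegativeCycle G w) (Z : Finset V) {u v x : V}
    (hx : x ∈ geodesicInterval G w u v) :
    ∃ a b, (a ∈ Z ∨ a = u) ∧ (b ∈ Z ∨ b = v) ∧ x ∈ localInterval G w Z a b ∧
      geodesicInterval G w a b ⊆ geodesicInterval G w u v := by
  obtain ⟨P, hP, hx⟩ := hx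
  have hP' := (isShortestPath_iff h).1 hP
  obtain ⟨A, B, rfl⟩ := Walk.mem_support_iff_exists_append.1 hx
  have key : ∀ {u x : V} (A : G.Walk u x), ∃ a, (a ∈ Z ∨ a = u) ∧ InOrConnected G Z a x ∧
      ∃ (A₁ : G.Walk u a) (A₂ : G.Walk a x), A = A₁.append A₂ := by
    intro u x A
    by_cases hz : ∃ z ∈ A.support, z ∈ Z
    · obtain ⟨z, hzA, hz⟩ := hz
      exact ⟨z, Or.inl hz, Or.inl hz, Walk.mem_support_iff_exists_append.1 hzA⟩
    · push Not at hz
      exact ⟨u, Or.inr rfl, Or.inr ⟨_, _, reachable_deleteVertices Z A hz⟩, Walk.nil, A, rfl⟩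
  obtain ⟨a, ha, hax, A₁, A₂, rfl⟩ := key A
  obtain ⟨b, hb, hbx, B₁, B₂, hB⟩ := key B.reverse
  obtain rfl : B = B₂.reverse.append B₁.reverse := by
    rw [← Walk.reverse_append, ← hB, Walk.reverse_reverse]
  have hsub := geodesicInterval_subset h hP (a := a) (b := b)
    (by simp [Walk.mem_support_append_iff]) (by simp [Walk.mem_support_append_iff])
  refine ⟨a, b, ha, hb, ⟨⟨A₂.append B₂.reverse, ?_, by simp [Walk.mem_support_append_iff]⟩,
    hax, hbx⟩, hsub⟩
  rw [← Walk.append_assoc, Walk.append_assoc (p := A₂)] at hP'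
  exact (isShortestPath_iff h).2
    ⟨hP'.1.of_append_right.of_append_left, hP'.2.of_append_right.of_append_left⟩

end ShortestWalks

/-! ### Branching on the atoms of an unmet constraint -/

section Branching

/-- A state of the branching: candidate sets for the solution vertices, a flag that records whether
all guesses were consistent, and the number that encodes the remaining guesses. -/
structure BranchState (V : Type) where
  cand : ℕ → Set V
  alive : Prop
  code : ℕ

/-- The last index below a bound that satisfies a predicate, plus one, and `0` if there is none. -/
noncomputable def lastIndex (P : ℕ → Prop) : ℕ → ℕ
  | 0 => 0
  | m + 1 => open Classical in if P m then m + 1 else lastIndex P m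

lemma lastIndex_eq_zero {P : ℕ → Prop} {m : ℕ} : lastIndex P m = 0 ↔ ∀ i < m, ¬ P i := by
  classical
  induction m with
  | zero => simp [lastIndex]
  | succ m ih =>
    rw [lastIndex]
    split_ifs with h
    · simp only [false_iff, not_forall, not_not]
      exact ⟨m, by omega, h⟩
    · rw [ih]
      refine ⟨fun H i hi => ?_, fun H i hi => H i (by omega)⟩
      rcases Nat.lt_succ_iff_lt_or_eq.1 hi with hi | rfl
      · exact H i hi
      · exact h

lemma lastIndex_eq_succ {P : ℕ → Prop} {m e : ℕ} (h : lastIndex P m = e + 1) : e < m ∧ P e := by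
  classical
  induction m with
  | zero => simp [lastIndex] at h
  | succ m ih =>
    rw [lastIndex] at h
    split_ifs at h with hm
    · obtain rfl : m = e := by omega
      exact ⟨by omega, hm⟩
    · exact ⟨(ih h).1.trans (by omega), (ih h).2⟩

variable {V : Type} (k m : ℕ) (N : ℕ) (T : ℕ → Prop) (J : ℕ → Set V) (At : ℕ → ℕ → ℕ → Set V)

/-- The constraint `e` is present and no candidate set lies inside it. -/
def Unmet (R : ℕ → Set V) (e : ℕ) : Prop := T e ∧ ∀ i < k, ¬ R i ⊆ J e

/-- One round of the branching: the last unmet constraint is chosen, a guessed candidate set is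
intersected with a guessed atom of the constraint. -/
noncomputable def branchStep (σ : BranchState V) : BranchState V :=
  match lastIndex (Unmet k T J σ.cand) N with
  | 0 => σ
  | e + 1 =>
    -- The modulus is `k + 1` to stay positive for `k = 0`; the set with index `k` is a dummy that
    -- `Unmet` never looks at.
    let i := σ.code % (k + 1)
    let c := σ.code / (k + 1)
    let A := σ.cand i ∩ At e (c % m) (c / m % m)
    ⟨Function.update σ.cand i A, σ.alive ∧ A.Nonempty ∧ A ⊆ J e, c / m / m⟩

variable {k m N T J At}

lemma branchStep_alive {σ : BranchState V} (h : (branchStep k m N T J At σ).alive) :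
    σ.alive := by
  unfold branchStep at h
  split at h
  · exact h
  · exact h.1

lemma branchStep_nonempty {σ : BranchState V} (hσ : ∀ i, (σ.cand i).Nonempty)
    (h : (branchStep k m N T J At σ).alive) (i : ℕ) :
    ((branchStep k m N T J At σ).cand i).Nonempty := by
  unfold branchStep at h ⊢
  split at h
  · exact hσ i
  · by_cases hi : i = σ.code % (k + 1)
    · subst hi
      simpa using h.2.1
    · simpa [Function.update_of_ne hi] using hσ i

lemma iterate_branchStep_nonempty {σ : BranchState V} (hσ : ∀ i, (σ.cand i).Nonempty) (r : ℕ)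
    (h : ((branchStep k m N T J At)^[r] σ).alive) (i : ℕ) :
    (((branchStep k m N T J At)^[r] σ).cand i).Nonempty := by
  induction r generalizing i with
  | zero => exact hσ i
  | succ r ih =>
    rw [Function.iterate_succ_apply'] at h ⊢
    exact branchStep_nonempty (ih (branchStep_alive h)) h i

/-- The start of the branching. -/
def branchInit (g : ℕ) : BranchState V := ⟨fun _ => Set.univ, True, g⟩

/-- The guesses encoded by `g` lead to candidate sets that meet all constraints. -/
def Accepts (k m N : ℕ) (T : ℕ → Prop) (J : ℕ → Set V) (At : ℕ → ℕ → ℕ → Set V) (L g : ℕ) : Prop :=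
  ((branchStep k m N T J At)^[L] (branchInit g)).alive ∧
    lastIndex (Unmet k T J ((branchStep k m N T J At)^[L] (branchInit g)).cand) N = 0

/-- Soundness does not depend on how the guesses arose: while the flag holds, all candidate sets are
nonempty, and a vertex picked from a set inside an interval hits that interval. Without constraints
the empty set is taken, since there may be no vertex to pick. -/
lemma Accepts.exists_hitting {L g : ℕ} (h : Accepts k m N T J At L g)
    (hne : ∀ e < N, T e → Nonempty V) :
    ∃ S : Finset V, S.card ≤ k ∧ ∀ e < N, T e → ∃ x ∈ S, x ∈ J e := by
  classical
  obtain ⟨hal, hlast⟩ := h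
  by_cases hE : ∃ e < N, T e
  swap
  · exact ⟨∅, by simp, fun e he hT => absurd ⟨e, he, hT⟩ hE⟩
  obtain ⟨e₀, he₀, hT₀⟩ := hE
  have := hne e₀ he₀ hT₀
  have hn := iterate_branchStep_nonempty (σ := branchInit g) (fun i => Set.univ_nonempty) L hal
  choose s hs using hn
  refine ⟨(Finset.range k).image s, Finset.card_image_le.trans (by simp), fun e he hT => ?_⟩
  have := lastIndex_eq_zero.1 hlast e he
  simp only [Unmet, not_and, not_forall, not_not] at this
  obtain ⟨i, hi, hsub⟩ := this hT
  exact ⟨s i, Finset.mem_image_of_mem _ (by simpa using hi), hsub (hs i)⟩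

/-! ### Completeness of the branching by a potential function -/

section Complete

variable {s : ℕ → V} {F : V → Finset (Set V)}

open Classical in
/-- The number of atoms around the solution vertices that contain the candidate sets. -/
noncomputable def atomCount (k : ℕ) (s : ℕ → V) (F : V → Finset (Set V)) (R : ℕ → Set V) : ℕ :=
  ∑ i ∈ Finset.range k, ((F (s i)).filter fun A => R i ⊆ A).card

lemma atomCount_le {Δ : ℕ} (hF : ∀ x, (F x).card ≤ Δ) (R : ℕ → Set V) :
    atomCount k s F R ≤ k * Δ := by
  classical
  refine (Finset.sum_le_card_nsmul _ _ Δ fun i _ =>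
    (Finset.card_filter_le _ _).trans (hF (s i))).trans (by simp)

/-- The guesses are read off a solution `s` with `s i ∈ R i`. An unmet constraint `e` is hit by some
`s i`, which lies in an atom `A ⊆ J e`. Replacing `R i` by `R i ∩ A` keeps `s i` and raises
`atomCount`: `A` is a new superset, as `R i ⊆ A` would have given `R i ⊆ J e`. The number `h` stands
for the digits of later rounds, on which the first `r` rounds do not depend. -/
lemma exists_code (hm : 0 < m)
    (hs : ∀ e < N, T e → ∃ i < k, s i ∈ J e)
    (hcover : ∀ e < N, T e → ∀ x ∈ J e, ∃ d₁ < m, ∃ d₂ < m, x ∈ At e d₁ d₂ ∧ At e d₁ d₂ ⊆ J e)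
    (hF : ∀ e < N, T e → ∀ x, ∀ d₁ < m, ∀ d₂ < m, x ∈ At e d₁ d₂ → At e d₁ d₂ ∈ F x)
    (r : ℕ) (R : ℕ → Set V) (hR : ∀ i < k, s i ∈ R i) :
    ∃ g < ((k + 1) * m * m) ^ r, ∀ h : ℕ,
      let σ := (branchStep k m N T J At)^[r] ⟨R, True, g + ((k + 1) * m * m) ^ r * h⟩
      σ.alive ∧ (lastIndex (Unmet k T J σ.cand) N = 0 ∨
        atomCount k s F R + r ≤ atomCount k s F σ.cand) := by
  classical
  induction r generalizing R with
  | zero => exact ⟨0, by simp, fun h => by simp⟩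
  | succ r ih =>
    set B := (k + 1) * m * m with hB
    have hBpos : 0 < B := by positivity
    by_cases h0 : lastIndex (Unmet k T J R) N = 0
    · refine ⟨0, by positivity, fun h => ?_⟩
      have hfix : ∀ (r c : ℕ), (branchStep k m N T J At)^[r] ⟨R, True, c⟩ = ⟨R, True, c⟩ := by
        intro r c
        induction r with
        | zero => rfl
        | succ r ih =>
          rw [Function.iterate_succ_apply', ih]
          unfold branchStep
          simp [h0]
      simp [hfix, h0]
    · obtain ⟨e, he⟩ := Nat.exists_eq_succ_of_ne_zero h0
      obtain ⟨heN, hT, hun⟩ := lastIndex_eq_succ he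
      obtain ⟨i, hi, hsi⟩ := hs e heN hT
      obtain ⟨d₁, hd₁, d₂, hd₂, hsA, hAJ⟩ := hcover e heN hT _ hsi
      set R' := Function.update R i (R i ∩ At e d₁ d₂) with hR'
      have hR's : ∀ j < k, s j ∈ R' j := by
        intro j hj
        by_cases hji : j = i
        · subst hji
          simpa [hR'] using ⟨hR j hj, hsA⟩
        · simpa [hR', Function.update_of_ne hji] using hR j hj
      obtain ⟨g, hg, hgr⟩ := ih R' hR's
      -- The lowest digit in base `B` packs `i`, `d₁` and `d₂`; one round consumes exactly this
      -- digit.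
      have hstep : ∀ c : ℕ, branchStep k m N T J At
          ⟨R, True, (i + (k + 1) * (d₁ + m * d₂)) + B * c⟩ = ⟨R', True, c⟩ := by
        intro c
        have e1 : (i + (k + 1) * (d₁ + m * d₂)) + B * c =
            i + (k + 1) * (d₁ + m * (d₂ + m * c)) := by rw [hB]; ring
        have e2 : (i + (k + 1) * (d₁ + m * (d₂ + m * c))) % (k + 1) = i := by
          rw [Nat.add_mul_mod_self_left, Nat.mod_eq_of_lt (by omega)]
        have e3 : (i + (k + 1) * (d₁ + m * (d₂ + m * c))) / (k + 1) =
            d₁ + m * (d₂ + m * c) := by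
          rw [Nat.add_mul_div_left _ _ (by omega), Nat.div_eq_of_lt (by omega), zero_add]
        have e4 : (d₁ + m * (d₂ + m * c)) % m = d₁ := by
          rw [Nat.add_mul_mod_self_left, Nat.mod_eq_of_lt hd₁]
        have e5 : (d₁ + m * (d₂ + m * c)) / m = d₂ + m * c := by
          rw [Nat.add_mul_div_left _ _ hm, Nat.div_eq_of_lt hd₁, zero_add]
        have e6 : (d₂ + m * c) % m = d₂ := by
          rw [Nat.add_mul_mod_self_left, Nat.mod_eq_of_lt hd₂]
        have e7 : (d₂ + m * c) / m = c := by
          rw [Nat.add_mul_div_left _ _ hm, Nat.div_eq_of_lt hd₂, zero_add]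
        unfold branchStep
        simp only [he, e1, e2, e3, e4, e5, e6, e7]
        have : (True ∧ (R i ∩ At e d₁ d₂).Nonempty ∧ R i ∩ At e d₁ d₂ ⊆ J e) = True :=
          eq_true ⟨trivial, ⟨s i, hR i hi, hsA⟩, Set.inter_subset_right.trans hAJ⟩
        rw [this]
      have hcount : atomCount k s F R + 1 ≤ atomCount k s F R' := by
        refine Nat.succ_le_of_lt (Finset.sum_lt_sum (fun j _ => ?_) ⟨i, by simpa using hi, ?_⟩)
        · refine Finset.card_le_card fun A hA => ?_
          simp only [Finset.mem_filter] at hA ⊢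
          refine ⟨hA.1, Set.Subset.trans ?_ hA.2⟩
          by_cases hji : j = i
          · subst hji
            simp [hR']
          · simp [hR', Function.update_of_ne hji]
        · refine Finset.card_lt_card ⟨fun A hA => ?_, fun hsub => ?_⟩
          · simp only [Finset.mem_filter] at hA ⊢
            exact ⟨hA.1, Set.Subset.trans (by simp [hR']) hA.2⟩
          · have hmem : At e d₁ d₂ ∈ (F (s i)).filter fun A => R' i ⊆ A :=
              Finset.mem_filter.2 ⟨hF e heN hT _ d₁ hd₁ d₂ hd₂ hsA, by simp [hR']⟩
            exact hun i hi ((Finset.mem_filter.1 (hsub hmem)).2.trans hAJ)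
      have hlt : i + (k + 1) * (d₁ + m * d₂) < B := by
        have h1 : d₁ + m * d₂ + 1 ≤ m * m := by
          calc d₁ + m * d₂ + 1 ≤ m + m * d₂ := by omega
            _ = m * (d₂ + 1) := by ring
            _ ≤ m * m := Nat.mul_le_mul_left _ hd₂
        calc i + (k + 1) * (d₁ + m * d₂) < (k + 1) + (k + 1) * (d₁ + m * d₂) := by omega
          _ = (k + 1) * (d₁ + m * d₂ + 1) := by ring
          _ ≤ (k + 1) * (m * m) := Nat.mul_le_mul_left _ h1
          _ = B := by rw [hB]; ring
      refine ⟨(i + (k + 1) * (d₁ + m * d₂)) + B * g, ?_, fun h => ?_⟩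
      · calc _ < B + B * g := by omega
          _ = B * (g + 1) := by ring
          _ ≤ B * B ^ r := Nat.mul_le_mul_left _ hg
          _ = B ^ (r + 1) := by ring
      · have e8 : (i + (k + 1) * (d₁ + m * d₂)) + B * g + B ^ (r + 1) * h =
            (i + (k + 1) * (d₁ + m * d₂)) + B * (g + B ^ r * h) := by ring
        rw [e8, Function.iterate_succ_apply, hstep]
        obtain ⟨h1, h2⟩ := hgr h
        exact ⟨h1, h2.imp id fun h2 => by omega⟩

/-- The potential never exceeds `k * Δ`, so it cannot have grown by `k * Δ + 1`; hence every
constraint is met at the end. -/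
lemma exists_accepts (hm : 0 < m)
    (hs : ∀ e < N, T e → ∃ i < k, s i ∈ J e)
    (hcover : ∀ e < N, T e → ∀ x ∈ J e, ∃ d₁ < m, ∃ d₂ < m, x ∈ At e d₁ d₂ ∧ At e d₁ d₂ ⊆ J e)
    (hF : ∀ e < N, T e → ∀ x, ∀ d₁ < m, ∀ d₂ < m, x ∈ At e d₁ d₂ → At e d₁ d₂ ∈ F x)
    {Δ : ℕ} (hΔ : ∀ x, (F x).card ≤ Δ) :
    ∃ g < ((k + 1) * m * m) ^ (k * Δ + 1), Accepts k m N T J At (k * Δ + 1) g := by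
  obtain ⟨g, hg, h⟩ := exists_code hm hs hcover hF (k * Δ + 1) (fun _ => Set.univ)
    fun _ _ => Set.mem_univ _
  refine ⟨g, hg, ?_⟩
  have := h 0
  simp only [mul_zero, add_zero] at this
  refine ⟨this.1, this.2.resolve_right fun h' => ?_⟩
  have := atomCount_le (k := k) (s := s) hΔ
    ((branchStep k m N T J At)^[k * Δ + 1] ⟨fun _ => Set.univ, True, g⟩).cand
  omega

end Complete

/-- The branching with all guesses decides whether the constraints have a small hitting set. -/
theorem exists_accepts_iff (hm : 0 < m) (hne : ∀ e < N, T e → Nonempty V)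
    (hcover : ∀ e < N, T e → ∀ x ∈ J e, ∃ d₁ < m, ∃ d₂ < m, x ∈ At e d₁ d₂ ∧ At e d₁ d₂ ⊆ J e)
    {F : V → Finset (Set V)}
    (hF : ∀ e < N, T e → ∀ x, ∀ d₁ < m, ∀ d₂ < m, x ∈ At e d₁ d₂ → At e d₁ d₂ ∈ F x)
    {Δ : ℕ} (hΔ : ∀ x, (F x).card ≤ Δ) :
    (∃ g < ((k + 1) * m * m) ^ (k * Δ + 1), Accepts k m N T J At (k * Δ + 1) g) ↔
      ∃ S : Finset V, S.card ≤ k ∧ ∀ e < N, T e → ∃ x ∈ S, x ∈ J e := by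
  classical
  refine ⟨fun ⟨g, _, hg⟩ => hg.exists_hitting hne, fun ⟨S, hSk, hS⟩ => ?_⟩
  by_cases hSn : S.Nonempty
  · obtain ⟨x₀, hx₀⟩ := hSn
    -- A solution with fewer than `k` vertices is padded with `x₀`.
    let s : ℕ → V := fun i => S.toList.getD i x₀
    refine exists_accepts (s := s) hm (fun e he hT => ?_) hcover hF hΔ
    obtain ⟨x, hx, hxJ⟩ := hS e he hT
    obtain ⟨i, hi, rfl⟩ := List.getElem_of_mem (Finset.mem_toList.2 hx)
    refine ⟨i, lt_of_lt_of_le hi (by simpa using hSk), ?_⟩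
    simpa [s, List.getD_eq_getElem?_getD, List.getElem?_eq_getElem hi] using hxJ
  -- An empty solution hits nothing, so there are no constraints and the initial state is already
  -- accepted.
  · have hE : ∀ e < N, ¬ T e := fun e he hT => by
      obtain ⟨x, hx, -⟩ := hS e he hT
      exact hSn ⟨x, hx⟩
    have h0 : ∀ R : ℕ → Set V, lastIndex (Unmet k T J R) N = 0 := fun R =>
      lastIndex_eq_zero.2 fun e he h => hE e he h.1
    refine ⟨0, by positivity, ?_⟩
    have : ∀ r, (branchStep k m N T J At)^[r] (branchInit 0) = branchInit 0 := by
      intro r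
      induction r with
      | zero => rfl
      | succ r ih =>
        rw [Function.iterate_succ_apply', ih]
        unfold branchStep
        simp [h0]
    exact ⟨by rw [this]; trivial, h0 _⟩

end Branching

/-! ### Structured programs and their time bounds -/

namespace RAM

/-- Boundedness by a polynomial. -/
def PolyBounded (f : ℕ → ℕ) : Prop := ∃ c d : ℕ, ∀ X, f X ≤ c * (X + 1) ^ d

lemma PolyBounded.const (a : ℕ) : PolyBounded fun _ => a := ⟨a, 0, by simp⟩

lemma PolyBounded.id : PolyBounded fun X => X := ⟨1, 1, by simp⟩

lemma PolyBounded.add {f g : ℕ → ℕ} (hf : PolyBounded f) (hg : PolyBounded g) :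
    PolyBounded fun X => f X + g X := by
  obtain ⟨c, d, hf⟩ := hf
  obtain ⟨c', d', hg⟩ := hg
  refine ⟨c + c', d + d', fun X => ?_⟩
  have h1 : (X + 1) ^ d ≤ (X + 1) ^ (d + d') := Nat.pow_le_pow_right (by omega) (by omega)
  have h2 : (X + 1) ^ d' ≤ (X + 1) ^ (d + d') := Nat.pow_le_pow_right (by omega) (by omega)
  calc f X + g X ≤ c * (X + 1) ^ d + c' * (X + 1) ^ d' := add_le_add (hf X) (hg X)
    _ ≤ c * (X + 1) ^ (d + d') + c' * (X + 1) ^ (d + d') := by gcongr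
    _ = _ := by ring

lemma PolyBounded.mul {f g : ℕ → ℕ} (hf : PolyBounded f) (hg : PolyBounded g) :
    PolyBounded fun X => f X * g X := by
  obtain ⟨c, d, hf⟩ := hf
  obtain ⟨c', d', hg⟩ := hg
  refine ⟨c * c', d + d', fun X => ?_⟩
  calc f X * g X ≤ (c * (X + 1) ^ d) * (c' * (X + 1) ^ d') := Nat.mul_le_mul (hf X) (hg X)
    _ = _ := by ring

/-- A bound on the length of the value of a term on memories with entries of at most `X` bits. -/
def Term.lenBound (X : ℕ) : Term → ℕ
  | .const z => len z
  | .load _ => X + 1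
  | .op _ a b => a.lenBound X + b.lenBound X + 1

/-- A bound on the cost of evaluating a term. -/
def Term.costBound (X : ℕ) : Term → ℕ
  | .const z => len z
  | .load a => a.costBound X + a.lenBound X + (X + 1)
  | .op _ a b => a.costBound X + b.costBound X + a.lenBound X + b.lenBound X

/-- A bound on the running time if all loops take at most `X` rounds. -/
def Program.timeBound (X : ℕ) : Program → ℕ
  | .skip => 1
  | .store a e => a.costBound X + e.costBound X + a.lenBound X + e.lenBound X
  | .seq P Q => P.timeBound X + Q.timeBound X
  | .cond e P Q => e.costBound X + e.lenBound X + (P.timeBound X + Q.timeBound X)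
  | .loop e P => (X + 1) * (e.costBound X + e.lenBound X + P.timeBound X)

lemma Term.polyBounded_lenBound (e : Term) : PolyBounded fun X => e.lenBound X := by
  induction e with
  | const z => exact .const _
  | load a => exact PolyBounded.id.add (.const 1)
  | op o a b ha hb => exact (ha.add hb).add (.const 1)

lemma Term.polyBounded_costBound (e : Term) : PolyBounded fun X => e.costBound X := by
  induction e with
  | const z => exact .const _
  | load a ha => exact (ha.add a.polyBounded_lenBound).add (PolyBounded.id.add (.const 1))
  | op o a b ha hb => exact ((ha.add hb).add a.polyBounded_lenBound).add b.polyBounded_lenBound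

/-- Each loop contributes a factor `X + 1`, so the degree depends only on the nesting in the fixed
program. Any `X` that bounds bit lengths and loop rounds therefore gives a time polynomial in `X`.
-/
lemma Program.polyBounded_timeBound (P : Program) : PolyBounded fun X => P.timeBound X := by
  induction P with
  | skip => exact .const _
  | store a e =>
    exact ((a.polyBounded_costBound.add e.polyBounded_costBound).add
      a.polyBounded_lenBound).add e.polyBounded_lenBound
  | seq P Q hP hQ => exact hP.add hQ
  | cond e P Q hP hQ =>
    exact (e.polyBounded_costBound.add e.polyBounded_lenBound).add (hP.add hQ)
  | loop e P hP =>
    exact (PolyBounded.id.add (.const 1)).mul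
      ((e.polyBounded_costBound.add e.polyBounded_lenBound).add hP)

/-- The integer `z` has at most `X` bits. -/
def Fits (X : ℕ) (z : ℤ) : Prop := z.natAbs < 2 ^ X

/-- All entries of the memory have at most `X` bits. -/
def Bounded (X : ℕ) (M : Mem) : Prop := ∀ a, Fits X (M a)

lemma len_le_of_fits {X : ℕ} {z : ℤ} (h : Fits X z) : len z ≤ X + 1 := by
  simpa [len, Fits, Nat.size_le] using h

lemma natAbs_lt_two_pow_len (z : ℤ) : z.natAbs < 2 ^ (len z - 1) := by
  simpa [len] using Nat.lt_size_self z.natAbs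

lemma natAbs_fdiv_le (a b : ℤ) : (Int.fdiv a b).natAbs ≤ a.natAbs := by
  rcases eq_or_ne b 0 with rfl | hb
  · simp
  have key : ∀ a b : ℤ, 0 < b → (Int.fdiv a b).natAbs ≤ a.natAbs := by
    intro a b hb
    rw [Int.fdiv_eq_ediv_of_nonneg _ hb.le]
    rcases le_or_gt 0 a with ha | ha
    · have h1 := Int.ediv_nonneg ha hb.le
      have h2 := Int.ediv_le_self b ha
      omega
    · have h1 : a ≤ a / b := by
        rw [Int.le_ediv_iff_mul_le hb]
        nlinarith
      have h2 : a / b < 0 := Int.ediv_neg_of_neg_of_pos ha hb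
      omega
  rcases lt_or_gt_of_ne hb with hb | hb
  · have := key (-a) (-b) (by omega)
    rwa [Int.neg_fdiv_neg, Int.natAbs_neg] at this
  · exact key a b hb

lemma BinOp.len_eval_le (o : BinOp) (a b : ℤ) : len (o.eval a b) ≤ len a + len b + 1 := by
  have h1 : ∀ z : ℤ, z.natAbs ≤ 1 → len z ≤ len a + len b + 1 := by
    intro z hz
    have : z.natAbs.size ≤ 1 := Nat.size_le.2 (by omega)
    simp only [len]
    omega
  have ha := Nat.lt_size_self a.natAbs
  have hb := Nat.lt_size_self b.natAbs
  set s := a.natAbs.size with hs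
  set t := b.natAbs.size with ht
  have hst : 2 ^ s ≤ 2 ^ (s + t) := Nat.pow_le_pow_right (by norm_num) (by omega)
  have hts : 2 ^ t ≤ 2 ^ (s + t) := Nat.pow_le_pow_right (by norm_num) (by omega)
  have hadd : ∀ z : ℤ, z.natAbs ≤ a.natAbs + b.natAbs → len z ≤ len a + len b + 1 := by
    intro z hz
    have : z.natAbs.size ≤ s + t + 1 := Nat.size_le.2 (by rw [pow_succ]; omega)
    simp only [len]
    omega
  cases o with
  | add => exact hadd _ (Int.natAbs_add_le a b)
  | sub => exact hadd _ (by simp only [BinOp.eval]; omega)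
  | mul =>
    have : (a * b).natAbs.size ≤ s + t := Nat.size_le.2 (by
      rw [Int.natAbs_mul, pow_add]
      exact Nat.mul_lt_mul'' ha hb)
    simp only [BinOp.eval, len]
    omega
  | div => exact hadd _ (by have := natAbs_fdiv_le a b; simp only [BinOp.eval]; omega)
  | eq => exact h1 _ (by simp only [BinOp.eval]; split_ifs <;> simp)
  | lt => exact h1 _ (by simp only [BinOp.eval]; split_ifs <;> simp)

lemma Term.len_eval_le {X : ℕ} {M : Mem} (hM : Bounded X M) (e : Term) :
    len (e.eval M) ≤ e.lenBound X := by
  induction e with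
  | const z => exact le_rfl
  | load a => exact len_le_of_fits (hM _)
  | op o a b ha hb =>
    have := o.len_eval_le (a.eval M) (b.eval M)
    simp only [Term.eval, Term.lenBound]
    omega

lemma Term.cost_le {X : ℕ} {M : Mem} (hM : Bounded X M) (e : Term) :
    e.cost M ≤ e.costBound X := by
  induction e with
  | const z => exact le_rfl
  | load a ha =>
    have h1 := a.len_eval_le hM
    have h2 := len_le_of_fits (hM (a.eval M))
    simp only [Term.cost, Term.costBound]
    omega
  | op o a b ha hb =>
    have h1 := a.len_eval_le hM
    have h2 := b.len_eval_le hM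
    simp only [Term.cost, Term.costBound]
    omega

/-- Started on `M` with entries of at most `X` bits, the program `P` halts in time, keeps the
entries that short, and establishes `Q`. -/
def wp (X : ℕ) (P : Program) (M : Mem) (Q : Mem → Prop) : Prop :=
  Bounded X M → ∃ M' t, Exec P M M' t ∧ t ≤ P.timeBound X ∧ Bounded X M' ∧ Q M'

/-! ### Rules for proving correctness together with the time bound -/

section Rules

variable {X : ℕ} {P P' : Program} {M : Mem} {Q Q' : Mem → Prop}

lemma wp_mono (h : wp X P M Q) (hQ : ∀ M', Q M' → Q' M') : wp X P M Q' := fun hM => by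
  obtain ⟨M', t, h1, h2, h3, h4⟩ := h hM
  exact ⟨M', t, h1, h2, h3, hQ _ h4⟩

lemma wp_skip (h : Q M) : wp X .skip M Q := fun hM => ⟨M, 1, .skip M, le_rfl, hM, h⟩

lemma wp_store {a e : Term} (he : Fits X (e.eval M))
    (h : Q (Function.update M (a.eval M) (e.eval M))) : wp X (.store a e) M Q := fun hM => by
  refine ⟨_, _, .store a e M, ?_, fun b => ?_, h⟩
  · exact add_le_add (add_le_add (add_le_add (a.cost_le hM) (e.cost_le hM)) (a.len_eval_le hM))
      (e.len_eval_le hM)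
  · by_cases hb : b = a.eval M
    · subst hb
      simpa using he
    · simpa [Function.update_of_ne hb] using hM b

lemma wp_seq (h : wp X P M fun M' => wp X P' M' Q) : wp X (.seq P P') M Q := fun hM => by
  obtain ⟨M₁, s, h1, h2, h3, h4⟩ := h hM
  obtain ⟨M₂, t, h5, h6, h7, h8⟩ := h4 h3
  exact ⟨M₂, s + t, .seq h1 h5, add_le_add h2 h6, h7, h8⟩

lemma wp_cond {e : Term} (h₁ : e.eval M ≠ 0 → wp X P M Q) (h₂ : e.eval M = 0 → wp X P' M Q) :
    wp X (.cond e P P') M Q := fun hM => by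
  have hc := e.cost_le hM
  have hl := e.len_eval_le hM
  by_cases he : e.eval M = 0
  · obtain ⟨M', t, h1, h2, h3, h4⟩ := h₂ he hM
    exact ⟨M', _, .cond_false he h1, by simp only [Program.timeBound]; omega, h3, h4⟩
  · obtain ⟨M', t, h1, h2, h3, h4⟩ := h₁ he hM
    exact ⟨M', _, .cond_true he h1, by simp only [Program.timeBound]; omega, h3, h4⟩

/-- The invariant is indexed by the number of completed rounds, which serves as the termination
measure; the induction runs over the rounds still to come. Since `N ≤ X`, the time is covered by the
factor `X + 1` of `timeBound`. -/
lemma wp_loop {e : Term} {N : ℕ} (hN : N ≤ X) (I : ℕ → Mem → Prop) (h0 : I 0 M)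
    (hstep : ∀ j < N, ∀ M, I j M → e.eval M ≠ 0 ∧ wp X P M (I (j + 1)))
    (hend : ∀ M, I N M → e.eval M = 0 ∧ Q M) : wp X (.loop e P) M Q := fun hM => by
  set c := e.costBound X + e.lenBound X with hc
  have key : ∀ m ≤ N, ∀ M, I (N - m) M → Bounded X M →
      ∃ M' t, Exec (.loop e P) M M' t ∧ t ≤ c + m * (c + P.timeBound X) ∧ Bounded X M' ∧ Q M' := by
    intro m
    induction m with
    | zero =>
      intro _ M hI hM
      obtain ⟨he, hQ⟩ := hend M hI
      exact ⟨M, _, .loop_false he, by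
        have hc := e.cost_le hM
        have hl := e.len_eval_le hM
        omega, hM, hQ⟩
    | succ m ih =>
      intro hm M hI hM
      obtain ⟨he, hP⟩ := hstep _ (by omega) M hI
      obtain ⟨M₁, s, h1, h2, h3, h4⟩ := hP hM
      rw [show N - (m + 1) + 1 = N - m by omega] at h4
      obtain ⟨M₂, t, h5, h6, h7, h8⟩ := ih (by omega) M₁ h4 h3
      refine ⟨M₂, _, .loop_true he h1 h5, ?_, h7, h8⟩
      have hc := e.cost_le hM
      have hl := e.len_eval_le hM
      rw [add_mul, one_mul]
      omega
  obtain ⟨M', t, h1, h2, h3, h4⟩ := key N le_rfl M (by simpa using h0) hM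
  refine ⟨M', t, h1, h2.trans ?_, h3, h4⟩
  have h5 : N * (c + P.timeBound X) ≤ X * (c + P.timeBound X) := Nat.mul_le_mul_right _ hN
  simp only [Program.timeBound, ← hc]
  rw [add_mul, one_mul]
  omega

end Rules

/-! ### Registers and arrays -/

/-- Names of arrays. A register is the entry `0` of an array. -/
inductive Reg
  | n | k | p | q | num | pd | sum | inf | w | tm | zf | zl | zc | d | itv | len | base | total
  | cand | alive | code | found | round | ans
  | i | j | x | c | a | b | e | t | s | u | v | m
  deriving DecidableEq

lemma Reg.ctorIdx_injective : Function.Injective Reg.ctorIdx :=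
  Function.LeftInverse.injective (g := Reg.ofNat) fun r => by cases r <;> rfl

lemma Reg.ctorIdx_lt (r : Reg) : r.ctorIdx < 64 := by cases r <;> decide

/-- The address of an array entry. Entries with nonnegative index are at negative addresses. -/
def address (r : Reg) (i : ℤ) : ℤ := ((r.ctorIdx : ℤ) - 64) - 64 * i

lemma address_inj {r r' : Reg} {i i' : ℤ} : address r i = address r' i' ↔ r = r' ∧ i = i' := by
  refine ⟨fun h => ?_, by rintro ⟨rfl, rfl⟩; rfl⟩
  have h1 := r.ctorIdx_lt
  have h2 := r'.ctorIdx_lt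
  simp only [address] at h
  exact ⟨Reg.ctorIdx_injective (by omega), by omega⟩

/-- The work arrays live at negative addresses, so the input in the nonnegative cells is never
overwritten by them. -/
lemma address_neg {r : Reg} {i : ℤ} (hi : 0 ≤ i) : address r i < 0 := by
  have h1 := r.ctorIdx_lt
  simp only [address]
  omega

/-- The content of an array entry. -/
def get (M : Mem) (r : Reg) (i : ℤ) : ℤ := M (address r i)

/-- Overwriting an array entry. -/
def set (M : Mem) (r : Reg) (i z : ℤ) : Mem := Function.update M (address r i) z

@[simp] lemma get_set (M : Mem) (r r' : Reg) (i i' z : ℤ) :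
    get (set M r i z) r' i' = if r' = r ∧ i' = i then z else get M r' i' := by
  simp [get, set, Function.update_apply, address_inj]

lemma set_apply_of_nonneg (M : Mem) {r : Reg} {i z a : ℤ} (hi : 0 ≤ i) (ha : 0 ≤ a) :
    set M r i z a = M a := by
  have := address_neg (r := r) hi
  exact Function.update_of_ne (by omega) _ _

instance : Add Term := ⟨.op .add⟩
instance : Sub Term := ⟨.op .sub⟩
instance : Mul Term := ⟨.op .mul⟩
instance : Div Term := ⟨.op .div⟩
instance (m : ℕ) : OfNat Term m := ⟨.const m⟩

/-- The test for equality. -/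
def Term.eq (a b : Term) : Term := .op .eq a b

/-- The test for being smaller. -/
def Term.lt (a b : Term) : Term := .op .lt a b

/-- The address of an array entry, as a term. -/
def entryAddress (r : Reg) (t : Term) : Term := .const ((r.ctorIdx : ℤ) - 64) - 64 * t

/-- An array entry. -/
def entry (r : Reg) (t : Term) : Term := .load (entryAddress r t)

/-- A register. -/
def reg (r : Reg) : Term := entry r 0

@[simp] lemma eval_add (M : Mem) (a b : Term) : (a + b).eval M = a.eval M + b.eval M := rfl
@[simp] lemma eval_sub (M : Mem) (a b : Term) : (a - b).eval M = a.eval M - b.eval M := rfl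
@[simp] lemma eval_mul (M : Mem) (a b : Term) : (a * b).eval M = a.eval M * b.eval M := rfl
@[simp] lemma eval_div (M : Mem) (a b : Term) :
    (a / b).eval M = Int.fdiv (a.eval M) (b.eval M) := rfl
@[simp] lemma eval_ofNat (M : Mem) (m : ℕ) [m.AtLeastTwo] :
    Term.eval M (no_index (OfNat.ofNat m)) = OfNat.ofNat m := rfl
@[simp] lemma eval_zero (M : Mem) : (0 : Term).eval M = 0 := rfl
@[simp] lemma eval_one (M : Mem) : (1 : Term).eval M = 1 := rfl
@[simp] lemma eval_eq (M : Mem) (a b : Term) :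
    (a.eq b).eval M = if a.eval M = b.eval M then 1 else 0 := rfl
@[simp] lemma eval_lt (M : Mem) (a b : Term) :
    (a.lt b).eval M = if a.eval M < b.eval M then 1 else 0 := rfl
@[simp] lemma eval_entry (M : Mem) (r : Reg) (t : Term) :
    (entry r t).eval M = get M r (t.eval M) := rfl
@[simp] lemma eval_reg (M : Mem) (r : Reg) : (reg r).eval M = get M r 0 := rfl

/-- Writing an array entry. -/
def put (r : Reg) (t e : Term) : Program := .store (entryAddress r t) e

/-- Writing a register. -/
def assign (r : Reg) (e : Term) : Program := put r 0 e

/-- The loop in which the register `r` runs from `0` to `e - 1`. -/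
def forLoop (r : Reg) (e : Term) (P : Program) : Program :=
  .seq (assign r 0) (.loop ((reg r).lt e) (.seq P (assign r (reg r + 1))))

/-- A conditional without alternative. -/
def ifThen (e : Term) (P : Program) : Program := .cond e P .skip

/-- The program writes only into the listed arrays. -/
def WritesIn (J : List Reg) : Program → Prop
  | .skip => True
  | .store a _ => ∃ r ∈ J, ∃ t, a = entryAddress r t
  | .seq P Q => WritesIn J P ∧ WritesIn J Q
  | .cond _ P Q => WritesIn J P ∧ WritesIn J Q
  | .loop _ P => WritesIn J P

lemma entryAddress_inj {r r' : Reg} {t t' : Term} (h : entryAddress r t = entryAddress r' t') :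
    r = r' := by
  have h1 : (Term.const ((r.ctorIdx : ℤ) - 64)) = Term.const ((r'.ctorIdx : ℤ) - 64) := by
    have := congrArg (fun s => match s with | Term.op _ a _ => a | s => s) h
    exact this
  simp only [Term.const.injEq] at h1
  exact Reg.ctorIdx_injective (by omega)

@[simp] lemma writesIn_skip (J : List Reg) : WritesIn J .skip := trivial
@[simp] lemma writesIn_put (J : List Reg) (r : Reg) (t e : Term) :
    WritesIn J (put r t e) ↔ r ∈ J := by
  refine ⟨fun ⟨r', h, t', h'⟩ => entryAddress_inj h' ▸ h, fun h => ⟨r, h, t, rfl⟩⟩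
@[simp] lemma writesIn_assign (J : List Reg) (r : Reg) (e : Term) :
    WritesIn J (assign r e) ↔ r ∈ J := writesIn_put J r 0 e
@[simp] lemma writesIn_seq (J : List Reg) (P Q : Program) :
    WritesIn J (.seq P Q) ↔ WritesIn J P ∧ WritesIn J Q := Iff.rfl
@[simp] lemma writesIn_cond (J : List Reg) (e : Term) (P Q : Program) :
    WritesIn J (.cond e P Q) ↔ WritesIn J P ∧ WritesIn J Q := Iff.rfl
@[simp] lemma writesIn_ifThen (J : List Reg) (e : Term) (P : Program) :
    WritesIn J (ifThen e P) ↔ WritesIn J P := by simp [ifThen]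
@[simp] lemma writesIn_forLoop (J : List Reg) (r : Reg) (e : Term) (P : Program) :
    WritesIn J (forLoop r e P) ↔ r ∈ J ∧ WritesIn J P := by
  rw [forLoop, writesIn_seq]
  simp only [writesIn_assign]
  refine and_congr_right fun h => ?_
  change WritesIn J P ∧ WritesIn J (assign r _) ↔ _
  simp [h]

/-- The memories agree outside of the listed arrays. -/
def AgreeOff (J : List Reg) (M M' : Mem) : Prop := ∀ r ∉ J, ∀ i, get M' r i = get M r i

lemma AgreeOff.refl (J : List Reg) (M : Mem) : AgreeOff J M M := fun _ _ _ => rfl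

lemma AgreeOff.trans {J : List Reg} {M M' M'' : Mem} (h : AgreeOff J M M')
    (h' : AgreeOff J M' M'') : AgreeOff J M M'' := fun r hr i => (h' r hr i).trans (h r hr i)

lemma AgreeOff.mono {J J' : List Reg} {M M' : Mem} (h : AgreeOff J M M') (hJ : J ⊆ J') :
    AgreeOff J' M M' := fun r hr i => h r (fun h => hr (hJ h)) i

lemma agreeOff_set {J : List Reg} {r : Reg} (hr : r ∈ J) (M : Mem) (i z : ℤ) :
    AgreeOff J M (set M r i z) := fun r' hr' i' => by
  have : r' ≠ r := fun h => hr' (h ▸ hr)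
  simp [this]

/-- The frame property can be checked on the program text: different arrays occupy different
residues modulo 64, so a write into one array misses all others whatever the index evaluates to. -/
lemma Exec.agreeOff {J : List Reg} {P : Program} {M M' : Mem} {t : ℕ} (h : Exec P M M' t)
    (hP : WritesIn J P) : AgreeOff J M M' := by
  induction h with
  | skip M => exact .refl _ _
  | store a e M =>
    obtain ⟨r, hr, t, rfl⟩ := hP
    exact agreeOff_set hr M _ _
  | seq _ _ h1 h2 => exact (h1 hP.1).trans (h2 hP.2)
  | cond_true _ _ h => exact h hP.1
  | cond_false _ _ h => exact h hP.2
  | loop_true _ _ _ h1 h2 => exact (h1 hP).trans (h2 hP)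
  | loop_false _ => exact .refl _ _

section Rules

variable {X : ℕ} {P P' : Program} {M : Mem} {Q Q' : Mem → Prop}

lemma wp_agreeOff {J : List Reg} (hP : WritesIn J P) (h : wp X P M Q) :
    wp X P M fun M' => AgreeOff J M M' ∧ Q M' := fun hM => by
  obtain ⟨M', t, h1, h2, h3, h4⟩ := h hM
  exact ⟨M', t, h1, h2, h3, h1.agreeOff hP, h4⟩

lemma wp_put {r : Reg} {t e : Term} (he : Fits X (e.eval M))
    (h : Q (set M r (t.eval M) (e.eval M))) : wp X (put r t e) M Q := wp_store he h

lemma wp_assign {r : Reg} {e : Term} (he : Fits X (e.eval M))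
    (h : Q (set M r 0 (e.eval M))) : wp X (assign r e) M Q := wp_put he h

lemma wp_ifThen {e : Term} (h₁ : e.eval M ≠ 0 → wp X P M Q) (h₂ : e.eval M = 0 → Q M) :
    wp X (ifThen e P) M Q := wp_cond h₁ fun h => wp_skip (h₂ h)

lemma fits_natCast {m : ℕ} (hm : m ≤ X) : Fits X (m : ℤ) := by
  simpa [Fits] using lt_of_le_of_lt hm Nat.lt_two_pow_self

lemma fits_zero : Fits X 0 := by simp [Fits]

lemma fits_one (hX : 1 ≤ X) : Fits X 1 := by exact_mod_cast fits_natCast hX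

/-- The body may change neither the counter (`hr`) nor the value of the bound (`he`). The invariant
for `j + 1` is required after the counter has been increased, which is why `hstep` mentions the
updated memory. -/
lemma wp_forLoop {J : List Reg} {r : Reg} {e : Term} {N : ℕ} (hN : N ≤ X) (I : ℕ → Mem → Prop)
    (hP : WritesIn J P) (hr : r ∉ J)
    (he : ∀ M', AgreeOff (r :: J) M M' → e.eval M' = N)
    (h0 : I 0 (set M r 0 0))
    (hstep : ∀ j < N, ∀ M', AgreeOff (r :: J) M M' → get M' r 0 = j → I j M' →
      wp X P M' fun M'' => AgreeOff J M' M'' → I (j + 1) (set M'' r 0 (j + 1)))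
    (hend : ∀ M', AgreeOff (r :: J) M M' → I N M' → Q M') : wp X (forLoop r e P) M Q := by
  refine wp_seq (wp_assign fits_zero ?_)
  refine wp_loop hN (fun j M' => AgreeOff (r :: J) M M' ∧ get M' r 0 = j ∧ I j M') ?_ ?_ ?_
  · exact ⟨agreeOff_set (by simp) _ _ _, by simp, h0⟩
  · rintro j hj M' ⟨h1, h2, h3⟩
    refine ⟨by simp [he M' h1, h2, hj],
      wp_seq (wp_mono (wp_agreeOff hP (hstep j hj M' h1 h2 h3)) ?_)⟩
    rintro M'' ⟨h4, h5⟩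
    have h6 : get M'' r 0 = j := (h4 r hr 0).trans h2
    refine wp_assign ?_ ?_
    · have := fits_natCast (X := X) (m := j + 1) (by omega)
      simpa [h6] using this
    · refine ⟨(h1.trans (h4.mono (by simp))).trans (agreeOff_set (by simp) _ _ _), by simp [h6], ?_⟩
      simpa [h6] using h5 h4
  · rintro M' ⟨h1, h2, h3⟩
    exact ⟨by simp [he M' h1, h2], hend M' h1 h3⟩

end Rules

end RAM

/-! ### Tables of distances -/

section Distances

open SimpleGraph

variable {V : Type} {G H : SimpleGraph V} {w : Sym2 V → ℚ}

/-- The graph without the edges at the vertices that satisfy `B`. -/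
def avoid (G : SimpleGraph V) (B : V → Prop) : SimpleGraph V where
  Adj u v := G.Adj u v ∧ ¬ B u ∧ ¬ B v
  symm := ⟨fun _ _ h => ⟨h.1.symm, h.2.2, h.2.1⟩⟩
  loopless := ⟨fun _ h => h.1.ne rfl⟩

lemma avoid_le (G : SimpleGraph V) (B : V → Prop) : avoid G B ≤ G := fun _ _ h => h.1

/-- In `avoid G B` the deleted vertices remain as isolated ones, so the trivial walk at such a
vertex has to be excluded by `hu`. -/
lemma not_of_mem_support_avoid {B : V → Prop} {u v x : V} (P : (avoid G B).Walk u v) (hu : ¬ B u)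
    (hx : x ∈ P.support) : ¬ B x := by
  induction P with
  | nil => simp only [Walk.support_nil, List.mem_singleton] at hx; exact hx ▸ hu
  | cons e P ih =>
    rcases List.mem_cons.1 (by simpa using hx) with rfl | hx
    · exact hu
    · exact ih e.2.2 hx

lemma exists_walk_avoid {B : V → Prop} {u v : V} (P : G.Walk u v) (h : ∀ x ∈ P.support, ¬ B x) :
    ∃ P' : (avoid G B).Walk u v, walkWeight (avoid G B) w P' = walkWeight G w P := by
  induction P with
  | nil => exact ⟨Walk.nil, rfl⟩
  | @cons a b c e P ih =>
    obtain ⟨P', hP'⟩ := ih fun x hx => h x (by simp [hx])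
    have hab : (avoid G B).Adj a b := ⟨e, h a (by simp), h b (by simp)⟩
    exact ⟨Walk.cons hab P', by simp [hP']⟩

lemma exists_walk_of_le (hHG : H ≤ G) {u v : V} (P : H.Walk u v) :
    ∃ P' : G.Walk u v, walkWeight G w P' = walkWeight H w P ∧ P'.support = P.support := by
  induction P with
  | nil => exact ⟨Walk.nil, rfl, rfl⟩
  | cons e P ih =>
    obtain ⟨P', hP', hs⟩ := ih
    exact ⟨Walk.cons (hHG e) P', by simp [hP'], by simp [hs]⟩

/-- The number `δ` is the distance in `H`, scaled by `s` and cut off at `inf`. -/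
structure IsDist (H : SimpleGraph V) (w : Sym2 V → ℚ) (s : ℚ) (inf : ℤ) (a b : V) (δ : ℤ) :
    Prop where
  nonneg : 0 ≤ δ
  exists_walk : δ < inf → ∃ P : H.Walk a b, walkWeight H w P * s = δ
  le_walk : ∀ P : H.Walk a b, (δ : ℚ) ≤ walkWeight H w P * s

variable {s : ℚ} {inf : ℤ}

lemma NoNegativeCycle.of_le (h : NoNegativeCycle G w) (hHG : H ≤ G) : NoNegativeCycle H w :=
  fun v C => by
    obtain ⟨C', hC, -⟩ := exists_walk_of_le (w := w) hHG C
    exact hC ▸ h v C'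

/-- The cut-off exceeds the scaled weight of all paths. -/
def PathBound (G : SimpleGraph V) (w : Sym2 V → ℚ) (s : ℚ) (inf : ℤ) : Prop :=
  ∀ {u v : V} (P : G.Walk u v), P.IsPath → walkWeight G w P * s < inf

/-- A walk can be shortened to a path, whose scaled weight is below the cut-off. So an entry that
reaches the cut-off certifies that there is no walk at all. -/
lemma IsDist.lt_iff (hw : NoNegativeCycle G w) (hinf : PathBound G w s inf)
    (hHG : H ≤ G) {a b : V} {δ : ℤ} (h : IsDist H w s inf a b δ) :
    δ < inf ↔ H.Reachable a b := by
  classical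
  refine ⟨fun hlt => ?_, fun ⟨P⟩ => ?_⟩
  · obtain ⟨P, -⟩ := h.exists_walk hlt
    exact ⟨P⟩
  · obtain ⟨P', hP', -⟩ := exists_walk_of_le (w := w) hHG P
    have h1 := hinf _ P'.bypass_isPath
    have h2 : walkWeight H w P.bypass ≤ walkWeight H w P := (hw.of_le hHG).walkWeight_bypass_le P
    have h3 := h.le_walk P.bypass
    obtain ⟨P'', hP'', hs''⟩ := exists_walk_of_le (w := w) hHG P.bypass
    have h4 := hinf P'' (by
      rw [Walk.isPath_def, hs'', ← Walk.isPath_def]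
      exact P.bypass_isPath)
    rw [hP''] at h4
    exact_mod_cast h3.trans_lt h4

lemma IsDist.eq_of_shortest (hw : NoNegativeCycle G w) (hs : 0 < s) (hinf : PathBound G w s inf)
    {a b : V} {δ : ℤ} (h : IsDist G w s inf a b δ) {P : G.Walk a b} (hP : IsShortestWalk G w P) :
    walkWeight G w P * s = δ := by
  obtain ⟨Q, hQ⟩ := h.exists_walk ((h.lt_iff hw hinf le_rfl).2 ⟨P⟩)
  refine le_antisymm ?_ (h.le_walk P)
  rw [← hQ]
  exact mul_le_mul_of_nonneg_right (hP Q) hs.le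

lemma IsDist.shortest (hs : 0 < s) {a b : V} {δ : ℤ} (h : IsDist G w s inf a b δ)
    {P : G.Walk a b} (hP : walkWeight G w P * s = δ) : IsShortestWalk G w P := fun Q => by
  have := h.le_walk Q
  rw [← hP] at this
  exact le_of_mul_le_mul_right this hs

/-- Intervals are determined by the distances in `G` and in the graphs `G - c`. -/
theorem mem_geodesicInterval_iff (hw : NoNegativeCycle G w) (hs : 0 < s)
    (hinf : PathBound G w s inf) {δ : V → V → ℤ} {δc : V → V → V → ℤ}
    (hδ : ∀ a b, IsDist G w s inf a b (δ a b))
    (hδc : ∀ c a b, IsDist (avoid G (· = c)) w s inf a b (δc c a b)) (u v x : V) :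
    x ∈ geodesicInterval G w u v ↔ δ u x + δ x v = δ u v ∧ δ u v < inf ∧
      ∀ c, c ≠ x → δc c x u = δ x u ∨ δc c x v = δ x v := by
  -- A shortest walk that misses `c` survives in `G - c`, where distances cannot be smaller than in
  -- `G`.
  have avoiding : ∀ {c x y : V} (P : G.Walk x y), IsShortestWalk G w P → c ∉ P.support →
      δc c x y = δ x y := by
    intro c x y P hP hc
    obtain ⟨P', hP'⟩ := exists_walk_avoid (w := w) (B := (· = c)) P fun z hz h => hc (h ▸ hz)
    obtain ⟨Q, hQ⟩ := (hδc c x y).exists_walk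
      (((hδc c x y).lt_iff hw hinf (avoid_le _ _)).2 ⟨P'⟩)
    obtain ⟨Q', hQ', -⟩ := exists_walk_of_le (w := w) (avoid_le _ _) Q
    have h1 := (hδc c x y).le_walk P'
    have h2 := (hδ x y).le_walk Q'
    rw [hP', (hδ x y).eq_of_shortest hw hs hinf hP] at h1
    rw [hQ', hQ] at h2
    exact le_antisymm (by exact_mod_cast h1) (by exact_mod_cast h2)
  constructor
  · intro hx
    obtain ⟨A, B, hAB, hc⟩ := exists_shortest_avoiding hw hx
    refine ⟨?_, ((hδ u v).lt_iff hw hinf le_rfl).2 ⟨A.append B⟩, fun c hcx => ?_⟩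
    · have h1 := (hδ u x).eq_of_shortest hw hs hinf hAB.of_append_left
      have h2 := (hδ x v).eq_of_shortest hw hs hinf hAB.of_append_right
      have h3 := (hδ u v).eq_of_shortest hw hs hinf hAB
      rw [walkWeight_append, add_mul, h1, h2] at h3
      exact_mod_cast h3
    · rcases hc c hcx with h | h
      · exact Or.inl (avoiding A.reverse hAB.of_append_left.reverse (by simpa using h))
      · exact Or.inr (avoiding B hAB.of_append_right h)
  · rintro ⟨h1, h2, h3⟩
    have h4 := (hδ u x).nonneg
    have h5 := (hδ x v).nonneg
    obtain ⟨A, hA⟩ := (hδ u x).exists_walk (by omega)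
    obtain ⟨B, hB⟩ := (hδ x v).exists_walk (by omega)
    have hAB : IsShortestWalk G w (A.append B) := by
      refine (hδ u v).shortest hs ?_
      rw [walkWeight_append, add_mul, hA, hB]
      exact_mod_cast h1
    -- Conversely, equal distances produce a walk in `G - c` that is shortest in `G`; since it
    -- starts at `x ≠ c`, it misses `c`.
    have back : ∀ {c y : V} (_ : c ≠ x) (_ : G.Reachable x y) (_ : δc c x y = δ x y),
        ∃ Q : G.Walk x y, IsShortestWalk G w Q ∧ c ∉ Q.support := by
      intro c y hcx hxy heq
      obtain ⟨Q, hQ⟩ := (hδc c x y).exists_walk (by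
        rw [heq]
        exact ((hδ x y).lt_iff hw hinf le_rfl).2 hxy)
      obtain ⟨Q', hQ', hs'⟩ := exists_walk_of_le (w := w) (avoid_le _ _) Q
      refine ⟨Q', (hδ x y).shortest hs (by rw [hQ', hQ, heq]), fun hc => ?_⟩
      rw [hs'] at hc
      exact not_of_mem_support_avoid Q hcx.symm hc rfl
    exact mem_geodesicInterval_of_forall hw A B hAB fun c hc =>
      (h3 c hc).imp (back hc ⟨A.reverse⟩) (back hc ⟨B⟩)

/-- Removing only the edges at `Z` keeps the vertex type, so that `G - Z` can be handled by the same
tables of distances as `G` and `G - c`. -/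
lemma inOrConnected_iff_reachable {Z : Finset V} {a x : V} :
    InOrConnected G Z a x ↔ a ∈ Z ∨ (avoid G (· ∈ Z)).Reachable a x := by
  by_cases ha : a ∈ Z
  · simp [InOrConnected, ha]
  rw [InOrConnected, or_iff_right ha, or_iff_right ha]
  constructor
  · rintro ⟨ha, hx, h⟩
    exact h.map (⟨Subtype.val, fun {u v} h => ⟨h, u.2, v.2⟩⟩ :
      deleteVertices G Z →g avoid G (· ∈ Z))
  · rintro ⟨P⟩
    obtain ⟨P', -, hs⟩ := exists_walk_of_le (w := fun _ => 0) (avoid_le _ _) P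
    exact ⟨ha, _, reachable_deleteVertices Z P' fun z hz =>
      not_of_mem_support_avoid P ha (hs ▸ hz)⟩

lemma inOrConnected_iff (hw : NoNegativeCycle G w) (hinf : PathBound G w s inf)
    {Z : Finset V} {a x : V} {δ : ℤ} (hδ : IsDist (avoid G (· ∈ Z)) w s inf a x δ) :
    InOrConnected G Z a x ↔ a ∈ Z ∨ δ < inf := by
  rw [inOrConnected_iff_reachable, hδ.lt_iff hw hinf (avoid_le _ _)]

end Distances

/-! ### The constraints of an instance -/

namespace SeparatedInstance

variable (I : SeparatedInstance)

/-- The position of a pair of vertices in the adjacency matrix. -/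
def pairIndex {n : ℕ} (u v : Fin n) : ℕ := u * n + v

lemma pairIndex_lt {n : ℕ} (u v : Fin n) : pairIndex u v < n * n := by
  have h1 : (u + 1) * n ≤ n * n := Nat.mul_le_mul_right n u.2
  have h2 := v.2
  simp only [pairIndex]
  rw [add_mul] at h1
  omega

lemma pairIndex_div {n : ℕ} (u v : Fin n) : pairIndex u v / n = u := by
  rw [pairIndex, mul_comm, Nat.mul_add_div (by have := u.2; omega), Nat.div_eq_of_lt v.2, add_zero]

lemma pairIndex_mod {n : ℕ} (u v : Fin n) : pairIndex u v % n = v := by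
  rw [pairIndex, mul_comm, Nat.mul_add_mod, Nat.mod_eq_of_lt v.2]

lemma pairIndex_inj {n : ℕ} {u v u' v' : Fin n} (h : pairIndex u v = pairIndex u' v') :
    u = u' ∧ v = v' :=
  ⟨Fin.ext (by rw [← pairIndex_div u v, h, pairIndex_div]),
    Fin.ext (by rw [← pairIndex_mod u v, h, pairIndex_mod])⟩

lemma exists_pairIndex {n e : ℕ} (he : e < n * n) : ∃ u v : Fin n, pairIndex u v = e := by
  have hn : 0 < n := Nat.pos_of_ne_zero fun h => by simp [h] at he
  exact ⟨⟨e / n, Nat.div_lt_of_lt_mul he⟩, ⟨e % n, Nat.mod_lt _ hn⟩, by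
    simp only [pairIndex]
    rw [mul_comm]
    exact Nat.div_add_mod e n⟩

open Classical in
/-- The vertices of `Z` in order. -/
noncomputable def separatorList : List (Fin I.n) := (List.finRange I.n).filter (· ∈ I.Z)

lemma mem_separatorList {v : Fin I.n} : v ∈ I.separatorList ↔ v ∈ I.Z := by
  simp [separatorList]

lemma length_separatorList_le : I.separatorList.length ≤ I.p := by
  classical
  refine le_trans ?_ I.card_Z_le
  have h : I.separatorList.Nodup := (List.nodup_finRange _).filter _
  rw [← List.toFinset_card_of_nodup h]
  exact Finset.card_le_card fun v hv => I.mem_separatorList.1 (List.mem_toFinset.1 hv)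

/-- The pair with index `e` is in `T`. -/
def IsPair (e : ℕ) : Prop := ∃ u v : Fin I.n, pairIndex u v = e ∧ s(u, v) ∈ I.T

/-- The interval of the pair with index `e`. -/
def pairInterval (e : ℕ) : Set (Fin I.n) :=
  {x | ∃ u v : Fin I.n, pairIndex u v = e ∧ x ∈ geodesicInterval I.G I.w u v}

/-- The vertex meant by a guess: a vertex of `Z` or the vertex `u`. -/
noncomputable def guess (d : ℕ) (u : Fin I.n) : Fin I.n := I.separatorList.getD d u

/-- The atoms of the interval of the pair with index `e`. -/
def atom (e d₁ d₂ : ℕ) : Set (Fin I.n) :=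
  {x | ∃ u v : Fin I.n, pairIndex u v = e ∧
    x ∈ localInterval I.G I.w I.Z (I.guess d₁ u) (I.guess d₂ v)}

lemma mem_pairInterval {u v x : Fin I.n} :
    x ∈ I.pairInterval (pairIndex u v) ↔ x ∈ geodesicInterval I.G I.w u v := by
  refine ⟨?_, fun h => ⟨u, v, rfl, h⟩⟩
  rintro ⟨u', v', h, hx⟩
  obtain ⟨rfl, rfl⟩ := pairIndex_inj h
  exact hx

lemma mem_atom {u v x : Fin I.n} {d₁ d₂ : ℕ} : x ∈ I.atom (pairIndex u v) d₁ d₂ ↔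
    x ∈ localInterval I.G I.w I.Z (I.guess d₁ u) (I.guess d₂ v) := by
  refine ⟨?_, fun h => ⟨u, v, rfl, h⟩⟩
  rintro ⟨u', v', h, hx⟩
  obtain ⟨rfl, rfl⟩ := pairIndex_inj h
  exact hx

lemma guess_mem_or (d : ℕ) (u : Fin I.n) : I.guess d u ∈ I.Z ∨ I.guess d u = u := by
  rw [guess]
  by_cases h : d < I.separatorList.length
  · left
    rw [List.getD_eq_getElem _ _ h]
    exact I.mem_separatorList.1 (List.getElem_mem h)
  · right
    exact List.getD_eq_default _ _ (by omega)

/-- Since `Z` has at most `p` vertices, the values up to `p` suffice: an index past the end of the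
list falls back to the default `u`. -/
lemma exists_guess {a u : Fin I.n} (h : a ∈ I.Z ∨ a = u) : ∃ d < I.p + 1, I.guess d u = a := by
  have := I.length_separatorList_le
  rcases h with h | rfl
  · obtain ⟨d, hd, rfl⟩ := List.getElem_of_mem (I.mem_separatorList.2 h)
    exact ⟨d, by omega, List.getD_eq_getElem _ _ hd⟩
  · exact ⟨I.separatorList.length, by omega, List.getD_eq_default _ _ le_rfl⟩

open Classical in
/-- The vertices of `Z` and the terminals in the component of `x`. -/
noncomputable def anchors (x : Fin I.n) : Finset (Fin I.n) :=
  I.Z ∪ Finset.univ.filter fun a => a ∉ I.Z ∧ a ∈ terminals I.T ∧ InOrConnected I.G I.Z a x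

/-- This is where the assumption on the separator enters: the anchors outside `Z` are terminals in
the component of `x` in `G - Z`, and there are none if `x ∈ Z`. -/
lemma card_anchors_le (x : Fin I.n) : (I.anchors x).card ≤ I.p + I.q := by
  classical
  refine (Finset.card_union_le _ _).trans (add_le_add I.card_Z_le ?_)
  by_cases hx : x ∈ I.Z
  · rw [Finset.card_eq_zero.2]
    · exact Nat.zero_le _
    · refine Finset.filter_eq_empty_iff.2 fun a _ => ?_
      rintro ⟨ha, -, ha' | ⟨_, hx', -⟩⟩
      · exact ha ha'
      · exact hx' hx
  · refine le_trans ?_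
      (I.terminals_le ((deleteVertices I.G I.Z).connectedComponentMk ⟨x, hx⟩))
    rw [Set.ncard_eq_toFinset_card']
    refine Finset.card_le_card_of_surjOn Subtype.val fun a ha => ?_
    simp only [Finset.coe_filter, Finset.mem_univ, true_and, Set.mem_ofPred_eq] at ha
    obtain ⟨ha, hT, ha' | ⟨_, _, h⟩⟩ := ha
    · exact absurd ha' ha
    · refine ⟨⟨a, ha⟩, ?_, rfl⟩
      simp only [Set.coe_toFinset, Set.mem_ofPred_eq]
      exact ⟨SimpleGraph.ConnectedComponent.sound h, hT⟩

lemma guess_mem_anchors {u x : Fin I.n} {d : ℕ} (hu : u ∈ terminals I.T)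
    (h : InOrConnected I.G I.Z (I.guess d u) x) : I.guess d u ∈ I.anchors x := by
  classical
  simp only [anchors, Finset.mem_union, Finset.mem_filter, Finset.mem_univ, true_and]
  by_cases hZ : I.guess d u ∈ I.Z
  · exact Or.inl hZ
  · refine Or.inr ⟨hZ, ?_, h⟩
    rwa [(I.guess_mem_or d u).resolve_left hZ]

/-- The number of rounds after which all constraints are met. -/
def rounds : ℕ := I.k * ((I.p + I.q) * (I.p + I.q)) + 1

/-- The number of possible guesses. -/
def guesses : ℕ := ((I.k + 1) * (I.p + 1) * (I.p + 1)) ^ I.rounds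

/-- The number `g` encodes guesses that lead to a solution. -/
def GoodGuess (g : ℕ) : Prop :=
  Accepts I.k (I.p + 1) (I.n * I.n) I.IsPair I.pairInterval I.atom I.rounds g

/-- The branching is applied with `Δ = (p + q)²`. An atom depends only on its two guessed vertices
and not on the pair from which it came, and both are anchors of each vertex in it; so the family `F
x` is indexed by pairs of anchors. -/
theorem exists_goodGuess_iff : (∃ g < I.guesses, I.GoodGuess g) ↔ I.IsYes := by
  classical
  rw [guesses, rounds]
  simp only [GoodGuess, rounds]
  rw [exists_accepts_iff (F := fun x => ((I.anchors x) ×ˢ (I.anchors x)).image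
    fun ab => localInterval I.G I.w I.Z ab.1 ab.2) (Nat.succ_pos _)]
  · refine exists_congr fun S => and_congr_right fun _ => ⟨fun h u v huv => ?_, ?_⟩
    · obtain ⟨x, hx, hx'⟩ := h _ (pairIndex_lt u v) ⟨u, v, rfl, huv⟩
      exact ⟨x, hx, I.mem_pairInterval.1 hx'⟩
    · rintro h e he ⟨u, v, rfl, huv⟩
      obtain ⟨x, hx, hx'⟩ := h u v huv
      exact ⟨x, hx, I.mem_pairInterval.2 hx'⟩
  · rintro e - ⟨u, -⟩
    exact ⟨u⟩
  · rintro e - ⟨u, v, rfl, -⟩ x hx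
    obtain ⟨a, b, ha, hb, hx', hsub⟩ :=
      exists_mem_localInterval I.noNegativeCycle I.Z (I.mem_pairInterval.1 hx)
    obtain ⟨d₁, hd₁, rfl⟩ := I.exists_guess ha
    obtain ⟨d₂, hd₂, rfl⟩ := I.exists_guess hb
    exact ⟨d₁, hd₁, d₂, hd₂, I.mem_atom.2 hx',
      fun y hy => I.mem_pairInterval.2 (hsub (I.mem_atom.1 hy).1)⟩
  · rintro e - ⟨u, v, rfl, huv⟩ x d₁ - d₂ - hx
    have hx' := I.mem_atom.1 hx
    refine Finset.mem_image.2 ⟨(I.guess d₁ u, I.guess d₂ v), Finset.mem_product.2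
      ⟨I.guess_mem_anchors ⟨_, huv, by simp⟩ hx'.2.1,
        I.guess_mem_anchors ⟨_, huv, by simp⟩ hx'.2.2⟩, ?_⟩
    ext y
    exact I.mem_atom.symm
  · intro x
    refine Finset.card_image_le.trans ?_
    rw [Finset.card_product]
    exact Nat.mul_le_mul (I.card_anchors_le x) (I.card_anchors_le x)

end SeparatedInstance

/-! ### The entries of the input -/

lemma getD_flatMap_of_length {α β : Type} (f : α → List β) (b : ℕ) (d : β) (l : List α)
    (hf : ∀ x ∈ l, (f x).length = b) {i r : ℕ} (hi : i < l.length) (hr : r < b) :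
    (l.flatMap f).getD (i * b + r) d = (f l[i]).getD r d := by
  induction l generalizing i with
  | nil => simp at hi
  | cons x l ih =>
    have hx : (f x).length = b := hf x (by simp)
    rw [List.flatMap_cons]
    cases i with
    | zero => rw [List.getD_append _ _ _ _ (by simpa [hx] using hr)]; simp
    | succ i =>
      rw [List.getD_append_right _ _ _ _ (by rw [hx, add_mul]; omega), hx,
        show (i + 1) * b + r - b = i * b + r by rw [add_mul]; omega]
      exact ih (fun y hy => hf y (by simp [hy])) (by simpa using hi)

lemma length_flatMap_of_length {α β : Type} (f : α → List β) (b : ℕ) (l : List α)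
    (hf : ∀ x ∈ l, (f x).length = b) : (l.flatMap f).length = l.length * b := by
  induction l with
  | nil => simp
  | cons x l ih =>
    rw [List.flatMap_cons, List.length_append, hf x (by simp),
      ih fun y hy => hf y (by simp [hy])]
    simp only [List.length_cons]
    ring

namespace SeparatedInstance

variable (I : SeparatedInstance)

/-- An entry of the input. -/
noncomputable def inputEntry (a : ℕ) : ℤ := I.encode.getD a 0

open Classical in
/-- The part of the input that describes the adjacency of two vertices. -/
noncomputable def edgeCode (u v : Fin I.n) : List ℤ :=
  if I.G.Adj u v then [1, (I.w s(u, v)).num, ((I.w s(u, v)).den : ℤ)] else [0, 0, 1]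

lemma length_edgeCode (u v : Fin I.n) : (I.edgeCode u v).length = 3 := by
  unfold edgeCode
  split_ifs <;> rfl

open Classical in
lemma encode_eq : I.encode = [(I.n : ℤ), (I.k : ℤ), (I.p : ℤ), (I.q : ℤ)]
    ++ (List.finRange I.n).flatMap (fun u => (List.finRange I.n).flatMap (I.edgeCode u))
    ++ (List.finRange I.n).flatMap (fun u => (List.finRange I.n).map fun v =>
        if s(u, v) ∈ I.T then 1 else 0)
    ++ (List.finRange I.n).map (fun u => if u ∈ I.Z then 1 else 0) := rfl

lemma length_edgeCodes : ((List.finRange I.n).flatMap fun u =>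
    (List.finRange I.n).flatMap (I.edgeCode u)).length = 3 * (I.n * I.n) := by
  rw [length_flatMap_of_length _ (I.n * 3) _ fun u _ => by
    rw [length_flatMap_of_length _ 3 _ fun v _ => I.length_edgeCode u v, List.length_finRange]]
  rw [List.length_finRange]
  ring

open Classical in
lemma length_pairCodes : ((List.finRange I.n).flatMap fun u => (List.finRange I.n).map fun v =>
    if s(u, v) ∈ I.T then (1 : ℤ) else 0).length = I.n * I.n := by
  rw [length_flatMap_of_length _ I.n _ fun u _ => by simp]
  simp

lemma length_encode : I.encode.length = 4 + 4 * (I.n * I.n) + I.n := by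
  classical
  rw [encode_eq, List.length_append, List.length_append, List.length_append, length_edgeCodes,
    length_pairCodes]
  simp
  ring

lemma inputEntry_edge (u v : Fin I.n) {r : ℕ} (hr : r < 3) :
    I.inputEntry (4 + 3 * pairIndex u v + r) = (I.edgeCode u v).getD r 0 := by
  classical
  have h1 := pairIndex_lt u v
  have hlen := I.length_edgeCodes
  rw [inputEntry, encode_eq, List.append_assoc, List.append_assoc,
    List.getD_append_right _ _ _ _ (by simp; omega), List.getD_append _ _ _ _ (by
      rw [hlen]; simp; omega)]
  have h2 : 4 + 3 * pairIndex u v + r - [(I.n : ℤ), (I.k : ℤ), (I.p : ℤ), (I.q : ℤ)].length =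
      u * (I.n * 3) + (v * 3 + r) := by
    simp [pairIndex]
    rw [show 4 + 3 * ((u : ℕ) * I.n + v) + r = 4 + (u * (I.n * 3) + (v * 3 + r)) by ring]
    omega
  have hv := v.2
  rw [h2, getD_flatMap_of_length _ (I.n * 3) 0 _ (fun u _ => by
      rw [length_flatMap_of_length _ 3 _ fun v _ => I.length_edgeCode u v, List.length_finRange])
      (by simp) (by omega), getD_flatMap_of_length _ 3 0 _ (fun v _ => I.length_edgeCode _ v)
      (by simp) hr]
  simp

open Classical in
lemma inputEntry_pair (u v : Fin I.n) :
    I.inputEntry (4 + 3 * (I.n * I.n) + pairIndex u v) = if s(u, v) ∈ I.T then 1 else 0 := by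
  have h1 := pairIndex_lt u v
  have hlen := I.length_edgeCodes
  have hlen' := I.length_pairCodes
  rw [inputEntry, encode_eq, List.getD_append _ _ _ _ (by
      rw [List.length_append, List.length_append, hlen, hlen']; simp; omega),
    List.getD_append_right _ _ _ _ (by rw [List.length_append, hlen]; simp)]
  rw [List.length_append, hlen]
  have h2 : 4 + 3 * (I.n * I.n) + pairIndex u v -
      ([(I.n : ℤ), (I.k : ℤ), (I.p : ℤ), (I.q : ℤ)].length + 3 * (I.n * I.n)) =
      u * I.n + v := by
    simp [pairIndex]
  rw [h2, getD_flatMap_of_length _ I.n 0 _ (fun u _ => by simp) (by simp) v.2]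
  simp [List.getD_eq_getElem?_getD]

open Classical in
lemma inputEntry_separator (v : Fin I.n) :
    I.inputEntry (4 + 4 * (I.n * I.n) + v) = if v ∈ I.Z then 1 else 0 := by
  have hlen := I.length_edgeCodes
  have hlen' := I.length_pairCodes
  have hlen'' : ([(I.n : ℤ), (I.k : ℤ), (I.p : ℤ), (I.q : ℤ)]
    ++ (List.finRange I.n).flatMap (fun u => (List.finRange I.n).flatMap (I.edgeCode u))
    ++ (List.finRange I.n).flatMap (fun u => (List.finRange I.n).map fun v =>
        if s(u, v) ∈ I.T then 1 else 0)).length = 4 + 4 * (I.n * I.n) := by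
    rw [List.length_append, List.length_append, hlen, hlen']
    simp
    ring
  rw [inputEntry, encode_eq, List.getD_append_right _ _ _ _ (by rw [hlen'']; omega), hlen'']
  simp [List.getD_eq_getElem?_getD]

lemma inputEntry_zero : I.inputEntry 0 = I.n := by simp [inputEntry, encode_eq]
lemma inputEntry_one : I.inputEntry 1 = I.k := by simp [inputEntry, encode_eq]
lemma inputEntry_two : I.inputEntry 2 = I.p := by simp [inputEntry, encode_eq]
lemma inputEntry_three : I.inputEntry 3 = I.q := by simp [inputEntry, encode_eq]

/-- The size of the input. -/
noncomputable def size : ℕ := RAM.inputSize I.encode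

lemma size_eq_sum : I.size = ∑ a ∈ Finset.range I.encode.length, RAM.len (I.inputEntry a) := by
  rw [size, RAM.inputSize, ← Fin.sum_univ_eq_sum_range (fun a => RAM.len (I.inputEntry a)),
    ← Fin.sum_univ_fun_getElem]
  refine Finset.sum_congr rfl fun a _ => ?_
  simp [inputEntry]

lemma length_encode_le_size : I.encode.length ≤ I.size := by
  rw [size_eq_sum]
  calc I.encode.length = ∑ a ∈ Finset.range I.encode.length, 1 := by simp
    _ ≤ _ := Finset.sum_le_sum fun a _ => by simp [RAM.len]

/-- Distinct cells contribute separately to the input size. This keeps the product of all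
denominators within `size` bits. -/
lemma sum_len_le_size {N : ℕ} (f : ℕ → ℕ) (hf : Function.Injective f)
    (hN : ∀ i < N, f i < I.encode.length) :
    ∑ i ∈ Finset.range N, RAM.len (I.inputEntry (f i)) ≤ I.size := by
  rw [size_eq_sum, ← Finset.sum_image (f := fun a => RAM.len (I.inputEntry a)) (g := f)
    fun a _ b _ h => hf h]
  refine Finset.sum_le_sum_of_subset fun a ha => ?_
  obtain ⟨i, hi, rfl⟩ := Finset.mem_image.1 ha
  exact Finset.mem_range.2 (hN i (Finset.mem_range.1 hi))

lemma natAbs_inputEntry_lt (a : ℕ) : (I.inputEntry a).natAbs < 2 ^ I.size := by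
  by_cases ha : a < I.encode.length
  · have h1 := I.sum_len_le_size (N := 1) (fun i => a + i) (add_right_injective a) (by simpa)
    have h2 := RAM.natAbs_lt_two_pow_len (I.inputEntry a)
    simp only [Finset.range_one, Finset.sum_singleton, add_zero] at h1
    exact h2.trans_le (Nat.pow_le_pow_right (by norm_num) (by omega))
  · rw [inputEntry, List.getD_eq_default _ _ (by omega)]
    simp

/-! ### Scaled weights -/

/-- The denominator at a position of the adjacency matrix. -/
noncomputable def denEntry (i : ℕ) : ℤ := I.inputEntry (6 + 3 * i)

/-- The product of the first denominators. -/
noncomputable def denProd (m : ℕ) : ℤ := ∏ i ∈ Finset.range m, I.denEntry i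

/-- The common denominator. -/
noncomputable def scale : ℤ := I.denProd (I.n * I.n)

/-- The scaled weight at a position of the adjacency matrix. -/
noncomputable def scaledEntry (i : ℕ) : ℤ :=
  I.inputEntry (5 + 3 * i) * Int.fdiv I.scale (I.denEntry i)

/-- The sum of the first scaled weights. -/
noncomputable def scaledSum (m : ℕ) : ℤ := ∑ i ∈ Finset.range m, I.scaledEntry i

/-- A number larger than all scaled weights of paths. -/
noncomputable def inf : ℤ := I.n * I.scaledSum (I.n * I.n) + 1

/-- The matrix of the scaled weights. -/
noncomputable def weightEntry (i : ℕ) : ℤ :=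
  if I.inputEntry (4 + 3 * i) = 0 then I.inf else I.scaledEntry i

lemma denEntry_pairIndex_pos (u v : Fin I.n) : 0 < I.denEntry (pairIndex u v) := by
  have := I.inputEntry_edge u v (r := 2) (by norm_num)
  rw [denEntry, show 6 + 3 * pairIndex u v = 4 + 3 * pairIndex u v + 2 by ring, this, edgeCode]
  split_ifs
  · simpa using (I.w s(u, v)).den_pos
  · simp

lemma denEntry_pos {i : ℕ} (hi : i < I.n * I.n) : 0 < I.denEntry i := by
  obtain ⟨u, v, rfl⟩ := exists_pairIndex hi
  exact I.denEntry_pairIndex_pos u v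

lemma denProd_pos {m : ℕ} (hm : m ≤ I.n * I.n) : 0 < I.denProd m :=
  Finset.prod_pos fun i hi => I.denEntry_pos (by have := Finset.mem_range.1 hi; omega)

lemma scale_pos : 0 < I.scale := I.denProd_pos le_rfl

lemma inputEntry_adj_eq_zero_iff (u v : Fin I.n) :
    I.inputEntry (4 + 3 * pairIndex u v) = 0 ↔ ¬ I.G.Adj u v := by
  have := I.inputEntry_edge u v (r := 0) (by norm_num)
  rw [add_zero] at this
  rw [this, edgeCode]
  split_ifs with h <;> simp [h]

/-- The denominator divides the common one, so the division that rounds down is exact. -/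
lemma scaledEntry_of_adj {u v : Fin I.n} (h : I.G.Adj u v) :
    (I.scaledEntry (pairIndex u v) : ℚ) = I.w s(u, v) * I.scale := by
  have h1 := I.inputEntry_edge u v (r := 1) (by norm_num)
  have h2 := I.inputEntry_edge u v (r := 2) (by norm_num)
  have hpos := I.denEntry_pairIndex_pos u v
  have hdvd : I.denEntry (pairIndex u v) ∣ I.scale :=
    Finset.dvd_prod_of_mem _ (Finset.mem_range.2 (pairIndex_lt u v))
  rw [edgeCode, if_pos h] at h1 h2
  simp only [List.getD_cons_succ, List.getD_cons_zero] at h1 h2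
  obtain ⟨c, hc⟩ := hdvd
  have h3 : I.denEntry (pairIndex u v) = (I.w s(u, v)).den := by
    rw [denEntry, show 6 + 3 * pairIndex u v = 4 + 3 * pairIndex u v + 2 by ring, h2]
  rw [scaledEntry, show 5 + 3 * pairIndex u v = 4 + 3 * pairIndex u v + 1 by ring, h1, hc,
    Int.mul_fdiv_cancel_left _ hpos.ne', h3]
  have h4 : ((I.w s(u, v)).den : ℚ) ≠ 0 := by simp
  push_cast
  rw [← mul_assoc, Rat.mul_den_eq_num]

/-- Non-edges are coded with numerator `0` and denominator `1`, so they change neither the common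
denominator nor the sum. -/
lemma scaledEntry_of_not_adj {u v : Fin I.n} (h : ¬ I.G.Adj u v) :
    I.scaledEntry (pairIndex u v) = 0 := by
  have h1 := I.inputEntry_edge u v (r := 1) (by norm_num)
  rw [edgeCode, if_neg h] at h1
  rw [scaledEntry, show 5 + 3 * pairIndex u v = 4 + 3 * pairIndex u v + 1 by ring, h1]
  simp

lemma scaledEntry_nonneg {i : ℕ} (hi : i < I.n * I.n) : 0 ≤ I.scaledEntry i := by
  obtain ⟨u, v, rfl⟩ := exists_pairIndex hi
  by_cases h : I.G.Adj u v
  · have h1 := I.scaledEntry_of_adj h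
    have h2 := I.noNegativeCycle.weight_nonneg h
    have h3 : (0 : ℚ) < I.scale := by exact_mod_cast I.scale_pos
    exact_mod_cast h1 ▸ mul_nonneg h2 h3.le
  · rw [I.scaledEntry_of_not_adj h]

lemma scaledEntry_le_sum {i : ℕ} (hi : i < I.n * I.n) :
    I.scaledEntry i ≤ I.scaledSum (I.n * I.n) :=
  Finset.single_le_sum (f := I.scaledEntry)
    (fun _ hj => I.scaledEntry_nonneg (Finset.mem_range.1 hj)) (Finset.mem_range.2 hi)

lemma scaledSum_nonneg {m : ℕ} (hm : m ≤ I.n * I.n) : 0 ≤ I.scaledSum m :=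
  Finset.sum_nonneg fun i hi => I.scaledEntry_nonneg (by have := Finset.mem_range.1 hi; omega)

lemma inf_pos : 0 < I.inf := by
  have := mul_nonneg (Int.natCast_nonneg I.n) (I.scaledSum_nonneg le_rfl)
  rw [inf]
  omega

lemma scaledEntry_lt_inf {i : ℕ} (hi : i < I.n * I.n) : I.scaledEntry i < I.inf := by
  have h1 := I.scaledEntry_le_sum hi
  have h2 := I.scaledSum_nonneg le_rfl
  have h3 : 1 ≤ (I.n : ℤ) := by
    have : I.n ≠ 0 := fun h => by simp [h] at hi
    omega
  rw [inf]
  nlinarith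

lemma weightEntry_nonneg {i : ℕ} (hi : i < I.n * I.n) : 0 ≤ I.weightEntry i := by
  rw [weightEntry]
  split_ifs
  · exact I.inf_pos.le
  · exact I.scaledEntry_nonneg hi

lemma weightEntry_le {i : ℕ} (hi : i < I.n * I.n) : I.weightEntry i ≤ I.inf := by
  rw [weightEntry]
  split_ifs
  · exact le_rfl
  · exact (I.scaledEntry_lt_inf hi).le

lemma adj_of_weightEntry_lt {u v : Fin I.n} (h : I.weightEntry (pairIndex u v) < I.inf) :
    I.G.Adj u v := by
  by_contra hn
  rw [weightEntry, if_pos ((I.inputEntry_adj_eq_zero_iff u v).2 hn)] at h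
  exact h.false

lemma weightEntry_of_adj {u v : Fin I.n} (h : I.G.Adj u v) :
    (I.weightEntry (pairIndex u v) : ℚ) = I.w s(u, v) * I.scale := by
  rw [weightEntry, if_neg (by rw [inputEntry_adj_eq_zero_iff]; simpa using h),
    I.scaledEntry_of_adj h]

/-- A path has fewer than `n` edges, each of scaled weight at most the sum of all; the `+ 1` in
`inf` makes the inequality strict even if all weights vanish. -/
lemma pathBound : PathBound I.G I.w I.scale I.inf := by
  intro u v P hP
  have key : ∀ {u v : Fin I.n} (P : I.G.Walk u v),
      walkWeight I.G I.w P * I.scale ≤ P.length * I.scaledSum (I.n * I.n) := by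
    intro u v P
    induction P with
    | nil => simp
    | @cons a b c e P ih =>
      have h1 : ((I.scaledEntry (pairIndex a b) : ℤ) : ℚ) ≤ I.scaledSum (I.n * I.n) := by
        exact_mod_cast I.scaledEntry_le_sum (pairIndex_lt a b)
      rw [I.scaledEntry_of_adj e] at h1
      simp only [walkWeight_cons, SimpleGraph.Walk.length_cons, Nat.cast_add, Nat.cast_one]
      linarith
  have h1 := key P
  have h2 : P.length < I.n := by simpa using hP.length_lt
  have h3 : (0 : ℚ) ≤ I.scaledSum (I.n * I.n) := by exact_mod_cast I.scaledSum_nonneg le_rfl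
  have h4 : (P.length : ℚ) ≤ I.n := by exact_mod_cast h2.le
  rw [inf]
  push_cast
  nlinarith [mul_le_mul_of_nonneg_right h4 h3]

/-! ### Bounds for the numbers -/

lemma sq_le_size : 4 + 4 * (I.n * I.n) + I.n ≤ I.size :=
  I.length_encode ▸ I.length_encode_le_size

lemma denProd_le {m : ℕ} (hm : m ≤ I.n * I.n) : (I.denProd m).natAbs ≤ 2 ^ I.size := by
  rw [denProd, show (∏ i ∈ Finset.range m, I.denEntry i).natAbs = _ from
    map_prod Int.natAbsHom I.denEntry _]
  change ∏ i ∈ Finset.range m, (I.denEntry i).natAbs ≤ _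
  calc ∏ i ∈ Finset.range m, (I.denEntry i).natAbs
      ≤ ∏ i ∈ Finset.range m, 2 ^ RAM.len (I.inputEntry (6 + 3 * i)) := by
        refine Finset.prod_le_prod' fun i _ => ?_
        refine (RAM.natAbs_lt_two_pow_len _).le.trans (Nat.pow_le_pow_right (by norm_num) ?_)
        exact Nat.sub_le _ _
    _ = 2 ^ ∑ i ∈ Finset.range m, RAM.len (I.inputEntry (6 + 3 * i)) :=
        Finset.prod_pow_eq_pow_sum _ _ _
    _ ≤ 2 ^ I.size := by
        refine Nat.pow_le_pow_right (by norm_num) (I.sum_len_le_size (fun i => 6 + 3 * i) ?_ ?_)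
        · intro a b h
          simp only at h
          omega
        · intro i hi
          rw [length_encode]
          omega

/-- One factor `2 ^ size` comes from the numerator and one from the common denominator. Summing over
at most `n²` positions costs a third in `scaledSum_natAbs_le`, and the factor `n` a fourth in
`inf_natAbs_le`. -/
lemma scaledEntry_natAbs_le (i : ℕ) : (I.scaledEntry i).natAbs ≤ 2 ^ (2 * I.size) := by
  rw [scaledEntry, Int.natAbs_mul, two_mul, pow_add]
  exact Nat.mul_le_mul (I.natAbs_inputEntry_lt _).le
    ((RAM.natAbs_fdiv_le _ _).trans (I.denProd_le le_rfl))

lemma scaledSum_natAbs_le {m : ℕ} (hm : m ≤ I.n * I.n) :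
    (I.scaledSum m).natAbs ≤ 2 ^ (3 * I.size) := by
  have h1 : (I.scaledSum m).natAbs ≤ m * 2 ^ (2 * I.size) := by
    refine (Int.natAbs_sum_le _ _).trans ?_
    refine (Finset.sum_le_card_nsmul _ _ _ fun i _ => I.scaledEntry_natAbs_le i).trans (by simp)
  have h2 := I.sq_le_size
  have h3 : I.size < 2 ^ I.size := Nat.lt_two_pow_self
  calc _ ≤ m * 2 ^ (2 * I.size) := h1
    _ ≤ 2 ^ I.size * 2 ^ (2 * I.size) := Nat.mul_le_mul_right _ (by omega)
    _ = _ := by rw [← pow_add]; congr 1; ring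

lemma inf_natAbs_le : I.inf.natAbs ≤ 2 ^ (4 * I.size) := by
  have h1 := I.scaledSum_natAbs_le le_rfl
  have h2 := I.sq_le_size
  have h3 : I.size < 2 ^ I.size := Nat.lt_two_pow_self
  have h4 : 1 ≤ 2 ^ (3 * I.size) := Nat.one_le_two_pow
  calc I.inf.natAbs ≤ I.n * (I.scaledSum (I.n * I.n)).natAbs + 1 := by
        rw [inf]
        refine (Int.natAbs_add_le _ _).trans ?_
        rw [Int.natAbs_mul]
        simp
    _ ≤ I.n * 2 ^ (3 * I.size) + 2 ^ (3 * I.size) := by gcongr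
    _ = (I.n + 1) * 2 ^ (3 * I.size) := by ring
    _ ≤ 2 ^ I.size * 2 ^ (3 * I.size) := Nat.mul_le_mul_right _ (by omega)
    _ = _ := by rw [← pow_add]; congr 1; ring

end SeparatedInstance

/-! ### Reading the input -/

namespace RAM

@[simp] lemma eval_load (M : Mem) (t : Term) : (Term.load t).eval M = M (t.eval M) := rfl

infixr:60 " ;; " => Program.seq

/-- Reads the numbers of the instance. -/
def readHeader : Program :=
  assign .n (.load 0) ;; assign .k (.load 1) ;; assign .p (.load 2) ;; assign .q (.load 3) ;;
  assign .num (reg .n * reg .n)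

/-- The scaled weight at the position `i`. -/
def scaledWeight : Term := .load (5 + 3 * reg .i) * (reg .pd / .load (6 + 3 * reg .i))

/-- Computes the common denominator. -/
def readScale : Program :=
  assign .pd 1 ;; forLoop .i (reg .num) (assign .pd (reg .pd * .load (6 + 3 * reg .i)))

/-- Computes the number `inf`. -/
def readInf : Program :=
  assign .sum 0 ;; forLoop .i (reg .num) (assign .sum (reg .sum + scaledWeight)) ;;
  assign .inf (reg .n * reg .sum + 1)

/-- Computes the weight matrix. -/
def readWeights : Program :=
  forLoop .i (reg .num) (.cond (.load (4 + 3 * reg .i)) (put .w (reg .i) scaledWeight)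
    (put .w (reg .i) (reg .inf)))

/-- Reads the pairs. -/
def readPairs : Program :=
  forLoop .i (reg .num) (put .tm (reg .i) (.load (4 + 3 * reg .num + reg .i)))

/-- Reads the set `Z`. -/
def readSeparator : Program :=
  assign .zc 0 ;; forLoop .i (reg .n)
    (put .zf (reg .i) (.load (4 + 4 * reg .num + reg .i)) ;;
      ifThen (entry .zf (reg .i)) (put .zl (reg .zc) (reg .i) ;; assign .zc (reg .zc + 1)))

end RAM

namespace SeparatedInstance

open RAM

variable (I : SeparatedInstance) {X : ℕ} {M M' : Mem} {J : List Reg}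

/-- The number `X` is large enough for all numbers and loops. -/
structure Enough (X : ℕ) : Prop where
  size : 4 * I.size + 4 ≤ X
  table : (I.n + 2) * (I.n * I.n) ≤ X
  relax : (I.n + 2) * (I.n * I.n) * I.n ≤ X
  rounds : I.rounds ≤ X
  guesses : I.guesses ≤ X
  cand : (I.k + 1) * I.n ≤ X

variable {I}

lemma Enough.sq (h : I.Enough X) : 4 + 4 * (I.n * I.n) + I.n ≤ X := by
  have := I.sq_le_size
  have := h.size
  omega

lemma Enough.fits_of_le (h : I.Enough X) {z : ℤ} (hz : z.natAbs ≤ 2 ^ (4 * I.size)) :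
    Fits X z :=
  lt_of_le_of_lt hz (Nat.pow_lt_pow_right (by norm_num) (by have := h.size; omega))

lemma Enough.fits_of_le_of_le (h : I.Enough X) {z : ℤ} {m : ℕ} (hm : m ≤ 4 * I.size)
    (hz : z.natAbs ≤ 2 ^ m) : Fits X z :=
  h.fits_of_le (hz.trans (Nat.pow_le_pow_right (by norm_num) hm))

lemma Enough.fits_one (h : I.Enough X) : Fits X 1 := RAM.fits_one (by have := h.size; omega)

lemma Enough.fits_inf (h : I.Enough X) : Fits X I.inf := h.fits_of_le I.inf_natAbs_le

lemma Enough.fits_scale (h : I.Enough X) {m : ℕ} (hm : m ≤ I.n * I.n) : Fits X (I.denProd m) :=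
  h.fits_of_le_of_le (by omega) (I.denProd_le hm)

lemma Enough.fits_scaledEntry (h : I.Enough X) (i : ℕ) : Fits X (I.scaledEntry i) :=
  h.fits_of_le_of_le (by omega) (I.scaledEntry_natAbs_le i)

lemma Enough.fits_scaledSum (h : I.Enough X) {m : ℕ} (hm : m ≤ I.n * I.n) :
    Fits X (I.scaledSum m) :=
  h.fits_of_le_of_le (by omega) (I.scaledSum_natAbs_le hm)

lemma Enough.fits_inputEntry (h : I.Enough X) (a : ℕ) : Fits X (I.inputEntry a) :=
  h.fits_of_le_of_le (by omega) (I.natAbs_inputEntry_lt a).le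

variable (I)

/-- The cells with nonnegative address hold the input. -/
def HoldsInput (M : Mem) : Prop := ∀ a : ℕ, M a = I.inputEntry a

variable {I}

lemma HoldsInput.set (h : I.HoldsInput M) (r : Reg) (i : ℕ) (z : ℤ) :
    I.HoldsInput (set M r i z) := fun a => by
  rw [set_apply_of_nonneg M (by positivity) (by positivity), h a]

lemma HoldsInput.set_zero (h : I.HoldsInput M) (r : Reg) (z : ℤ) :
    I.HoldsInput (RAM.set M r 0 z) := h.set r 0 z

lemma holdsInput_inputMem : I.HoldsInput (inputMem I.encode) := fun a => by
  simp [inputMem, inputEntry]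

variable (I)

/-- The registers for the numbers of the instance are filled. -/
structure Header (M : Mem) : Prop where
  n : get M .n 0 = I.n
  k : get M .k 0 = I.k
  p : get M .p 0 = I.p
  q : get M .q 0 = I.q
  num : get M .num 0 = I.n * I.n

variable {I}

lemma Header.of_agreeOff (h : I.Header M) (hJ : AgreeOff J M M')
    (hdis : ∀ r ∈ [Reg.n, .k, .p, .q, .num], r ∉ J) : I.Header M' :=
  ⟨(hJ _ (hdis _ (by simp)) _).trans h.n, (hJ _ (hdis _ (by simp)) _).trans h.k,
    (hJ _ (hdis _ (by simp)) _).trans h.p, (hJ _ (hdis _ (by simp)) _).trans h.q,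
    (hJ _ (hdis _ (by simp)) _).trans h.num⟩

lemma wp_readHeader (hX : I.Enough X) (h : I.HoldsInput M) :
    wp X readHeader M fun M' => I.HoldsInput M' ∧ I.Header M' := by
  have h0 : ∀ {M}, I.HoldsInput M → M 0 = I.n := fun h => (h 0).trans I.inputEntry_zero
  have h1 : ∀ {M}, I.HoldsInput M → M 1 = I.k := fun h => (h 1).trans I.inputEntry_one
  have h2 : ∀ {M}, I.HoldsInput M → M 2 = I.p := fun h => (h 2).trans I.inputEntry_two
  have h3 : ∀ {M}, I.HoldsInput M → M 3 = I.q := fun h => (h 3).trans I.inputEntry_three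
  have e1 := h.set_zero .n I.n
  have e2 := e1.set_zero .k I.k
  have e3 := e2.set_zero .p I.p
  have e4 := e3.set_zero .q I.q
  have e5 := e4.set_zero .num (I.n * I.n)
  refine wp_seq (wp_assign ?_ (wp_seq (wp_assign ?_ (wp_seq (wp_assign ?_ (wp_seq (wp_assign ?_
    (wp_assign ?_ ?_))))))))
  all_goals simp only [eval_load, eval_zero, eval_one, eval_ofNat, eval_mul, eval_reg, get_set,
    h0 h, h1 e1, h2 e2, h3 e3]
  · exact I.inputEntry_zero ▸ hX.fits_inputEntry 0
  · exact I.inputEntry_one ▸ hX.fits_inputEntry 1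
  · exact I.inputEntry_two ▸ hX.fits_inputEntry 2
  · exact I.inputEntry_three ▸ hX.fits_inputEntry 3
  · simpa using fits_natCast (X := X) (m := I.n * I.n) (by have := hX.sq; omega)
  · simp only [reduceCtorEq, and_true, if_false, if_true]
    exact ⟨e5, by constructor <;> simp⟩

lemma wp_readScale (hX : I.Enough X) (h : I.HoldsInput M) (hh : I.Header M) :
    wp X readScale M fun M' => I.HoldsInput M' ∧ get M' .pd 0 = I.scale := by
  refine wp_seq (wp_assign hX.fits_one ?_)
  refine wp_forLoop (J := [.pd]) (N := I.n * I.n) (by have := hX.sq; omega)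
    (fun j M => I.HoldsInput M ∧ get M .pd 0 = I.denProd j) (by simp) (by simp) ?_ ?_ ?_ ?_
  · intro M' h'
    simp [h' .num (by simp), hh.num]
  · refine ⟨(h.set_zero _ _).set_zero _ _, by simp [denProd]⟩
  · rintro j hj M' h' hi ⟨h1, h2⟩
    have h3 : M' (6 + 3 * j) = I.denEntry j := by exact_mod_cast h1 (6 + 3 * j)
    have h4 : get M' .pd 0 * M' (6 + 3 * j) = I.denProd (j + 1) := by
      rw [h2, h3, denProd, denProd, Finset.prod_range_succ]
    refine wp_assign ?_ fun _ => ?_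
    · simpa [hi, h4] using hX.fits_scale (by omega)
    · exact ⟨(h1.set_zero _ _).set_zero _ _, by simp [hi, h4]⟩
  · rintro M' h' ⟨h1, h2⟩
    exact ⟨h1, h2⟩

lemma eval_scaledWeight (h : I.HoldsInput M) (hpd : get M .pd 0 = I.scale) {j : ℕ}
    (hj : get M .i 0 = j) : scaledWeight.eval M = I.scaledEntry j := by
  have h3 : M (6 + 3 * j) = I.denEntry j := by exact_mod_cast h (6 + 3 * j)
  have h4 : M (5 + 3 * j) = I.inputEntry (5 + 3 * j) := by exact_mod_cast h (5 + 3 * j)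
  simp [scaledWeight, hj, h3, h4, hpd, scaledEntry]

lemma wp_readInf (hX : I.Enough X) (h : I.HoldsInput M) (hh : I.Header M)
    (hpd : get M .pd 0 = I.scale) :
    wp X readInf M fun M' => I.HoldsInput M' ∧ get M' .inf 0 = I.inf := by
  refine wp_seq (wp_assign fits_zero (wp_seq ?_))
  refine wp_forLoop (J := [.sum]) (N := I.n * I.n) (by have := hX.sq; omega)
    (fun j M => I.HoldsInput M ∧ get M .sum 0 = I.scaledSum j) (by simp) (by simp) ?_ ?_ ?_ ?_
  · intro M' h'
    simp [h' .num (by simp), hh.num]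
  · refine ⟨(h.set_zero _ _).set_zero _ _, by simp [scaledSum]⟩
  · rintro j hj M' h' hi ⟨h1, h2⟩
    have h3 := eval_scaledWeight h1 (by simp [h' .pd (by simp), hpd]) hi
    have h4 : get M' .sum 0 + scaledWeight.eval M' = I.scaledSum (j + 1) := by
      rw [h2, h3, scaledSum, scaledSum, Finset.sum_range_succ]
    refine wp_assign ?_ fun _ => ?_
    · simpa [h4] using hX.fits_scaledSum (by omega)
    · exact ⟨(h1.set_zero _ _).set_zero _ _, by simp [h4]⟩
  · rintro M' h' ⟨h1, h2⟩
    have h3 : (reg .n * reg .sum + 1 : Term).eval M' = I.inf := by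
      simp [h' .n (by simp), hh.n, h2, inf]
    refine wp_assign (h3 ▸ hX.fits_inf) ?_
    rw [h3]
    exact ⟨h1.set_zero _ _, by simp⟩

lemma wp_readWeights (hX : I.Enough X) (h : I.HoldsInput M) (hh : I.Header M)
    (hpd : get M .pd 0 = I.scale) (hinf : get M .inf 0 = I.inf) :
    wp X readWeights M fun M' => I.HoldsInput M' ∧
      ∀ i < I.n * I.n, get M' .w i = I.weightEntry i := by
  refine wp_forLoop (J := [.w]) (N := I.n * I.n) (by have := hX.sq; omega)
    (fun j M => I.HoldsInput M ∧ ∀ i < j, get M .w i = I.weightEntry i) (by simp) (by simp)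
    ?_ ?_ ?_ ?_
  · intro M' h'
    simp [h' .num (by simp), hh.num]
  · exact ⟨h.set_zero _ _, by simp⟩
  · rintro j hj M' h' hi ⟨h1, h2⟩
    have h3 := eval_scaledWeight h1 (by simp [h' .pd (by simp), hpd]) hi
    have h4 : M' (4 + 3 * j) = I.inputEntry (4 + 3 * j) := by exact_mod_cast h1 (4 + 3 * j)
    have h5 : get M' .inf 0 = I.inf := by simp [h' .inf (by simp), hinf]
    have key : ∀ e : Term, e.eval M' = I.weightEntry j → Fits X (I.weightEntry j) →
        wp X (put .w (reg .i) e) M' fun M'' => AgreeOff [.w] M' M'' →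
          I.HoldsInput (set M'' .i 0 (j + 1)) ∧
          ∀ i < j + 1, get (set M'' .i 0 (j + 1)) .w i = I.weightEntry i := by
      intro e he hf
      refine wp_put (he ▸ hf) fun _ => ?_
      rw [he, eval_reg, hi]
      refine ⟨(h1.set _ _ _).set_zero _ _, fun i hij => ?_⟩
      by_cases h : i = j
      · subst h
        simp
      · simpa [h] using h2 i (by omega)
    refine wp_cond (fun hc => ?_) fun hc => ?_
    · have hw : I.weightEntry j = I.scaledEntry j := by
        rw [weightEntry, if_neg]
        simpa [hi, h4] using hc
      exact key _ (h3.trans hw.symm) (hw ▸ hX.fits_scaledEntry j)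
    · have hw : I.weightEntry j = I.inf := by
        rw [weightEntry, if_pos]
        simpa [hi, h4] using hc
      exact key _ (by simp [h5, hw]) (hw ▸ hX.fits_inf)
  · rintro M' h' h1
    exact h1

open Classical in
lemma wp_readPairs (hX : I.Enough X) (h : I.HoldsInput M) (hh : I.Header M) :
    wp X readPairs M fun M' => I.HoldsInput M' ∧
      ∀ i < I.n * I.n, get M' .tm i = if I.IsPair i then 1 else 0 := by
  refine wp_forLoop (J := [.tm]) (N := I.n * I.n) (by have := hX.sq; omega)
    (fun j M => I.HoldsInput M ∧ ∀ i < j, get M .tm i = if I.IsPair i then 1 else 0)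
    (by simp) (by simp) ?_ ?_ ?_ ?_
  · intro M' h'
    simp [h' .num (by simp), hh.num]
  · exact ⟨h.set_zero _ _, by simp⟩
  · rintro j hj M' h' hi ⟨h1, h2⟩
    have h4 : M' (4 + 3 * (I.n * I.n) + j) = I.inputEntry (4 + 3 * (I.n * I.n) + j) := by
      exact_mod_cast h1 (4 + 3 * (I.n * I.n) + j)
    have h5 : I.inputEntry (4 + 3 * (I.n * I.n) + j) = if I.IsPair j then 1 else 0 := by
      obtain ⟨u, v, rfl⟩ := exists_pairIndex hj
      rw [inputEntry_pair]
      refine if_congr ⟨fun h => ⟨u, v, rfl, h⟩, ?_⟩ rfl rfl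
      rintro ⟨u', v', h, hT⟩
      obtain ⟨rfl, rfl⟩ := pairIndex_inj h
      exact hT
    have h6 : (Term.load (4 + 3 * reg .num + reg .i)).eval M' =
        I.inputEntry (4 + 3 * (I.n * I.n) + j) := by
      simp [h' .num (by simp), hh.num, hi, h4]
    refine wp_put (h6 ▸ hX.fits_inputEntry _) fun _ => ?_
    rw [h6, h5, eval_reg, hi]
    refine ⟨(h1.set _ _ _).set_zero _ _, fun i hij => ?_⟩
    by_cases h : i = j
    · subst h
      simp
    · simpa [h] using h2 i (by omega)
  · rintro M' h' h1
    exact h1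

variable (I)

open Classical in
/-- The vertices of `Z` below `m`, in order. -/
noncomputable def separatorBelow (m : ℕ) : List ℕ :=
  (List.range m).filter fun a => I.inputEntry (4 + 4 * (I.n * I.n) + a) ≠ 0

lemma separatorBelow_eq : I.separatorBelow I.n = I.separatorList.map Fin.val := by
  classical
  rw [separatorBelow, separatorList, ← List.map_coe_finRange_eq_range, List.filter_map]
  congr 1
  refine List.filter_congr fun v _ => ?_
  simp [inputEntry_separator]

lemma length_separatorBelow_le (m : ℕ) : (I.separatorBelow m).length ≤ m :=
  (List.length_filter_le _ _).trans (by simp)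

/-- The memory describes the set `Z`. -/
structure HoldsSeparator (M : Mem) : Prop where
  zf : ∀ v : Fin I.n, open Classical in get M .zf (v : ℕ) = if v ∈ I.Z then 1 else 0
  zc : get M .zc 0 = I.separatorList.length
  zl : ∀ (d : ℕ) (h : d < I.separatorList.length), get M .zl d = (I.separatorList[d] : ℕ)

variable {I}

lemma wp_readSeparator (hX : I.Enough X) (h : I.HoldsInput M) (hh : I.Header M) :
    wp X readSeparator M I.HoldsSeparator := by
  classical
  refine wp_seq (wp_assign fits_zero ?_)
  refine wp_forLoop (J := [.zf, .zl, .zc]) (N := I.n) (by have := hX.sq; omega)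
    (fun j M => I.HoldsInput M ∧
      (∀ i < j, get M .zf i = I.inputEntry (4 + 4 * (I.n * I.n) + i)) ∧
      get M .zc 0 = (I.separatorBelow j).length ∧
      ∀ (d : ℕ) (h : d < (I.separatorBelow j).length), get M .zl d = (I.separatorBelow j)[d])
    (by simp) (by simp) ?_ ?_ ?_ ?_
  · intro M' h'
    simp [h' .n (by simp), hh.n]
  · exact ⟨(h.set_zero _ _).set_zero _ _, by simp, by simp [separatorBelow],
      by simp [separatorBelow]⟩
  · rintro j hj M' h' hi ⟨h1, h2, h3, h4⟩
    have h5 : M' (4 + 4 * (I.n * I.n) + j) = I.inputEntry (4 + 4 * (I.n * I.n) + j) := by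
      exact_mod_cast h1 (4 + 4 * (I.n * I.n) + j)
    have h6 : (Term.load (4 + 4 * reg .num + reg .i)).eval M' =
        I.inputEntry (4 + 4 * (I.n * I.n) + j) := by
      simp [h' .num (by simp), hh.num, hi, h5]
    refine wp_seq (wp_put (h6 ▸ hX.fits_inputEntry _) ?_)
    rw [h6, eval_reg, hi]
    have h7 : ∀ i < j + 1, (if i = j then I.inputEntry (4 + 4 * (I.n * I.n) + j) else
        get M' .zf i) = I.inputEntry (4 + 4 * (I.n * I.n) + i) := by
      intro i hij
      split_ifs with h
      · rw [h]
      · exact h2 i (by omega)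
    have hle := I.length_separatorBelow_le j
    refine wp_ifThen (fun hc => ?_) fun hc _ => ?_
    · have hz : I.separatorBelow (j + 1) = I.separatorBelow j ++ [j] := by
        rw [separatorBelow, List.range_succ, List.filter_append]
        have : I.inputEntry (4 + 4 * (I.n * I.n) + j) ≠ 0 := by simpa [hi] using hc
        simp [this, separatorBelow]
      refine wp_seq (wp_put ?_ (wp_assign ?_ fun _ => ?_))
      · simpa [hi] using fits_natCast (X := X) (m := j) (by have := hX.sq; omega)
      · have := fits_natCast (X := X) (m := (I.separatorBelow j).length + 1)
          (by have := hX.sq; omega)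
        simpa [h3] using this
      · simp only [eval_reg, get_set, eval_add, eval_one, reduceCtorEq, false_and, if_false, h3,
          hi]
        refine ⟨(((h1.set _ _ _).set _ _ _).set_zero _ _).set_zero _ _, ?_, ?_, ?_⟩
        · simpa using h7
        · simp [hz]
        · intro d hd
          by_cases hdl : d = (I.separatorBelow j).length
          · subst hdl
            simp [hz]
          · have hd' : d < (I.separatorBelow j).length := by
              simp only [hz, List.length_append, List.length_singleton] at hd
              omega
            simp [hz, hdl, h4 d hd', List.getElem_append_left hd']
    · have hz : I.separatorBelow (j + 1) = I.separatorBelow j := by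
        rw [separatorBelow, List.range_succ, List.filter_append]
        have : I.inputEntry (4 + 4 * (I.n * I.n) + j) = 0 := by simpa [hi] using hc
        simp [this, separatorBelow]
      refine ⟨(h1.set _ _ _).set_zero _ _, by simpa using h7, by simp [hz, h3], ?_⟩
      intro d hd
      simp only [hz] at hd ⊢
      simp [h4 d hd]
  · rintro M' h' ⟨h1, h2, h3, h4⟩
    rw [separatorBelow_eq] at h3
    refine ⟨fun v => (h2 v v.2).trans (I.inputEntry_separator v), by simpa using h3, fun d hd => ?_⟩
    have := h4 d (by rw [separatorBelow_eq]; simpa using hd)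
    simpa [I.separatorBelow_eq] using this

end SeparatedInstance

/-! ### Computing the distances -/

namespace SeparatedInstance

open RAM SimpleGraph

variable (I : SeparatedInstance)

/-- The graphs whose distances are computed: `G - c` for a vertex `c`, then `G`, then `G - Z`. -/
def distGraph (c : ℕ) : SimpleGraph (Fin I.n) :=
  avoid I.G fun v => c = v ∨ (c = I.n + 1 ∧ v ∈ I.Z)

lemma distGraph_vertex (c : Fin I.n) : I.distGraph c = avoid I.G (· = c) := by
  have := c.2
  rw [distGraph]
  congr 1
  ext v
  rw [Fin.ext_iff]
  exact ⟨fun h => h.elim (fun h => h.symm) fun h => by omega, fun h => Or.inl h.symm⟩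

/-- No vertex has the number `n` or `n + 1`: the first index deletes nothing, and the second is free
to mark the deletion of `Z`. -/
lemma distGraph_n : I.distGraph I.n = I.G := by
  ext u v
  have h1 := u.2
  have h2 := v.2
  refine ⟨fun h => h.1, fun h => ⟨h, ?_, ?_⟩⟩ <;> rintro (h | h) <;> omega

lemma distGraph_succ : I.distGraph (I.n + 1) = avoid I.G (· ∈ I.Z) := by
  rw [distGraph]
  congr 1
  ext v
  have := v.2
  exact ⟨fun h => h.elim (fun h => by omega) fun h => h.2, fun h => Or.inr ⟨rfl, h⟩⟩

/-- The position of an entry of the table of distances. -/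
def distIndex {n : ℕ} (c : ℕ) (a b : Fin n) : ℕ := (c * n + a) * n + b

lemma eq_of_mul_add_eq {n s s' e e' : ℕ} (he : e < n) (he' : e' < n)
    (h : s * n + e = s' * n + e') : s = s' ∧ e = e' := by
  have h1 : (s * n + e) / n = s := by
    rw [mul_comm, Nat.mul_add_div (by omega), Nat.div_eq_of_lt he, add_zero]
  have h2 : (s' * n + e') / n = s' := by
    rw [mul_comm, Nat.mul_add_div (by omega), Nat.div_eq_of_lt he', add_zero]
  have h3 : s = s' := by rw [← h1, h, h2]
  subst h3
  exact ⟨rfl, by omega⟩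

lemma distIndex_inj {n c c' : ℕ} {a a' b b' : Fin n} (h : distIndex c a b = distIndex c' a' b') :
    c = c' ∧ a = a' ∧ b = b' := by
  obtain ⟨h1, h2⟩ := eq_of_mul_add_eq b.2 b'.2 h
  obtain ⟨h3, h4⟩ := eq_of_mul_add_eq a.2 a'.2 h1
  exact ⟨h3, Fin.ext h4, Fin.ext h2⟩

lemma distIndex_lt {n c m : ℕ} (hc : c < m) (a b : Fin n) : distIndex c a b < m * (n * n) := by
  have h1 : (c + 1) * (n * n) ≤ m * (n * n) := Nat.mul_le_mul_right _ hc
  have h2 := pairIndex_lt a b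
  rw [pairIndex] at h2
  have h3 : distIndex c a b = c * (n * n) + (a * n + b) := by rw [distIndex]; ring
  rw [add_mul] at h1
  omega

lemma exists_distIndex {n m i : ℕ} (hi : i < m * (n * n)) :
    ∃ c < m, ∃ a b : Fin n, i = distIndex c a b := by
  have hn : 0 < n := Nat.pos_of_ne_zero fun h => by simp [h] at hi
  refine ⟨i / n / n, ?_, ⟨i / n % n, Nat.mod_lt _ hn⟩, ⟨i % n, Nat.mod_lt _ hn⟩, ?_⟩
  · rw [Nat.div_div_eq_div_mul]
    exact Nat.div_lt_of_lt_mul (by rwa [mul_comm])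
  · have h1 := Nat.div_add_mod i n
    have h2 := Nat.div_add_mod (i / n) n
    simp only [distIndex]
    rw [mul_comm (i / n / n), h2, mul_comm (i / n), h1]

/-- The entries below `inf` are scaled weights of walks. -/
def SoundTable (D : ℕ → ℤ) : Prop := ∀ c < I.n + 2, ∀ a b : Fin I.n,
  0 ≤ D (distIndex c a b) ∧ D (distIndex c a b) ≤ I.inf ∧
    (D (distIndex c a b) < I.inf →
      ∃ P : (I.distGraph c).Walk a b, walkWeight _ I.w P * I.scale = D (distIndex c a b))

/-- The entries are at most the scaled weights of the walks of length at most `r`. -/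
def CompleteTable (r : ℕ) (D : ℕ → ℤ) : Prop := ∀ c < I.n + 2, ∀ a b : Fin I.n,
  ∀ P : (I.distGraph c).Walk a b, P.length ≤ r →
    (D (distIndex c a b) : ℚ) ≤ walkWeight _ I.w P * I.scale

/-- The first `j` relaxations of a round have been done. -/
def RelaxedTable (r j : ℕ) (D : ℕ → ℤ) : Prop := ∀ c < I.n + 2, ∀ a b e : Fin I.n,
  distIndex c a b * I.n + e < j → ∀ P : (I.distGraph c).Walk a e, P.length ≤ r →
    (I.distGraph c).Adj e b →
      (D (distIndex c a b) : ℚ) ≤ (walkWeight _ I.w P + I.w s(e, b)) * I.scale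

/-- The test before a relaxation. -/
def Relaxes (D : ℕ → ℤ) (c : ℕ) (a b e : Fin I.n) : Prop :=
  ((¬ c = e ∧ ¬ c = b) ∧ ¬ (c = I.n + 1 ∧ (e ∈ I.Z ∨ b ∈ I.Z))) ∧
    D (distIndex c a e) + I.weightEntry (pairIndex e b) < D (distIndex c a b)

variable {I}

lemma weightEntry_of_distGraph_adj {c : ℕ} {u v : Fin I.n} (h : (I.distGraph c).Adj u v) :
    (I.weightEntry (pairIndex u v) : ℚ) = I.w s(u, v) * I.scale := I.weightEntry_of_adj h.1

/-- Entries only decrease, so upper bounds already reached persist although the table is updated in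
place. For soundness, a new entry lies below an entry that is at most `inf`; hence both summands are
below `inf`, the first is the weight of a walk and the second that of a genuine edge, since
non-edges carry the weight `inf`. -/
lemma relax_table {D D' : ℕ → ℤ} {r c : ℕ} {a b e : Fin I.n} (hc : c < I.n + 2)
    (hs : I.SoundTable D) (hC : I.CompleteTable r D)
    (hR : I.RelaxedTable r (distIndex c a b * I.n + e) D)
    (h₁ : I.Relaxes D c a b e → ∀ i, D' i = if i = distIndex c a b then
      D (distIndex c a e) + I.weightEntry (pairIndex e b) else D i)
    (h₂ : ¬ I.Relaxes D c a b e → ∀ i, D' i = D i) :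
    I.SoundTable D' ∧ I.CompleteTable r D' ∧
      I.RelaxedTable r (distIndex c a b * I.n + e + 1) D' := by
  have hle : ∀ i, D' i ≤ D i := by
    intro i
    by_cases h : I.Relaxes D c a b e
    · rw [h₁ h]
      split_ifs with hi
      · exact hi ▸ h.2.le
      · exact le_rfl
    · exact (h₂ h i).le
  have hleQ : ∀ i, (D' i : ℚ) ≤ D i := fun i => by exact_mod_cast hle i
  refine ⟨fun c' hc' a' b' => ?_, fun c' hc' a' b' P hP => (hleQ _).trans (hC c' hc' a' b' P hP),
    fun c' hc' a' b' e' hlt P hP hadj => ?_⟩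
  · obtain ⟨h3, h4, h5⟩ := hs c' hc' a' b'
    by_cases h : I.Relaxes D c a b e
    swap
    · rw [h₂ h]
      exact ⟨h3, h4, h5⟩
    rw [h₁ h]
    split_ifs with hi
    swap
    · exact ⟨h3, h4, h5⟩
    obtain ⟨rfl, rfl, rfl⟩ := distIndex_inj hi
    obtain ⟨h6, -, h7⟩ := hs c' hc' a' e
    have h8 := I.weightEntry_nonneg (pairIndex_lt e b')
    obtain ⟨⟨⟨hce, hcb⟩, hZ⟩, hlt⟩ := h
    refine ⟨by omega, by omega, fun _ => ?_⟩
    obtain ⟨P, hP⟩ := h7 (by omega)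
    have hadj : (I.distGraph c').Adj e b' := by
      refine ⟨I.adj_of_weightEntry_lt (by omega), ?_, ?_⟩
      · rintro (h | h)
        · exact hce h
        · exact hZ ⟨h.1, Or.inl h.2⟩
      · rintro (h | h)
        · exact hcb h
        · exact hZ ⟨h.1, Or.inr h.2⟩
    refine ⟨P.append (Walk.cons hadj Walk.nil), ?_⟩
    rw [walkWeight_append, walkWeight_cons, walkWeight_nil, add_zero, add_mul, hP,
      ← weightEntry_of_distGraph_adj hadj]
    push_cast
    rfl
  · rcases Nat.lt_succ_iff_lt_or_eq.1 hlt with hlt | heq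
    · exact (hleQ _).trans (hR c' hc' a' b' e' hlt P hP hadj)
    obtain ⟨h3, h4⟩ := eq_of_mul_add_eq e'.2 e.2 heq
    obtain ⟨rfl, rfl, rfl⟩ := distIndex_inj h3
    obtain rfl := Fin.ext h4
    have h5 : D' (distIndex c' a' b') ≤
        D (distIndex c' a' e') + I.weightEntry (pairIndex e' b') := by
      by_cases h : I.Relaxes D c' a' b' e'
      · rw [h₁ h, if_pos rfl]
      · rw [h₂ h]
        by_contra hcon
        refine h ⟨⟨⟨fun h => hadj.2.1 (Or.inl h), fun h => hadj.2.2 (Or.inl h)⟩, ?_⟩, by omega⟩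
        rintro ⟨h, h' | h'⟩
        · exact hadj.2.1 (Or.inr ⟨h, h'⟩)
        · exact hadj.2.2 (Or.inr ⟨h, h'⟩)
    have h6 := hC c' hc' a' e' P hP
    have h7 : (D' (distIndex c' a' b') : ℚ) ≤
        D (distIndex c' a' e') + I.weightEntry (pairIndex e' b') := by exact_mod_cast h5
    rw [weightEntry_of_distGraph_adj hadj] at h7
    linarith

/-- The last edge of a walk of length `r + 1` is split off, as the first edge of the reversed walk;
the relaxation for this edge has taken place. -/
lemma completeTable_succ {D : ℕ → ℤ} {r : ℕ} (hC : I.CompleteTable r D)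
    (hR : I.RelaxedTable r ((I.n + 2) * (I.n * I.n) * I.n) D) : I.CompleteTable (r + 1) D := by
  intro c hc a b P hP
  by_cases hP' : P.length ≤ r
  · exact hC c hc a b P hP'
  have key : ∀ {b a : Fin I.n} (P : (I.distGraph c).Walk b a), P.length = r + 1 →
      ∃ (e : Fin I.n) (h : (I.distGraph c).Adj b e) (Q : (I.distGraph c).Walk e a),
        P = Walk.cons h Q ∧ Q.length = r := by
    intro b a P hP
    cases P with
    | nil => simp at hP
    | cons h Q => exact ⟨_, h, Q, rfl, by simpa using hP⟩
  obtain ⟨e, h, Q, hPQ, hQ⟩ := key P.reverse (by simp; omega)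
  have hlt : distIndex c a b * I.n + e < (I.n + 2) * (I.n * I.n) * I.n := by
    have h1 : (distIndex c a b + 1) * I.n ≤ (I.n + 2) * (I.n * I.n) * I.n :=
      Nat.mul_le_mul_right _ (distIndex_lt hc a b)
    have := e.2
    rw [add_mul] at h1
    omega
  have h1 := hR c hc a b e hlt Q.reverse (by simp [hQ]) h.symm
  have h2 : walkWeight _ I.w P = walkWeight _ I.w P.reverse := by simp
  rw [h2, hPQ, walkWeight_cons, Sym2.eq_swap]
  rw [walkWeight_reverse] at h1
  rwa [add_comm]

/-- Removing loops leaves fewer than `n` edges and does not increase the weight, so `n` rounds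
suffice. -/
lemma isDist_of_table {D : ℕ → ℤ} (hs : I.SoundTable D) (hC : I.CompleteTable I.n D) {c : ℕ}
    (hc : c < I.n + 2) (a b : Fin I.n) :
    IsDist (I.distGraph c) I.w I.scale I.inf a b (D (distIndex c a b)) := by
  refine ⟨(hs c hc a b).1, (hs c hc a b).2.2, fun P => ?_⟩
  have h1 := hC c hc a b P.bypass (by simpa using P.bypass_isPath.length_lt.le)
  have h2 := (I.noNegativeCycle.of_le (avoid_le _ _)).walkWeight_bypass_le P
  have h3 : (0 : ℚ) ≤ I.scale := by exact_mod_cast I.scale_pos.le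
  exact h1.trans (mul_le_mul_of_nonneg_right h2 h3)

end SeparatedInstance

namespace RAM

/-- The table of distances before the first round. -/
def initDist : Program :=
  forLoop .i ((reg .n + 2) * reg .num)
    (assign .t (reg .i / reg .n) ;; assign .b (reg .i - reg .t * reg .n) ;;
      assign .a (reg .t - reg .t / reg .n * reg .n) ;;
      .cond ((reg .a).eq (reg .b)) (put .d (reg .i) 0) (put .d (reg .i) (reg .inf)))

/-- Whether the edge is deleted in the graph of the table. -/
def deletedTest : Term :=
  (reg .c).eq (reg .e) + (reg .c).eq (reg .b) +
    (reg .c).eq (reg .n + 1) * (entry .zf (reg .e) + entry .zf (reg .b))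

/-- One relaxation. -/
def relaxDist : Program :=
  assign .s (reg .i / reg .n) ;; assign .e (reg .i - reg .s * reg .n) ;;
  assign .t (reg .s / reg .n) ;; assign .b (reg .s - reg .t * reg .n) ;;
  assign .c (reg .t / reg .n) ;;
  assign .u (entry .d (reg .t * reg .n + reg .e) + entry .w (reg .e * reg .n + reg .b)) ;;
  ifThen (deletedTest.eq 0 * (reg .u).lt (entry .d (reg .s))) (put .d (reg .s) (reg .u))

/-- The rounds of relaxations. -/
def computeDist : Program :=
  initDist ;; forLoop .round (reg .n)
    (forLoop .i ((reg .n + 2) * reg .num * reg .n) relaxDist)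

section Rules

variable {X : ℕ} {P : Program} {M : Mem} {Q : Mem → Prop}

lemma wp_assign_seq {r : Reg} {e : Term} {z : ℤ} (he : e.eval M = z) (hz : Fits X z)
    (h : wp X P (set M r 0 z) Q) : wp X (assign r e ;; P) M Q := by
  subst he
  exact wp_seq (wp_assign hz h)

end Rules

lemma fdiv_mul_add {n s e : ℕ} (he : e < n) : Int.fdiv ((s * n + e : ℕ) : ℤ) n = s := by
  rw [← Int.ofNat_fdiv, mul_comm, Nat.mul_add_div (by omega), Nat.div_eq_of_lt he, add_zero]

lemma mul_add_sub_mul (n s e : ℕ) : ((s * n + e : ℕ) : ℤ) - s * n = e := by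
  push_cast
  ring

end RAM

namespace SeparatedInstance

open RAM

variable {I : SeparatedInstance} {X : ℕ} {M M' : Mem} {J : List Reg}

variable (I)

/-- The memory holds the data of the instance. -/
structure HoldsInstance (M : Mem) : Prop extends I.Header M, I.HoldsSeparator M where
  inf : get M .inf 0 = I.inf
  w : ∀ u v : Fin I.n, get M .w (pairIndex u v : ℕ) = I.weightEntry (pairIndex u v)
  tm : ∀ i < I.n * I.n, open Classical in get M .tm i = if I.IsPair i then 1 else 0

/-- The arrays that hold the data of the instance. -/
def instanceRegs : List Reg := [.n, .k, .p, .q, .num, .zf, .zc, .zl, .inf, .w, .tm]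

variable {I}

lemma HoldsInstance.of_agreeOff (h : I.HoldsInstance M) (hJ : AgreeOff J M M')
    (hdis : ∀ r ∈ instanceRegs, r ∉ J) : I.HoldsInstance M' where
  toHeader := h.toHeader.of_agreeOff hJ fun r hr => hdis r (by
    simp only [List.mem_cons, List.not_mem_nil, or_false, instanceRegs] at hr ⊢
    tauto)
  zf v := (hJ _ (hdis _ (by simp [instanceRegs])) _).trans (h.zf v)
  zc := (hJ _ (hdis _ (by simp [instanceRegs])) _).trans h.zc
  zl d hd := (hJ _ (hdis _ (by simp [instanceRegs])) _).trans (h.zl d hd)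
  inf := (hJ _ (hdis _ (by simp [instanceRegs])) _).trans h.inf
  w u v := (hJ _ (hdis _ (by simp [instanceRegs])) _).trans (h.w u v)
  tm i hi := (hJ _ (hdis _ (by simp [instanceRegs])) _).trans (h.tm i hi)

/-- The table of distances in the memory. -/
def distTable (M : Mem) (i : ℕ) : ℤ := get M .d i

lemma distTable_set {r : Reg} (hr : r ≠ .d) (M : Mem) (i z : ℤ) :
    distTable (RAM.set M r i z) = distTable M := by
  funext j
  simp [distTable, hr.symm]

lemma ite_ne_zero_iff (A : Prop) [Decidable A] : (if A then (1 : ℤ) else 0) ≠ 0 ↔ A := by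
  split_ifs <;> simp_all

lemma wp_initDist (hX : I.Enough X) (hI : I.HoldsInstance M) :
    wp X initDist M fun M' => I.SoundTable (distTable M') ∧
      I.CompleteTable 0 (distTable M') := by
  refine wp_forLoop (J := [.t, .b, .a, .d]) (N := (I.n + 2) * (I.n * I.n)) hX.table
    (fun j M => ∀ c < I.n + 2, ∀ a b : Fin I.n, distIndex c a b < j →
      distTable M (distIndex c a b) = if a = b then 0 else I.inf) (by simp) (by simp) ?_ ?_ ?_ ?_
  · intro M' h'
    simp [h' .num (by simp), h' .n (by simp), hI.num, hI.n]
  · simp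
  · rintro j hj M' h' hi h1
    have hI' := hI.of_agreeOff h' (by simp [instanceRegs])
    obtain ⟨c, hc, a, b, rfl⟩ := exists_distIndex hj
    have hn : 0 < I.n := a.pos
    set t := c * I.n + a with ht
    have hle : t ≤ distIndex c a b := by
      have : t ≤ t * I.n := Nat.le_mul_of_pos_right _ hn
      rw [distIndex, ← ht]
      omega
    have f1 : Int.fdiv ((distIndex c a b : ℕ) : ℤ) I.n = t := fdiv_mul_add b.2
    have f2 : ((distIndex c a b : ℕ) : ℤ) - t * I.n = (b : ℕ) := mul_add_sub_mul _ _ _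
    have f3 : Int.fdiv (t : ℤ) I.n = c := fdiv_mul_add a.2
    have f4 : (t : ℤ) - c * I.n = (a : ℕ) := mul_add_sub_mul _ _ _
    have hfit := hX.table
    have hn' := hX.sq
    have ha := a.2
    have hb := b.2
    refine wp_assign_seq (z := t) (by simp [hi, hI'.n, f1]) (fits_natCast (by omega)) ?_
    refine wp_assign_seq (z := (b : ℕ)) (by simp [hi, hI'.n, f2]) (fits_natCast (by omega)) ?_
    refine wp_assign_seq (z := (a : ℕ)) (by simp [hI'.n, f3, f4]) (fits_natCast (by omega)) ?_
    have key : ∀ z : ℤ, (z = if a = b then 0 else I.inf) → ∀ c' < I.n + 2, ∀ a' b' : Fin I.n,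
        distIndex c' a' b' < distIndex c a b + 1 →
        (if distIndex c' a' b' = distIndex c a b then z else distTable M' (distIndex c' a' b')) =
          if a' = b' then 0 else I.inf := by
      intro z hz c' hc' a' b' hlt
      split_ifs with h h' h'
      · obtain ⟨-, rfl, rfl⟩ := distIndex_inj h
        rw [hz, if_pos h']
      · obtain ⟨-, rfl, rfl⟩ := distIndex_inj h
        rw [hz, if_neg h']
      · rw [h1 c' hc' a' b' (by omega), if_pos h']
      · rw [h1 c' hc' a' b' (by omega), if_neg h']
    refine wp_cond (fun he => wp_put fits_zero fun _ => ?_) fun he => wp_put ?_ fun _ => ?_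
    · simpa [distTable, hi, hI'.inf] using key 0 (by
        rw [if_pos]
        simpa [← Fin.ext_iff] using he)
    · simpa [hI'.inf] using hX.fits_inf
    · simpa [distTable, hi, hI'.inf] using key I.inf (by
        rw [if_neg]
        simpa [← Fin.ext_iff] using he)
  · intro M' h' h1
    refine ⟨fun c hc a b => ?_, fun c hc a b P hP => ?_⟩
    · rw [h1 c hc a b (distIndex_lt hc a b)]
      split_ifs with h
      · subst h
        exact ⟨le_rfl, I.inf_pos.le, fun _ => ⟨.nil, by simp⟩⟩
      · exact ⟨I.inf_pos.le, le_rfl, fun h => absurd h (lt_irrefl _)⟩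
    · have hab := SimpleGraph.Walk.eq_of_length_eq_zero (Nat.le_zero.1 hP)
      rw [h1 c hc a b (distIndex_lt hc a b), if_pos hab]
      have h2 := (I.noNegativeCycle.of_le (avoid_le _ _)).walkWeight_nonneg P
      have h3 : (0 : ℚ) ≤ I.scale := by exact_mod_cast I.scale_pos.le
      have h4 := mul_nonneg h2 h3
      rw [Int.cast_zero]
      exact h4

/-- A relaxation forms the sum of two numbers up to `inf`; the additive slack in `Enough.size`
leaves room for the extra bit. -/
lemma Enough.fits_of_le_two_inf (hX : I.Enough X) {z : ℤ} (h0 : 0 ≤ z) (h : z ≤ 2 * I.inf) :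
    Fits X z := by
  have h1 := I.inf_natAbs_le
  have h2 : 2 ^ (4 * I.size + 1) < 2 ^ X :=
    Nat.pow_lt_pow_right (by norm_num) (by have := hX.size; omega)
  rw [pow_succ] at h2
  unfold Fits
  omega

lemma ite_sum_eq_zero_iff (A B C D E : Prop) [Decidable A] [Decidable B] [Decidable C]
    [Decidable D] [Decidable E] :
    ((if A then (1 : ℤ) else 0) + (if B then 1 else 0) +
      (if C then 1 else 0) * ((if D then 1 else 0) + (if E then 1 else 0)) = 0) ↔
      (¬ A ∧ ¬ B) ∧ ¬ (C ∧ (D ∨ E)) := by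
  split_ifs <;> simp_all

lemma wp_relaxDist (hX : I.Enough X) (hI : I.HoldsInstance M) {r c : ℕ} (hc : c < I.n + 2)
    {a b e : Fin I.n} (hi : get M .i 0 = (distIndex c a b * I.n + e : ℕ))
    (hj : distIndex c a b * I.n + e < (I.n + 2) * (I.n * I.n) * I.n)
    (hs : I.SoundTable (distTable M)) (hC : I.CompleteTable r (distTable M))
    (hR : I.RelaxedTable r (distIndex c a b * I.n + e) (distTable M)) :
    wp X relaxDist M fun M' => I.SoundTable (distTable M') ∧ I.CompleteTable r (distTable M') ∧
      I.RelaxedTable r (distIndex c a b * I.n + e + 1) (distTable M') := by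
  classical
  have hn : 0 < I.n := a.pos
  set s := distIndex c a b with hs'
  set t := c * I.n + a with ht
  have hts : t ≤ s := by
    have : t ≤ t * I.n := Nat.le_mul_of_pos_right _ hn
    rw [hs', distIndex, ← ht]
    omega
  have hst : s ≤ s * I.n + e := by
    have : s ≤ s * I.n := Nat.le_mul_of_pos_right _ hn
    omega
  have f1 : Int.fdiv ((s * I.n + e : ℕ) : ℤ) I.n = s := fdiv_mul_add e.2
  have f2 : ((s * I.n + e : ℕ) : ℤ) - s * I.n = (e : ℕ) := mul_add_sub_mul _ _ _
  have f3 : Int.fdiv (s : ℤ) I.n = t := fdiv_mul_add b.2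
  have f4 : (s : ℤ) - t * I.n = (b : ℕ) := mul_add_sub_mul _ _ _
  have f5 : Int.fdiv (t : ℤ) I.n = c := fdiv_mul_add a.2
  have hfit := hX.relax
  have hn' := hX.sq
  have he := e.2
  have hb := b.2
  have g1 : get M .d ((t : ℤ) * I.n + (e : ℕ)) = distTable M (distIndex c a e) := by
    rw [distTable, distIndex, ← ht]
    push_cast
    rfl
  have g2 : get M .w (((e : ℕ) : ℤ) * I.n + (b : ℕ)) = I.weightEntry (pairIndex e b) := by
    rw [← hI.w, pairIndex]
    push_cast
    rfl
  refine wp_assign_seq (z := s) (by rw [eval_div, eval_reg, eval_reg, hi, hI.n, f1])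
    (fits_natCast (by omega)) ?_
  refine wp_assign_seq (z := (e : ℕ)) (by
    simp only [eval_sub, eval_mul, eval_reg, get_set, reduceCtorEq, false_and, if_false,
      and_self, if_true, hi, hI.n, f2]) (fits_natCast (by omega)) ?_
  refine wp_assign_seq (z := t) (by simp [hI.n, f3]) (fits_natCast (by omega)) ?_
  refine wp_assign_seq (z := (b : ℕ)) (by simp [hI.n, f4]) (fits_natCast (by omega)) ?_
  refine wp_assign_seq (z := c) (by simp [hI.n, f5]) (fits_natCast (by omega)) ?_
  have h0 := (hs c hc a e).1
  have h0' := (hs c hc a e).2.1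
  have h0'' := I.weightEntry_nonneg (pairIndex_lt e b)
  have h0''' := I.weightEntry_le (pairIndex_lt e b)
  refine wp_assign_seq (z := distTable M (distIndex c a e) + I.weightEntry (pairIndex e b))
    (by simp [hI.n, g1, g2]) ?_ ?_
  · exact hX.fits_of_le_two_inf (by omega) (by omega)
  set M₁ := RAM.set (RAM.set (RAM.set (RAM.set (RAM.set (RAM.set M .s 0 s) .e 0 (e : ℕ)) .t 0 t)
    .b 0 (b : ℕ)) .c 0 c) .u 0 (distTable M (distIndex c a e) + I.weightEntry (pairIndex e b))
    with hM₁
  have htest : deletedTest.eval M₁ = 0 ↔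
      (¬ c = e ∧ ¬ c = b) ∧ ¬ (c = I.n + 1 ∧ (e ∈ I.Z ∨ b ∈ I.Z)) := by
    rw [← ite_sum_eq_zero_iff]
    have h6 : ((c : ℤ) = I.n + 1) ↔ c = I.n + 1 := by omega
    simp [deletedTest, hM₁, hI.zf, hI.n, h6]
  have hds : get M₁ .d s = distTable M s := by simp [hM₁, distTable]
  have hu : get M₁ .u 0 = distTable M (distIndex c a e) + I.weightEntry (pairIndex e b) := by
    simp [hM₁]
  have hss : get M₁ .s 0 = s := by simp [hM₁]
  have hD : distTable M₁ = distTable M := by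
    funext i
    simp [hM₁, distTable]
  have hrel : (deletedTest.eq 0 * (reg .u).lt (entry .d (reg .s))).eval M₁ ≠ 0 ↔
      I.Relaxes (distTable M) c a b e := by
    rw [Relaxes, ← htest, ← hs', eval_mul, eval_eq, eval_lt, mul_ne_zero_iff, ite_ne_zero_iff,
      ite_ne_zero_iff, eval_zero, eval_entry, eval_reg, eval_reg, hss, hds, hu]
  refine wp_ifThen (fun h => ?_) fun h => ?_
  · rw [hrel] at h
    refine wp_put ?_ (relax_table hc hs hC hR (fun _ i => ?_) fun h' => absurd h h')
    · rw [eval_reg, hu]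
      exact hX.fits_of_le_two_inf (by omega) (by omega)
    · simp only [distTable, eval_reg, get_set, hu, hss, true_and, Nat.cast_inj]
      refine if_congr Iff.rfl rfl ?_
      exact congrFun hD i
  · have h' : ¬ I.Relaxes (distTable M) c a b e := by
      rw [← hrel, not_not]
      exact h
    exact relax_table hc hs hC hR (fun h => absurd h h') fun _ i => congrFun hD i

/-- The memory holds the tables of distances. -/
def HoldsDist (I : SeparatedInstance) (M : Mem) : Prop := ∀ c < I.n + 2, ∀ a b : Fin I.n,
  IsDist (I.distGraph c) I.w I.scale I.inf a b (distTable M (distIndex c a b))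

/-- This is the Bellman–Ford scheme for all `n + 2` graphs and all sources at once: round `r`
extends completeness from walks of length `r` to length `r + 1`. The inner index encodes the graph
`c`, the ends `a`, `b` and the last intermediate vertex `e`. -/
lemma wp_computeDist (hX : I.Enough X) (hI : I.HoldsInstance M) :
    wp X computeDist M I.HoldsDist := by
  refine wp_seq (wp_mono (wp_agreeOff (J := [.i, .t, .b, .a, .d]) (by simp [initDist])
    (wp_initDist hX hI)) ?_)
  rintro M₁ ⟨hA₁, hs, hC⟩
  replace hI := hI.of_agreeOff hA₁ (by simp [instanceRegs])
  clear hA₁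
  refine wp_forLoop (J := [.i, .s, .e, .t, .b, .c, .u, .d]) (N := I.n)
    (by have := hX.sq; omega)
    (fun r M => I.SoundTable (distTable M) ∧ I.CompleteTable r (distTable M))
    (by simp [relaxDist]) (by simp) ?_ ?_ ?_ ?_
  · intro M' h'
    simp [h' .n (by simp), hI.n]
  · simpa [distTable_set] using ⟨hs, hC⟩
  · rintro r hr M₂ hA₂ - ⟨hs, hC⟩
    replace hI := hI.of_agreeOff hA₂ (by simp [instanceRegs])
    refine wp_forLoop (J := [.s, .e, .t, .b, .c, .u, .d]) (N := (I.n + 2) * (I.n * I.n) * I.n)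
      hX.relax (fun j M => I.SoundTable (distTable M) ∧ I.CompleteTable r (distTable M) ∧
        I.RelaxedTable r j (distTable M)) (by simp [relaxDist]) (by simp) ?_ ?_ ?_ ?_
    · intro M' h'
      simp [h' .num (by simp), h' .n (by simp), hI.n, hI.num]
    · rw [distTable_set (by simp)]
      exact ⟨hs, hC, fun _ _ _ _ _ h => absurd h (by omega)⟩
    · rintro j hj M₃ hA₃ hi ⟨hs, hC, hR⟩
      replace hI := hI.of_agreeOff hA₃ (by simp [instanceRegs])
      have hn : 0 < I.n := Nat.pos_of_ne_zero fun h => by simp [h] at hj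
      obtain ⟨c, hc, a, b, hcab⟩ := exists_distIndex (n := I.n) (m := I.n + 2) (i := j / I.n)
        (Nat.div_lt_of_lt_mul (by rwa [mul_comm]))
      obtain ⟨e, rfl⟩ : ∃ e : Fin I.n, j = distIndex c a b * I.n + e :=
        ⟨⟨j % I.n, Nat.mod_lt _ hn⟩, by rw [← hcab, mul_comm]; exact (Nat.div_add_mod _ _).symm⟩
      refine wp_mono (wp_relaxDist hX hI hc hi hj hs hC hR) fun M₄ h _ => ?_
      rwa [distTable_set (by simp)]
    · rintro M₃ - ⟨hs, hC, hR⟩ -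
      rw [distTable_set (by simp)]
      exact ⟨hs, completeTable_succ hC hR⟩
  · rintro M₂ - ⟨hs, hC⟩
    exact fun c hc a b => isDist_of_table hs hC hc a b

end SeparatedInstance

/-! ### Computing the intervals -/

namespace RAM

/-- An entry of the table of distances. -/
def distEntry (rc ra rb : Reg) : Term :=
  entry .d ((reg rc * reg .n + reg ra) * reg .n + reg rb)

/-- Whether the vertex in the register `c` separates `x` from `u` and `v`. -/
def cutTest : Term :=
  (1 - (reg .c).eq (reg .x)) * ((1 - (distEntry .c .x .u).eq (distEntry .n .x .u)) *
    (1 - (distEntry .c .x .v).eq (distEntry .n .x .v)))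

/-- The table of the intervals. -/
def computeIntervals : Program :=
  forLoop .i (reg .num * reg .n)
    (assign .s (reg .i / reg .n) ;; assign .x (reg .i - reg .s * reg .n) ;;
      assign .u (reg .s / reg .n) ;; assign .v (reg .s - reg .u * reg .n) ;;
      assign .m ((distEntry .n .u .x + distEntry .n .x .v).eq (distEntry .n .u .v) *
        (distEntry .n .u .v).lt (reg .inf)) ;;
      forLoop .c (reg .n) (ifThen cutTest (assign .m 0)) ;;
      put .itv (reg .i) (reg .m))

end RAM

namespace SeparatedInstance

open RAM

variable {I : SeparatedInstance} {X : ℕ} {M M' : Mem} {J : List Reg}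

lemma HoldsDist.of_agreeOff (h : I.HoldsDist M) (hJ : AgreeOff J M M') (hd : Reg.d ∉ J) :
    I.HoldsDist M' := by
  have : distTable M' = distTable M := funext fun i => hJ _ hd _
  intro c hc a b
  rw [this]
  exact h c hc a b

lemma eval_distEntry {rc ra rb : Reg} {c : ℕ} {a b : Fin I.n} (hc : get M rc 0 = c)
    (ha : get M ra 0 = (a : ℕ)) (hb : get M rb 0 = (b : ℕ)) (hn : get M .n 0 = I.n) :
    (distEntry rc ra rb).eval M = distTable M (distIndex c a b) := by
  simp [distEntry, distTable, distIndex, hc, ha, hb, hn]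

/-- The distances certify that `x` lies on shortest walks from `u` to `v`, and that none of the
first `j` vertices separates it from the ends. -/
def UncutBelow (I : SeparatedInstance) (D : ℕ → ℤ) (u v x : Fin I.n) (j : ℕ) : Prop :=
  D (distIndex I.n u x) + D (distIndex I.n x v) = D (distIndex I.n u v) ∧
    D (distIndex I.n u v) < I.inf ∧ ∀ c : Fin I.n, (c : ℕ) < j → c ≠ x →
      D (distIndex c x u) = D (distIndex I.n x u) ∨ D (distIndex c x v) = D (distIndex I.n x v)

/-- Table `n` supplies the distances in `G`, and table `c < n` those in `G - c`, as
`mem_geodesicInterval_iff` requires. -/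
lemma HoldsDist.uncutBelow_iff (h : I.HoldsDist M) (u v x : Fin I.n) :
    I.UncutBelow (distTable M) u v x I.n ↔ x ∈ geodesicInterval I.G I.w u v := by
  rw [mem_geodesicInterval_iff I.noNegativeCycle (s := I.scale)
    (by exact_mod_cast I.scale_pos) I.pathBound
    (δ := fun a b => distTable M (distIndex I.n a b))
    (δc := fun c a b => distTable M (distIndex c a b))
    (fun a b => by
      have := h I.n (by omega) a b
      rwa [distGraph_n] at this)
    (fun c a b => by
      have := h c (by omega) a b
      rwa [distGraph_vertex] at this)]
  simp [UncutBelow]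

/-- The memory holds the table of the intervals. -/
def HoldsIntervals (I : SeparatedInstance) (M : Mem) : Prop := ∀ u v x : Fin I.n,
  open Classical in get M .itv ((pairIndex u v * I.n + x : ℕ) : ℤ) =
    if x ∈ geodesicInterval I.G I.w u v then 1 else 0

lemma HoldsIntervals.of_agreeOff (h : I.HoldsIntervals M) (hJ : AgreeOff J M M')
    (hd : Reg.itv ∉ J) : I.HoldsIntervals M' := fun u v x => (hJ _ hd _).trans (h u v x)

lemma one_sub_ite_ne_zero_iff (A : Prop) [Decidable A] :
    1 - (if A then (1 : ℤ) else 0) ≠ 0 ↔ ¬ A := by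
  split_ifs <;> simp_all

lemma ite_mul_ite (A B : Prop) [Decidable A] [Decidable B] :
    (if A then (1 : ℤ) else 0) * (if B then 1 else 0) = if A ∧ B then 1 else 0 := by
  split_ifs <;> simp_all

open Classical in
lemma wp_cutLoop (hX : I.Enough X) (hI : I.HoldsInstance M) {u v x : Fin I.n}
    (hu : get M .u 0 = (u : ℕ)) (hv : get M .v 0 = (v : ℕ)) (hx : get M .x 0 = (x : ℕ))
    (hm : get M .m 0 = if I.UncutBelow (distTable M) u v x 0 then 1 else 0) :
    wp X (forLoop .c (reg .n) (ifThen cutTest (assign .m 0))) M fun M' =>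
      get M' .m 0 = if I.UncutBelow (distTable M) u v x I.n then 1 else 0 := by
  refine wp_forLoop (J := [.m]) (N := I.n) (by have := hX.sq; omega)
    (fun j M' => get M' .m 0 = if I.UncutBelow (distTable M) u v x j then 1 else 0)
    (by simp) (by simp) ?_ ?_ ?_ ?_
  · intro M' h'
    simp [h' .n (by simp), hI.n]
  · simpa using hm
  · intro j hj M' h' hc h1
    have hn' : get M' .n 0 = I.n := (h' .n (by simp) _).trans hI.n
    have hu' := (h' .u (by simp) _).trans hu
    have hv' := (h' .v (by simp) _).trans hv
    have hx' := (h' .x (by simp) _).trans hx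
    have hd : distTable M' = distTable M := funext fun i => h' _ (by simp) _
    have htest : cutTest.eval M' ≠ 0 ↔ j ≠ x ∧
        distTable M (distIndex j x u) ≠ distTable M (distIndex I.n x u) ∧
        distTable M (distIndex j x v) ≠ distTable M (distIndex I.n x v) := by
      simp only [cutTest, eval_mul, eval_sub, eval_eq, eval_one, mul_ne_zero_iff,
        one_sub_ite_ne_zero_iff, eval_distEntry hc hx' hu' hn', eval_distEntry hc hx' hv' hn',
        eval_distEntry hn' hx' hu' hn', eval_distEntry hn' hx' hv' hn', hd, eval_reg, hc, hx',
        Nat.cast_inj, ne_eq]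
    have hstep : I.UncutBelow (distTable M) u v x (j + 1) ↔
        I.UncutBelow (distTable M) u v x j ∧ ¬ cutTest.eval M' ≠ 0 := by
      rw [htest]
      simp only [UncutBelow, and_assoc]
      refine and_congr_right fun _ => and_congr_right fun _ => ⟨fun h => ⟨fun c hc hcx => ?_, ?_⟩,
        fun ⟨h, h'⟩ c hc hcx => ?_⟩
      · exact h c (by omega) hcx
      · rintro ⟨h1, h2, h3⟩
        exact (h ⟨j, hj⟩ (by simp) (fun h => h1 (by rw [← h]))).elim h2 h3
      · rcases Nat.lt_succ_iff_lt_or_eq.1 hc with hc | rfl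
        · exact h c hc hcx
        · by_contra! hcon
          exact h' ⟨fun h => hcx (Fin.ext h), hcon⟩
    refine wp_ifThen (fun h => wp_assign fits_zero fun _ => ?_) fun h _ => ?_
    · rw [if_neg fun h2 => (hstep.1 h2).2 h]
      simp
    · have : I.UncutBelow (distTable M) u v x (j + 1) ↔ I.UncutBelow (distTable M) u v x j := by
        rw [hstep, and_iff_left]
        simpa using h
      simp only [get_set, reduceCtorEq, false_and, if_false, h1, this]
  · intro M' _ h1
    exact h1

lemma wp_computeIntervals (hX : I.Enough X) (hI : I.HoldsInstance M) (hD : I.HoldsDist M) :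
    wp X computeIntervals M I.HoldsIntervals := by
  classical
  refine wp_forLoop (J := [.s, .x, .u, .v, .m, .c, .itv]) (N := I.n * I.n * I.n)
    (le_trans (by nlinarith) hX.table)
    (fun j M => ∀ u v x : Fin I.n, pairIndex u v * I.n + x < j →
      get M .itv ((pairIndex u v * I.n + x : ℕ) : ℤ) =
        if x ∈ geodesicInterval I.G I.w u v then 1 else 0) (by simp) (by simp) ?_ ?_ ?_ ?_
  · intro M' h'
    simp [h' .num (by simp), h' .n (by simp), hI.num, hI.n]
  · simp
  · rintro j hj M₁ h' hi h1
    have hI₁ := hI.of_agreeOff h' (by simp [instanceRegs])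
    have hD₁ := hD.of_agreeOff h' (by simp)
    have hn : 0 < I.n := Nat.pos_of_ne_zero fun h => by simp [h] at hj
    obtain ⟨u, v, huv⟩ := exists_pairIndex (n := I.n) (e := j / I.n)
      (Nat.div_lt_of_lt_mul (by rwa [mul_comm]))
    obtain ⟨x, rfl⟩ : ∃ x : Fin I.n, j = pairIndex u v * I.n + x :=
      ⟨⟨j % I.n, Nat.mod_lt _ hn⟩, by rw [huv, mul_comm]; exact (Nat.div_add_mod _ _).symm⟩
    set s := pairIndex u v with hs
    have f1 : Int.fdiv ((s * I.n + x : ℕ) : ℤ) I.n = s := fdiv_mul_add x.2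
    have f2 : ((s * I.n + x : ℕ) : ℤ) - s * I.n = (x : ℕ) := mul_add_sub_mul _ _ _
    have f3 : Int.fdiv (s : ℤ) I.n = (u : ℕ) := fdiv_mul_add v.2
    have f4 : (s : ℤ) - (u : ℕ) * I.n = (v : ℕ) := mul_add_sub_mul _ _ _
    have hn' := hX.sq
    have hs' := pairIndex_lt u v
    have hu := u.2
    have hv := v.2
    have hx := x.2
    refine wp_assign_seq (z := s) (by rw [eval_div, eval_reg, eval_reg, hi, hI₁.n, f1])
      (fits_natCast (by omega)) ?_
    refine wp_assign_seq (z := (x : ℕ)) (by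
      simp only [eval_sub, eval_mul, eval_reg, get_set, reduceCtorEq, false_and, if_false,
        and_self, if_true, hi, hI₁.n, f2]) (fits_natCast (by omega)) ?_
    refine wp_assign_seq (z := (u : ℕ)) (by simp [hI₁.n, f3]) (fits_natCast (by omega)) ?_
    refine wp_assign_seq (z := (v : ℕ)) (by simp [hI₁.n, f4]) (fits_natCast (by omega)) ?_
    set M₂ := RAM.set (RAM.set (RAM.set (RAM.set M₁ .s 0 s) .x 0 (x : ℕ)) .u 0 (u : ℕ)) .v 0
      (v : ℕ) with hM₂
    have hA₂ : AgreeOff [.s, .x, .u, .v] M₁ M₂ :=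
      (((agreeOff_set (by simp) _ _ _).trans (agreeOff_set (by simp) _ _ _)).trans
        (agreeOff_set (by simp) _ _ _)).trans (agreeOff_set (by simp) _ _ _)
    have hI₂ := hI₁.of_agreeOff hA₂ (by simp [instanceRegs])
    have hD₂ := hD₁.of_agreeOff hA₂ (by simp)
    have hu₂ : get M₂ .u 0 = (u : ℕ) := by simp [hM₂]
    have hv₂ : get M₂ .v 0 = (v : ℕ) := by simp [hM₂]
    have hx₂ : get M₂ .x 0 = (x : ℕ) := by simp [hM₂]
    have hi₂ : get M₂ .i 0 = ((s * I.n + x : ℕ) : ℤ) := (hA₂ .i (by simp) _).trans hi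
    have hitv₂ : ∀ i, get M₂ .itv i = get M₁ .itv i := hA₂ .itv (by simp)
    clear_value M₂
    have hz : ((distEntry .n .u .x + distEntry .n .x .v).eq (distEntry .n .u .v) *
        (distEntry .n .u .v).lt (reg .inf)).eval M₂ =
        if I.UncutBelow (distTable M₂) u v x 0 then 1 else 0 := by
      simp only [eval_mul, eval_eq, eval_lt, eval_add, eval_distEntry hI₂.n hu₂ hx₂ hI₂.n,
        eval_distEntry hI₂.n hx₂ hv₂ hI₂.n, eval_distEntry hI₂.n hu₂ hv₂ hI₂.n, eval_reg,
        hI₂.inf, UncutBelow, not_lt_zero, IsEmpty.forall_iff, implies_true, and_true, ite_mul_ite]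
    refine wp_assign_seq hz ?_ (wp_seq (wp_mono (wp_agreeOff (J := [.c, .m]) (by simp)
      (wp_cutLoop hX (hI₂.of_agreeOff (agreeOff_set (J := [.m]) (by simp) _ _ _)
        (by simp [instanceRegs])) (u := u) (v := v) (x := x) (by simpa using hu₂)
        (by simpa using hv₂) (by simpa using hx₂) ?_)) ?_))
    · split_ifs
      · exact hX.fits_one
      · exact fits_zero
    · simp [distTable_set]
    · rintro M₃ ⟨hA₃, h3⟩
      rw [distTable_set (by simp)] at h3
      simp only [hD₂.uncutBelow_iff] at h3
      have hi₃ : get M₃ .i 0 = ((s * I.n + x : ℕ) : ℤ) := by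
        rw [hA₃ .i (by simp)]
        simpa using hi₂
      refine wp_put ?_ fun _ => ?_
      · rw [eval_reg, h3]
        split_ifs
        · exact hX.fits_one
        · exact fits_zero
      · intro u' v' x' hlt
        simp only [eval_reg, get_set, h3, hi₃, reduceCtorEq, false_and, if_false, true_and,
          Nat.cast_inj]
        by_cases h5 : pairIndex u' v' * I.n + x' = s * I.n + x
        · obtain ⟨h7, h8⟩ := eq_of_mul_add_eq x'.2 x.2 h5
          obtain ⟨rfl, rfl⟩ := pairIndex_inj h7
          obtain rfl := Fin.ext h8
          rw [if_pos h5]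
        · rw [if_neg h5, hA₃ .itv (by simp), get_set, if_neg (by simp), hitv₂,
            h1 u' v' x' (by omega)]
  · intro M' _ h1 u v x
    refine h1 u v x ?_
    have h2 : (pairIndex u v + 1) * I.n ≤ I.n * I.n * I.n :=
      Nat.mul_le_mul_right _ (pairIndex_lt u v)
    have := x.2
    rw [add_mul] at h2
    omega

end SeparatedInstance

/-! ### Searching for an unmet pair -/

namespace RAM

open Classical in
/-- The truth value of a proposition as a number. -/
noncomputable def bit (A : Prop) : ℤ := if A then 1 else 0

lemma ite_eq_bit (A : Prop) [Decidable A] : (if A then (1 : ℤ) else 0) = bit A := by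
  unfold bit
  congr

@[simp] lemma bit_true : bit True = 1 := by simp [bit]

@[simp] lemma bit_false : bit False = 0 := by simp [bit]

lemma bit_of {A : Prop} (h : A) : bit A = 1 := by simp [bit, h]

lemma bit_of_not {A : Prop} (h : ¬ A) : bit A = 0 := by simp [bit, h]

@[simp] lemma bit_eq_zero_iff {A : Prop} : bit A = 0 ↔ ¬ A := by
  by_cases h : A <;> simp [bit, h]

lemma bit_mul_bit (A B : Prop) : bit A * bit B = bit (A ∧ B) := by
  by_cases hA : A <;> by_cases hB : B <;> simp [bit, hA, hB]

lemma one_sub_bit (A : Prop) : 1 - bit A = bit (¬ A) := by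
  by_cases hA : A <;> simp [bit, hA]

lemma bit_add_pos_iff (A B : Prop) : 0 < bit A + bit B ↔ A ∨ B := by
  by_cases hA : A <;> by_cases hB : B <;> simp [bit, hA, hB]

lemma fits_bit {X : ℕ} (hX : 1 ≤ X) (A : Prop) : Fits X (bit A) := by
  by_cases hA : A
  · rw [bit_of hA]
    exact RAM.fits_one hX
  · rw [bit_of_not hA]
    exact fits_zero

/-- Tests whether the candidate set `j` leaves the interval `e`. -/
def subsetLoop : Program :=
  forLoop .x (reg .n) (ifThen (entry .cand (reg .j * reg .n + reg .x) *
    (1 - entry .itv (reg .e * reg .n + reg .x))) (assign .m 0))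

/-- Tests whether a candidate set lies in the interval `e`. -/
def metLoop : Program :=
  forLoop .j (reg .k) (assign .m 1 ;; subsetLoop ;; ifThen (reg .m) (assign .s 1))

/-- Searches for a pair whose interval contains no candidate set. -/
def findUnmet : Program :=
  assign .found 0 ;; forLoop .e (reg .num) (ifThen (entry .tm (reg .e))
    (assign .s 0 ;; metLoop ;; ifThen ((reg .s).eq 0) (assign .found (reg .e + 1))))

end RAM

namespace SeparatedInstance

open RAM

variable (I : SeparatedInstance)

/-- The memory holds the data of the instance and the tables. -/
structure Ready (M : Mem) : Prop where
  inst : I.HoldsInstance M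
  dist : I.HoldsDist M
  itv : I.HoldsIntervals M

/-- The arrays that hold the data of the instance and the tables. -/
def readyRegs : List Reg := [.d, .itv, .n, .k, .p, .q, .num, .zf, .zc, .zl, .inf, .w, .tm]

variable {I} {X : ℕ} {M M' : Mem} {J : List Reg} {R : ℕ → Set (Fin I.n)}

lemma Ready.of_agreeOff (h : I.Ready M) (hJ : AgreeOff J M M') (hdis : ∀ r ∈ readyRegs, r ∉ J) :
    I.Ready M' where
  inst := h.inst.of_agreeOff hJ fun r hr => hdis r (by
    simp only [List.mem_cons, List.not_mem_nil, or_false, instanceRegs, readyRegs] at hr ⊢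
    tauto)
  dist := h.dist.of_agreeOff hJ (hdis _ (by simp [readyRegs]))
  itv := h.itv.of_agreeOff hJ (hdis _ (by simp [readyRegs]))

lemma Ready.get_itv (h : I.Ready M) {e : ℕ} (he : e < I.n * I.n) (x : Fin I.n) :
    get M .itv ((e : ℤ) * I.n + (x : ℕ)) = bit (x ∈ I.pairInterval e) := by
  obtain ⟨u, v, rfl⟩ := exists_pairIndex he
  have := h.itv u v x
  rw [ite_eq_bit] at this
  simpa [mem_pairInterval] using this

lemma Enough.fits_bit (hX : I.Enough X) (A : Prop) : Fits X (bit A) :=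
  RAM.fits_bit (by have := hX.size; omega) A

/-- The memory holds the first `k + 1` candidate sets. -/
def HoldsCand (R : ℕ → Set (Fin I.n)) (M : Mem) : Prop := ∀ i < I.k + 1, ∀ x : Fin I.n,
  get M .cand ((i : ℤ) * I.n + (x : ℕ)) = bit (x ∈ R i)

lemma HoldsCand.of_agreeOff (h : HoldsCand R M) (hJ : AgreeOff J M M') (hc : Reg.cand ∉ J) :
    HoldsCand R M' := fun i hi x => (hJ _ hc _).trans (h i hi x)

lemma forall_lt_succ_iff {n j : ℕ} (hj : j < n) {A : Fin n → Prop} :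
    (∀ x : Fin n, (x : ℕ) < j + 1 → A x) ↔ (∀ x : Fin n, (x : ℕ) < j → A x) ∧ A ⟨j, hj⟩ := by
  refine ⟨fun h => ⟨fun x hx => h x (by omega), h _ (by simp)⟩, fun h x hx => ?_⟩
  rcases Nat.lt_succ_iff_lt_or_eq.1 hx with hx | rfl
  · exact h.1 x hx
  · exact h.2

lemma wp_subsetLoop (hX : I.Enough X) (hI : I.Ready M) (hR : HoldsCand R M) {j e : ℕ}
    (hj : j < I.k + 1) (he : e < I.n * I.n) (hjM : get M .j 0 = j) (heM : get M .e 0 = e)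
    (hm : get M .m 0 = 1) :
    wp X subsetLoop M fun M' => get M' .m 0 = bit (R j ⊆ I.pairInterval e) := by
  refine wp_forLoop (J := [.m]) (N := I.n) (by have := hX.sq; omega)
    (fun y M' => get M' .m 0 =
      bit (∀ x : Fin I.n, (x : ℕ) < y → x ∈ R j → x ∈ I.pairInterval e))
    (by simp) (by simp) ?_ ?_ ?_ ?_
  · intro M' h'
    simp [h' .n (by simp), hI.inst.n]
  · simpa using hm
  · intro y hy M' h' hx h1
    have hR' := hR.of_agreeOff h' (by simp)
    have hI' := hI.of_agreeOff h' (by simp [readyRegs])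
    have htest : (entry .cand (reg .j * reg .n + reg .x) *
        (1 - entry .itv (reg .e * reg .n + reg .x))).eval M' =
        bit (⟨y, hy⟩ ∈ R j ∧ ⟨y, hy⟩ ∉ I.pairInterval e) := by
      have e1 := hR' j hj ⟨y, hy⟩
      have e2 := hI'.get_itv he ⟨y, hy⟩
      simp only [eval_mul, eval_sub, eval_one, eval_entry, eval_add, eval_reg, hx, hI'.inst.n,
        h' .j (by simp), h' .e (by simp), hjM, heM, e1, e2, one_sub_bit, bit_mul_bit]
    refine wp_ifThen (fun h => wp_assign fits_zero fun _ => ?_) fun h _ => ?_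
    · rw [htest, ne_eq, bit_eq_zero_iff, not_not] at h
      rw [bit_of_not fun h' => h.2 (h' ⟨y, hy⟩ (by simp) h.1)]
      simp
    · rw [htest, bit_eq_zero_iff, not_and, not_not] at h
      simp only [get_set, reduceCtorEq, false_and, if_false, h1]
      rw [forall_lt_succ_iff hy, and_iff_left h]
  · intro M' _ h1
    rw [h1]
    congr 1
    exact propext ⟨fun h x => h x x.2, fun h x _ => @h x⟩

lemma exists_lt_succ_iff {j : ℕ} {A : ℕ → Prop} :
    (∃ i < j + 1, A i) ↔ (∃ i < j, A i) ∨ A j := by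
  constructor
  · rintro ⟨i, hi, h⟩
    rcases Nat.lt_succ_iff_lt_or_eq.1 hi with hi | rfl
    · exact Or.inl ⟨i, hi, h⟩
    · exact Or.inr h
  · rintro (⟨i, hi, h⟩ | h)
    · exact ⟨i, by omega, h⟩
    · exact ⟨j, by omega, h⟩

lemma wp_metLoop (hX : I.Enough X) (hI : I.Ready M) (hR : HoldsCand R M) {e : ℕ}
    (he : e < I.n * I.n) (heM : get M .e 0 = e) (hs : get M .s 0 = 0) :
    wp X metLoop M fun M' => get M' .s 0 = bit (∃ i < I.k, R i ⊆ I.pairInterval e) := by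
  refine wp_forLoop (J := [.m, .x, .s]) (N := I.k) ?_
    (fun j M' => get M' .s 0 = bit (∃ i < j, R i ⊆ I.pairInterval e))
    (by simp [subsetLoop]) (by simp) ?_ ?_ ?_ ?_
  · have h1 := hX.cand
    have h2 : 0 < I.n := Nat.pos_of_ne_zero fun h => by simp [h] at he
    nlinarith
  · intro M' h'
    simp [h' .k (by simp), hI.inst.k]
  · simpa [bit] using hs
  · intro j hj M' h' hjM h1
    have hA : AgreeOff [.j, .m, .x, .s] M (RAM.set M' .m 0 1) :=
      h'.trans (agreeOff_set (by simp) _ _ _)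
    refine wp_assign_seq (z := 1) (by simp) hX.fits_one ?_
    refine wp_seq (wp_mono (wp_agreeOff (J := [.m, .x]) (by simp [subsetLoop])
      (wp_subsetLoop (R := R) (j := j) (e := e) hX (hI.of_agreeOff hA (by simp [readyRegs]))
        (hR.of_agreeOff hA (by simp)) (by omega) he (by simpa using hjM)
        ((hA .e (by simp) _).trans heM) (by simp))) ?_)
    rintro M₂ ⟨hA₂, h2⟩
    have hs₂ : get M₂ .s 0 = bit (∃ i < j, R i ⊆ I.pairInterval e) := by
      rw [hA₂ .s (by simp), ← h1]
      simp
    refine wp_ifThen (fun h => wp_assign hX.fits_one fun _ => ?_) fun h _ => ?_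
    · rw [eval_reg, h2, ne_eq, bit_eq_zero_iff, not_not] at h
      rw [bit_of ⟨j, by omega, h⟩]
      simp
    · rw [eval_reg, h2, bit_eq_zero_iff] at h
      simp only [get_set, reduceCtorEq, false_and, if_false, hs₂]
      rw [exists_lt_succ_iff, or_iff_left h]
  · intro M' _ h1
    exact h1

/-- Each unmet pair overwrites the register, so the last one survives, shifted by one so that `0`
means none. This is exactly the recursion of `lastIndex`. -/
lemma wp_findUnmet (hX : I.Enough X) (hI : I.Ready M) (hR : HoldsCand R M) :
    wp X findUnmet M fun M' => get M' .found 0 =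
      lastIndex (Unmet I.k I.IsPair I.pairInterval R) (I.n * I.n) := by
  classical
  refine wp_assign_seq (z := 0) (by simp) fits_zero ?_
  refine wp_forLoop (J := [.s, .j, .m, .x, .found]) (N := I.n * I.n) (by have := hX.sq; omega)
    (fun e M' => get M' .found 0 = lastIndex (Unmet I.k I.IsPair I.pairInterval R) e)
    (by simp [metLoop, subsetLoop]) (by simp) ?_ ?_ ?_ ?_
  · intro M' h'
    simp [h' .num (by simp), hI.inst.num]
  · simp [lastIndex]
  · intro e he M' h' heM h1
    replace h' : AgreeOff [.e, .s, .j, .m, .x, .found] M M' :=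
      (agreeOff_set (J := [.e, .s, .j, .m, .x, .found]) (by simp) _ _ _).trans h'
    have hI' := hI.of_agreeOff h' (by simp [readyRegs])
    have hT := hI'.inst.tm e he
    have skip : ∀ {M''}, get M'' .found 0 = get M' .found 0 →
        ¬ Unmet I.k I.IsPair I.pairInterval R e → get (RAM.set M'' .e 0 (e + 1)) .found 0 =
          lastIndex (Unmet I.k I.IsPair I.pairInterval R) (e + 1) := by
      intro M'' hM'' hun
      rw [lastIndex, if_neg hun, ← h1, ← hM'']
      simp
    refine wp_ifThen (fun h => ?_) fun h _ => skip rfl fun hun => ?_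
    · rw [eval_entry, eval_reg, heM, hT, ite_ne_zero_iff] at h
      refine wp_assign_seq (z := 0) (by simp) fits_zero ?_
      have hA : AgreeOff [.s] M' (RAM.set M' .s 0 0) := agreeOff_set (by simp) _ _ _
      refine wp_seq (wp_mono (wp_agreeOff (J := [.j, .m, .x, .s]) (by simp [metLoop, subsetLoop])
        (wp_metLoop (R := R) hX (hI'.of_agreeOff hA (by simp [readyRegs]))
          ((hR.of_agreeOff h' (by simp)).of_agreeOff hA (by simp)) he
          (by simpa using heM) (by simp))) ?_)
      rintro M₂ ⟨hA₂, h2⟩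
      have hf₂ : get M₂ .found 0 = get M' .found 0 := by
        rw [hA₂ .found (by simp)]
        simp
      have he₂ : get M₂ .e 0 = e := by
        rw [hA₂ .e (by simp)]
        simpa using heM
      refine wp_ifThen (fun hc => ?_) fun hc _ => skip hf₂ fun hun => ?_
      · have hun : Unmet I.k I.IsPair I.pairInterval R e := by
          refine ⟨h, fun i hi hsub => ?_⟩
          rw [bit_of ⟨i, hi, hsub⟩] at h2
          simp [h2] at hc
        refine wp_assign ?_ fun _ => ?_
        · have := fits_natCast (X := X) (m := e + 1) (by have := hX.sq; omega)
          simpa [he₂] using this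
        · rw [lastIndex, if_pos hun]
          simp [he₂]
      · rw [bit_of_not] at h2
        · simp [h2] at hc
        · rintro ⟨i, hi, hsub⟩
          exact hun.2 i hi hsub
    · rw [eval_entry, eval_reg, heM, hT, if_pos hun.1] at h
      exact one_ne_zero h
  · intro M' _ h1
    exact h1

end SeparatedInstance

/-! ### One round of the branching -/

namespace RAM

lemma fdiv_natCast_add_one (a b : ℕ) : Int.fdiv (a : ℤ) (b + 1) = (a / (b + 1) : ℕ) := by
  rw [Int.ofNat_fdiv]
  push_cast
  rfl

lemma sub_div_mul_add_one (a b : ℕ) :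
    (a : ℤ) - (a / (b + 1) : ℕ) * (b + 1) = (a % (b + 1) : ℕ) := by
  have := Nat.div_add_mod' a (b + 1)
  have h : ((a / (b + 1) * (b + 1) + a % (b + 1) : ℕ) : ℤ) = a := by rw [this]
  rw [Nat.cast_add, Nat.cast_mul, Nat.cast_add_one] at h
  linarith

/-- Reads the digits of the code that describe a candidate set and two vertices. -/
def decodeDigits : Program :=
  assign .c (reg .code / (reg .k + 1)) ;; assign .i (reg .code - reg .c * (reg .k + 1)) ;;
  assign .s (reg .c / (reg .p + 1)) ;; assign .a (reg .c - reg .s * (reg .p + 1)) ;;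
  assign .code (reg .s / (reg .p + 1)) ;; assign .b (reg .s - reg .code * (reg .p + 1))

/-- Replaces the vertices of the pair by the guessed vertices of `Z`. -/
def decodeVertices : Program :=
  assign .e (reg .found - 1) ;; assign .u (reg .e / reg .n) ;;
  assign .v (reg .e - reg .u * reg .n) ;;
  ifThen ((reg .a).lt (reg .zc)) (assign .u (entry .zl (reg .a))) ;;
  ifThen ((reg .b).lt (reg .zc)) (assign .v (entry .zl (reg .b))) ;;
  assign .c (reg .n + 1)

/-- Whether `x` is in the component of the vertex in the register `r`. -/
def nearTest (r : Reg) : Term :=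
  (0 : Term).lt (entry .zf (reg r) + (distEntry .c r .x).lt (reg .inf))

/-- Whether `x` is in the guessed atom. -/
def atomTest : Term :=
  entry .itv ((reg .u * reg .n + reg .v) * reg .n + reg .x) * (nearTest .u * nearTest .v)

/-- Intersects the candidate set `i` with the guessed atom. -/
def restrictLoop : Program :=
  forLoop .x (reg .n)
    (put .cand (reg .i * reg .n + reg .x) (entry .cand (reg .i * reg .n + reg .x) * atomTest) ;;
      ifThen (entry .cand (reg .i * reg .n + reg .x))
        (assign .s 1 ;;
          ifThen ((entry .itv (reg .e * reg .n + reg .x)).eq 0) (assign .alive 0)))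

/-- One round of the branching. -/
def branchRound : Program :=
  findUnmet ;; ifThen (reg .found) (decodeDigits ;; decodeVertices ;; assign .s 0 ;;
    restrictLoop ;; ifThen ((reg .s).eq 0) (assign .alive 0))

end RAM

namespace SeparatedInstance

open RAM

variable {I : SeparatedInstance} {X : ℕ} {M M' : Mem} {J : List Reg} {R : ℕ → Set (Fin I.n)}

lemma wp_decodeDigits {c : ℕ} (hI : I.Ready M) (hcX : c ≤ X) (hc : get M .code 0 = c) :
    wp X decodeDigits M fun M' => get M' .i 0 = (c % (I.k + 1) : ℕ) ∧
      get M' .a 0 = (c / (I.k + 1) % (I.p + 1) : ℕ) ∧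
      get M' .b 0 = (c / (I.k + 1) / (I.p + 1) % (I.p + 1) : ℕ) ∧
      get M' .code 0 = (c / (I.k + 1) / (I.p + 1) / (I.p + 1) : ℕ) := by
  have h1 := Nat.div_le_self c (I.k + 1)
  have h2 := Nat.div_le_self (c / (I.k + 1)) (I.p + 1)
  have h3 := Nat.div_le_self (c / (I.k + 1) / (I.p + 1)) (I.p + 1)
  have h4 := Nat.mod_le c (I.k + 1)
  have h5 := Nat.mod_le (c / (I.k + 1)) (I.p + 1)
  have h6 := Nat.mod_le (c / (I.k + 1) / (I.p + 1)) (I.p + 1)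
  have hk := hI.inst.k
  have hp := hI.inst.p
  refine wp_assign_seq (z := (c / (I.k + 1) : ℕ)) ?_ (fits_natCast (by omega)) ?_
  · simp only [eval_div, eval_add, eval_one, eval_reg, hk, hc, fdiv_natCast_add_one]
  refine wp_assign_seq (z := (c % (I.k + 1) : ℕ)) ?_ (fits_natCast (by omega)) ?_
  · simp only [eval_sub, eval_mul, eval_add, eval_one, eval_reg, get_set, reduceCtorEq, false_and,
      if_false, and_self, if_true, hk, hc, sub_div_mul_add_one]
  refine wp_assign_seq (z := (c / (I.k + 1) / (I.p + 1) : ℕ)) ?_ (fits_natCast (by omega)) ?_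
  · simp only [eval_div, eval_add, eval_one, eval_reg, get_set, reduceCtorEq, false_and,
      if_false, and_self, if_true, hp, fdiv_natCast_add_one]
  refine wp_assign_seq (z := (c / (I.k + 1) % (I.p + 1) : ℕ)) ?_ (fits_natCast (by omega)) ?_
  · simp only [eval_sub, eval_mul, eval_add, eval_one, eval_reg, get_set, reduceCtorEq, false_and,
      if_false, and_self, if_true, hp, sub_div_mul_add_one]
  refine wp_assign_seq (z := (c / (I.k + 1) / (I.p + 1) / (I.p + 1) : ℕ)) ?_
    (fits_natCast (by omega)) ?_
  · simp only [eval_div, eval_add, eval_one, eval_reg, get_set, reduceCtorEq, false_and,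
      if_false, and_self, if_true, hp, fdiv_natCast_add_one]
  have hb : (reg .s - reg .code * (reg .p + 1) : Term).eval (RAM.set (RAM.set (RAM.set (RAM.set
      (RAM.set M .c 0 (c / (I.k + 1) : ℕ)) .i 0 (c % (I.k + 1) : ℕ)) .s 0
      (c / (I.k + 1) / (I.p + 1) : ℕ)) .a 0 (c / (I.k + 1) % (I.p + 1) : ℕ)) .code 0
      (c / (I.k + 1) / (I.p + 1) / (I.p + 1) : ℕ)) =
      (c / (I.k + 1) / (I.p + 1) % (I.p + 1) : ℕ) := by
    simp only [eval_sub, eval_mul, eval_add, eval_one, eval_reg, get_set, reduceCtorEq, false_and,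
      if_false, and_self, if_true, hp, sub_div_mul_add_one]
  refine wp_assign ?_ ?_
  · rw [hb]
    exact fits_natCast (by omega)
  · rw [hb]
    simp only [get_set, reduceCtorEq, false_and, if_false, and_self, if_true]

/-- Leaving the register unchanged when the index is past the end of the list realises the default
value in `guess`. -/
lemma wp_guessVertex (hX : I.Enough X) (hI : I.Ready M) {r₁ r₂ : Reg} {d : ℕ} {u : Fin I.n}
    (hd : get M r₁ 0 = d) (hu : get M r₂ 0 = (u : ℕ)) :
    wp X (ifThen ((reg r₁).lt (reg .zc)) (assign r₂ (entry .zl (reg r₁)))) M fun M' =>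
      get M' r₂ 0 = (I.guess d u : ℕ) := by
  have htest : ((reg r₁).lt (reg .zc)).eval M ≠ 0 ↔ d < I.separatorList.length := by
    rw [eval_lt, ite_ne_zero_iff, eval_reg, eval_reg, hd, hI.inst.zc, Nat.cast_lt]
  refine wp_ifThen (fun h => ?_) fun h => ?_
  · rw [htest] at h
    have h1 := hI.inst.zl d h
    have h2 : I.guess d u = I.separatorList[d] := List.getD_eq_getElem _ _ h
    refine wp_assign ?_ ?_
    · rw [eval_entry, eval_reg, hd, h1]
      exact fits_natCast (by have := hX.sq; have := (I.separatorList[d]).2; omega)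
    · rw [eval_entry, eval_reg, hd, h1, h2]
      simp
  · have h1 : ¬ d < I.separatorList.length := by rwa [← htest, not_not]
    rw [hu, guess, List.getD_eq_default _ _ (by omega)]

lemma wp_decodeVertices (hX : I.Enough X) (hI : I.Ready M) {d₁ d₂ : ℕ} {u v : Fin I.n}
    (hf : get M .found 0 = (pairIndex u v + 1 : ℕ)) (ha : get M .a 0 = d₁)
    (hb : get M .b 0 = d₂) :
    wp X decodeVertices M fun M' => get M' .e 0 = pairIndex u v ∧
      get M' .u 0 = (I.guess d₁ u : ℕ) ∧ get M' .v 0 = (I.guess d₂ v : ℕ) ∧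
      get M' .c 0 = (I.n + 1 : ℕ) := by
  set s := pairIndex u v with hs
  have f3 : Int.fdiv (s : ℤ) I.n = (u : ℕ) := fdiv_mul_add v.2
  have f4 : (s : ℤ) - (u : ℕ) * I.n = (v : ℕ) := mul_add_sub_mul _ _ _
  have hn' := hX.sq
  have hs' := pairIndex_lt u v
  have hu := u.2
  have hv := v.2
  refine wp_assign_seq (z := s) (by simp [hf]) (fits_natCast (by omega)) ?_
  refine wp_assign_seq (z := (u : ℕ)) (by simp [hI.inst.n, f3]) (fits_natCast (by omega)) ?_
  refine wp_assign_seq (z := (v : ℕ)) (by simp [hI.inst.n, f4]) (fits_natCast (by omega)) ?_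
  set M₁ := RAM.set (RAM.set (RAM.set M .e 0 s) .u 0 (u : ℕ)) .v 0 (v : ℕ) with hM₁
  have hA₁ : AgreeOff [.e, .u, .v] M M₁ :=
    ((agreeOff_set (by simp) _ _ _).trans (agreeOff_set (by simp) _ _ _)).trans
      (agreeOff_set (by simp) _ _ _)
  have hI₁ := hI.of_agreeOff hA₁ (by simp [readyRegs])
  have ha₁ : get M₁ .a 0 = d₁ := (hA₁ .a (by simp) _).trans ha
  have hb₁ : get M₁ .b 0 = d₂ := (hA₁ .b (by simp) _).trans hb
  have he₁ : get M₁ .e 0 = s := by simp [hM₁]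
  have hu₁ : get M₁ .u 0 = (u : ℕ) := by simp [hM₁]
  have hv₁ : get M₁ .v 0 = (v : ℕ) := by simp [hM₁]
  clear_value M₁
  refine wp_seq (wp_mono (wp_agreeOff (J := [.u]) (by simp) (wp_guessVertex hX hI₁ ha₁ hu₁)) ?_)
  rintro M₂ ⟨hA₂, hu₂⟩
  have hI₂ := hI₁.of_agreeOff hA₂ (by simp [readyRegs])
  refine wp_seq (wp_mono (wp_agreeOff (J := [.v]) (by simp) (wp_guessVertex hX hI₂
    ((hA₂ .b (by simp) _).trans hb₁) ((hA₂ .v (by simp) _).trans hv₁))) ?_)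
  rintro M₃ ⟨hA₃, hv₃⟩
  have hI₃ := hI₂.of_agreeOff hA₃ (by simp [readyRegs])
  have hn : (reg .n + 1 : Term).eval M₃ = (I.n + 1 : ℕ) := by simp [hI₃.inst.n]
  refine wp_assign ?_ ?_
  · rw [hn]
    exact fits_natCast (by omega)
  · rw [hn]
    refine ⟨?_, ?_, ?_, by simp⟩
    · rw [get_set, if_neg (by simp), hA₃ .e (by simp), hA₂ .e (by simp), he₁]
    · rw [get_set, if_neg (by simp), hA₃ .u (by simp), hu₂]
    · rw [get_set, if_neg (by simp), hv₃]

/-- With `n + 1` in the register `c`, the test reads the table of `G - Z`, where an entry below the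
cut-off means being connected. A sum of two truth values is positive when one of them holds. -/
lemma eval_nearTest (hI : I.Ready M) {r : Reg} {a x : Fin I.n} (hc : get M .c 0 = (I.n + 1 : ℕ))
    (ha : get M r 0 = (a : ℕ)) (hx : get M .x 0 = (x : ℕ)) :
    (nearTest r).eval M = bit (InOrConnected I.G I.Z a x) := by
  classical
  have hD := hI.dist (I.n + 1) (by omega) a x
  rw [distGraph_succ] at hD
  rw [inOrConnected_iff I.noNegativeCycle I.pathBound hD, nearTest, eval_lt, eval_add, eval_lt,
    eval_distEntry hc ha hx hI.inst.n, eval_entry, eval_reg, eval_reg, ha, hI.inst.zf, eval_zero,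
    hI.inst.inf, ite_eq_bit, ite_eq_bit, ite_eq_bit, bit_add_pos_iff]

lemma eval_atomTest (hI : I.Ready M) {d₁ d₂ : ℕ} {u v x : Fin I.n}
    (hc : get M .c 0 = (I.n + 1 : ℕ)) (hu : get M .u 0 = (I.guess d₁ u : ℕ))
    (hv : get M .v 0 = (I.guess d₂ v : ℕ)) (hx : get M .x 0 = (x : ℕ)) :
    atomTest.eval M = bit (x ∈ I.atom (pairIndex u v) d₁ d₂) := by
  have h := hI.get_itv (pairIndex_lt (I.guess d₁ u) (I.guess d₂ v)) x
  rw [mem_pairInterval] at h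
  simp only [pairIndex, Nat.cast_add, Nat.cast_mul] at h
  rw [mem_atom, localInterval, atomTest, eval_mul, eval_mul, eval_nearTest hI hc hu hx,
    eval_nearTest hI hc hv hx, eval_entry, eval_add, eval_mul, eval_add, eval_mul, eval_reg,
    eval_reg, eval_reg, eval_reg, hu, hv, hx, hI.inst.n, h, bit_mul_bit, bit_mul_bit]
  rfl

lemma HoldsCand.put {R' : ℕ → Set (Fin I.n)} (h : HoldsCand R M) {i : ℕ} {y : Fin I.n} {A : Prop}
    (h₁ : ∀ j x, ¬ (j = i ∧ x = y) → (x ∈ R' j ↔ x ∈ R j)) (h₂ : y ∈ R' i ↔ A) :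
    HoldsCand R' (RAM.set M .cand ((i : ℤ) * I.n + (y : ℕ)) (bit A)) := by
  intro j hj x
  by_cases hjx : j = i ∧ x = y
  · obtain ⟨rfl, rfl⟩ := hjx
    simp [h₂]
  · rw [get_set, if_neg, h j hj x, h₁ j x hjx]
    rintro ⟨-, h'⟩
    obtain ⟨h3, h4⟩ := eq_of_mul_add_eq (n := I.n) x.2 y.2 (by exact_mod_cast h')
    exact hjx ⟨h3, Fin.ext h4⟩

/-- The set is intersected in place, so the invariant describes a mixture: vertices below `y` are
already filtered by the atom, the others not yet. Along the way `s` records whether a vertex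
survives and `alive` whether all survivors lie in the interval. -/
lemma wp_restrictLoop (hX : I.Enough X) (hI : I.Ready M) (hR : HoldsCand R M) {i d₁ d₂ : ℕ}
    {u v : Fin I.n} {al : Prop} (hi : i < I.k + 1) (hiM : get M .i 0 = i)
    (heM : get M .e 0 = pairIndex u v) (hu : get M .u 0 = (I.guess d₁ u : ℕ))
    (hv : get M .v 0 = (I.guess d₂ v : ℕ)) (hc : get M .c 0 = (I.n + 1 : ℕ))
    (hs : get M .s 0 = 0) (hal : get M .alive 0 = bit al) :
    wp X restrictLoop M fun M' =>
      HoldsCand (Function.update R i (R i ∩ I.atom (pairIndex u v) d₁ d₂)) M' ∧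
      get M' .s 0 = bit (R i ∩ I.atom (pairIndex u v) d₁ d₂).Nonempty ∧
      get M' .alive 0 =
        bit (al ∧ R i ∩ I.atom (pairIndex u v) d₁ d₂ ⊆ I.pairInterval (pairIndex u v)) := by
  set B := I.atom (pairIndex u v) d₁ d₂ with hB
  set E := I.pairInterval (pairIndex u v) with hE
  refine wp_forLoop (J := [.cand, .s, .alive]) (N := I.n) (by have := hX.sq; omega)
    (fun y M' =>
      HoldsCand (Function.update R i {x | x ∈ R i ∧ ((x : ℕ) < y → x ∈ B)}) M' ∧
      get M' .s 0 = bit (¬ ∀ x : Fin I.n, (x : ℕ) < y → x ∉ R i ∩ B) ∧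
      get M' .alive 0 = bit (al ∧ ∀ x : Fin I.n, (x : ℕ) < y → x ∈ R i ∩ B → x ∈ E))
    (by simp) (by simp) ?_ ?_ ?_ ?_
  · intro M' h'
    simp [h' .n (by simp), hI.inst.n]
  · refine ⟨?_, ?_, ?_⟩
    · have : Function.update R i {x | x ∈ R i ∧ ((x : ℕ) < 0 → x ∈ B)} = R := by
        simp
      rw [this]
      exact hR.of_agreeOff (agreeOff_set (J := [.x]) (by simp) _ _ _) (by simp)
    · simpa [bit] using hs
    · simpa using hal
  · rintro y hy M₁ h' hx ⟨h1, h2, h3⟩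
    have hI₁ := hI.of_agreeOff h' (by simp [readyRegs])
    have hi₁ := (h' .i (by simp) _).trans hiM
    have he₁ := (h' .e (by simp) _).trans heM
    have hu₁ := (h' .u (by simp) _).trans hu
    have hv₁ := (h' .v (by simp) _).trans hv
    have hc₁ := (h' .c (by simp) _).trans hc
    have hval : (entry .cand (reg .i * reg .n + reg .x) * atomTest).eval M₁ =
        bit (⟨y, hy⟩ ∈ R i ∩ B) := by
      have e1 := h1 i hi ⟨y, hy⟩
      rw [eval_mul, eval_atomTest (x := ⟨y, hy⟩) hI₁ hc₁ hu₁ hv₁ hx, eval_entry, eval_add,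
        eval_mul, eval_reg, eval_reg, eval_reg, hi₁, hI₁.inst.n, hx, e1, bit_mul_bit]
      simp [hB]
    have haddr : (reg .i * reg .n + reg .x : Term).eval M₁ = (i : ℤ) * I.n + y := by
      simp [hi₁, hI₁.inst.n, hx]
    refine wp_seq (wp_put (hval ▸ hX.fits_bit _) ?_)
    rw [hval, haddr]
    set M₂ := RAM.set M₁ .cand ((i : ℤ) * I.n + y) (bit (⟨y, hy⟩ ∈ R i ∩ B)) with hM₂
    have hA₂ : AgreeOff [.cand] M₁ M₂ := agreeOff_set (by simp) _ _ _
    have hR₂ : HoldsCand (Function.update R i {x | x ∈ R i ∧ ((x : ℕ) < y + 1 → x ∈ B)}) M₂ := by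
      refine h1.put (y := ⟨y, hy⟩) (fun j x hjx => ?_) ?_
      · by_cases hji : j = i
        · subst hji
          have hxy : (x : ℕ) ≠ y := fun h => hjx ⟨rfl, Fin.ext h⟩
          have : (x : ℕ) ≤ y ↔ (x : ℕ) < y := by omega
          simp [this]
        · simp [Function.update_of_ne hji]
      · simp
    have hcand : (entry .cand (reg .i * reg .n + reg .x)).eval M₂ =
        bit (⟨y, hy⟩ ∈ R i ∩ B) := by
      have e1 : (reg .i * reg .n + reg .x : Term).eval M₂ = (i : ℤ) * I.n + y := by
        simp [hA₂ _ _, hi₁, hI₁.inst.n, hx]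
      rw [eval_entry, e1]
      simp [hM₂]
    have hitv : (entry .itv (reg .e * reg .n + reg .x)).eval M₂ = bit (⟨y, hy⟩ ∈ E) := by
      have e1 : (reg .e * reg .n + reg .x : Term).eval M₂ = (pairIndex u v : ℤ) * I.n + y := by
        simp [hA₂ _ _, he₁, hI₁.inst.n, hx]
      rw [eval_entry, e1, hA₂ .itv (by simp)]
      exact hI₁.get_itv (pairIndex_lt u v) ⟨y, hy⟩
    have hs₂ := (hA₂ .s (by simp) 0).trans h2
    have hal₂ := (hA₂ .alive (by simp) 0).trans h3
    clear_value M₂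
    simp only [forall_lt_succ_iff hy]
    refine wp_ifThen (fun h => ?_) fun h _ => ?_
    · rw [hcand, ne_eq, bit_eq_zero_iff, not_not] at h
      have hR₃ := hR₂.of_agreeOff (agreeOff_set (J := [.s]) (r := .s) (by simp) M₂ 0 1) (by simp)
      refine wp_assign_seq (z := 1) (by simp) hX.fits_one (wp_ifThen (fun h4 => ?_) fun h4 _ => ?_)
      · have h5 : (⟨y, hy⟩ : Fin I.n) ∉ E := by
          rw [eval_eq, ite_ne_zero_iff, eval_zero] at h4
          rw [← bit_eq_zero_iff, ← hitv]
          simpa using h4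
        refine wp_assign fits_zero fun _ => ⟨?_, ?_, ?_⟩
        · exact (hR₃.of_agreeOff (agreeOff_set (J := [.alive]) (by simp) _ _ _)
            (by simp)).of_agreeOff (agreeOff_set (J := [.x]) (by simp) _ _ _) (by simp)
        · rw [bit_of fun h6 => h6.2 h]
          simp
        · rw [bit_of_not fun h6 => h5 (h6.2.2 h)]
          simp
      · have h5 : (⟨y, hy⟩ : Fin I.n) ∈ E := by
          by_contra h5
          rw [← bit_eq_zero_iff, ← hitv] at h5
          refine (ite_ne_zero_iff _).2 ?_ h4
          simpa using h5
        refine ⟨hR₃.of_agreeOff (agreeOff_set (J := [.x]) (by simp) _ _ _) (by simp), ?_, ?_⟩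
        · rw [bit_of fun h6 => h6.2 h]
          simp
        · simp only [get_set, reduceCtorEq, false_and, if_false, hal₂]
          congr 2
          exact propext (by simp [h5])
    · rw [hcand, bit_eq_zero_iff] at h
      refine ⟨hR₂.of_agreeOff (agreeOff_set (J := [.x]) (by simp) _ _ _) (by simp), ?_, ?_⟩
      · simp only [get_set, reduceCtorEq, false_and, if_false, hs₂]
        rw [and_iff_left h]
      · simp only [get_set, reduceCtorEq, false_and, if_false, hal₂]
        congr 2
        exact propext (iff_self_and.2 fun _ h' => absurd h' h)
  · rintro M' - ⟨h1, h2, h3⟩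
    refine ⟨?_, ?_, ?_⟩
    · convert h1 using 3
      ext x
      simp
    · rw [h2]
      congr 1
      refine propext ?_
      simp [Set.Nonempty]
    · rw [h3]
      congr 2
      exact propext ⟨fun h x => h x x.2, fun h x _ => @h x⟩

end SeparatedInstance

/-! ### Trying all guesses -/

namespace RAM

/-- Starts the branching. -/
def startBranching : Program :=
  assign .code (reg .t) ;; assign .alive 1 ;;
    forLoop .i ((reg .k + 1) * reg .n) (put .cand (reg .i) 1)

/-- Tries one guess. -/
def tryGuess : Program :=
  startBranching ;; forLoop .round (reg .len) branchRound ;; findUnmet ;;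
    ifThen (reg .alive * (reg .found).eq 0) (assign .ans 1)

/-- Computes the number of rounds and the number of guesses. -/
def countGuesses : Program :=
  assign .len (reg .k * ((reg .p + reg .q) * (reg .p + reg .q)) + 1) ;;
    assign .base ((reg .k + 1) * (reg .p + 1) * (reg .p + 1)) ;; assign .total 1 ;;
    forLoop .i (reg .len) (assign .total (reg .total * reg .base))

/-- Tries all guesses. -/
def tryGuesses : Program :=
  countGuesses ;; assign .ans 0 ;; forLoop .t (reg .total) tryGuess

end RAM

namespace SeparatedInstance

open RAM

variable {I : SeparatedInstance} {X : ℕ} {M M' : Mem} {J : List Reg}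

/-- The memory holds the state of the branching. -/
structure HoldsState (σ : BranchState (Fin I.n)) (M : Mem) : Prop where
  cand : HoldsCand σ.cand M
  alive : get M .alive 0 = bit σ.alive
  code : get M .code 0 = σ.code

lemma HoldsState.of_agreeOff {σ : BranchState (Fin I.n)} (h : HoldsState σ M)
    (hJ : AgreeOff J M M') (hdis : ∀ r ∈ [Reg.cand, .alive, .code], r ∉ J) : HoldsState σ M' where
  cand := h.cand.of_agreeOff hJ (hdis _ (by simp))
  alive := (hJ _ (hdis _ (by simp)) _).trans h.alive
  code := (hJ _ (hdis _ (by simp)) _).trans h.code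

variable (I)

/-- One round of the branching for the constraints of the instance. -/
noncomputable def nextState : BranchState (Fin I.n) → BranchState (Fin I.n) :=
  branchStep I.k (I.p + 1) (I.n * I.n) I.IsPair I.pairInterval I.atom

variable {I}

/-- The code only shrinks, so the bound `X` on the initial code remains valid in all rounds. -/
lemma code_nextState_le (σ : BranchState (Fin I.n)) : (I.nextState σ).code ≤ σ.code := by
  unfold nextState branchStep
  split
  · exact le_rfl
  · exact (Nat.div_le_self _ _).trans ((Nat.div_le_self _ _).trans (Nat.div_le_self _ _))

lemma wp_branchRound (hX : I.Enough X) (hI : I.Ready M) {σ : BranchState (Fin I.n)}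
    (hσ : HoldsState σ M) (hcode : σ.code ≤ X) :
    wp X branchRound M (HoldsState (I.nextState σ)) := by
  refine wp_seq (wp_mono (wp_agreeOff (J := [.found, .e, .s, .j, .m, .x])
    (by simp [findUnmet, metLoop, subsetLoop]) (wp_findUnmet hX hI hσ.cand)) ?_)
  rintro M₁ ⟨hA₁, hf⟩
  have hI₁ := hI.of_agreeOff hA₁ (by simp [readyRegs])
  have hσ₁ := hσ.of_agreeOff hA₁ (by simp)
  cases hlast : lastIndex (Unmet I.k I.IsPair I.pairInterval σ.cand) (I.n * I.n) with
  | zero =>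
    have hnext : I.nextState σ = σ := by
      unfold nextState branchStep
      simp [hlast]
    rw [hlast] at hf
    exact wp_ifThen (fun h => absurd (by simpa using hf) h) fun _ => by
      rw [hnext]
      exact hσ₁
  | succ e =>
    rw [hlast] at hf
    obtain ⟨he, -, -⟩ := lastIndex_eq_succ hlast
    obtain ⟨u, v, rfl⟩ := exists_pairIndex he
    set i := σ.code % (I.k + 1) with hi
    set c := σ.code / (I.k + 1) with hc
    set A := σ.cand i ∩ I.atom (pairIndex u v) (c % (I.p + 1)) (c / (I.p + 1) % (I.p + 1)) with hA
    have hnext : I.nextState σ = ⟨Function.update σ.cand i A,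
        σ.alive ∧ A.Nonempty ∧ A ⊆ I.pairInterval (pairIndex u v),
        c / (I.p + 1) / (I.p + 1)⟩ := by
      unfold nextState branchStep
      simp [hlast, hi, hc, hA]
    rw [hnext]
    refine wp_ifThen (fun _ => ?_) fun h => absurd h (by
      rw [eval_reg, hf]
      exact Nat.cast_ne_zero.2 (Nat.succ_ne_zero _))
    refine wp_seq (wp_mono (wp_agreeOff (J := [.c, .i, .s, .a, .code, .b])
      (by simp [decodeDigits]) (wp_decodeDigits hI₁ hcode hσ₁.code)) ?_)
    rintro M₂ ⟨hA₂, hi₂, ha₂, hb₂, hc₂⟩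
    have hI₂ := hI₁.of_agreeOff hA₂ (by simp [readyRegs])
    refine wp_seq (wp_mono (wp_agreeOff (J := [.e, .u, .v, .c]) (by simp [decodeVertices])
      (wp_decodeVertices hX hI₂ (u := u) (v := v) ((hA₂ .found (by simp) _).trans hf) ha₂ hb₂)) ?_)
    rintro M₃ ⟨hA₃, he₃, hu₃, hv₃, hc₃⟩
    have hI₃ := hI₂.of_agreeOff hA₃ (by simp [readyRegs])
    have hi₃ := (hA₃ .i (by simp) 0).trans hi₂
    have hcode₃ := (hA₃ .code (by simp) 0).trans hc₂
    have hcand₃ := (hσ₁.cand.of_agreeOff hA₂ (by simp)).of_agreeOff hA₃ (by simp)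
    have halive₃ := ((hA₃ .alive (by simp) 0).trans (hA₂ .alive (by simp) 0)).trans hσ₁.alive
    have hA₄ : AgreeOff [.s] M₃ (RAM.set M₃ .s 0 0) := agreeOff_set (by simp) _ _ _
    refine wp_assign_seq (z := 0) (by simp) fits_zero ?_
    refine wp_seq (wp_mono (wp_agreeOff (J := [.x, .cand, .s, .alive]) (by simp [restrictLoop])
      (wp_restrictLoop hX (hI₃.of_agreeOff hA₄ (by simp [readyRegs]))
        (hcand₃.of_agreeOff hA₄ (by simp)) (i := i) (Nat.mod_lt _ (Nat.succ_pos _))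
        ((hA₄ .i (by simp) _).trans hi₃) ((hA₄ .e (by simp) _).trans he₃)
        ((hA₄ .u (by simp) _).trans hu₃) ((hA₄ .v (by simp) _).trans hv₃)
        ((hA₄ .c (by simp) _).trans hc₃) (by simp) ((hA₄ .alive (by simp) _).trans halive₃))) ?_)
    rintro M₅ ⟨hA₅, h1, h2, h3⟩
    have hcode₅ := ((hA₅ .code (by simp) 0).trans (hA₄ .code (by simp) 0)).trans hcode₃
    rw [← hA] at h1 h2 h3
    refine wp_ifThen (fun h => wp_assign fits_zero ?_) fun h => ?_
    · have hne : ¬ A.Nonempty := by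
        rw [eval_eq, ite_ne_zero_iff, eval_reg, h2, eval_zero] at h
        simpa using h
      have hA₆ : AgreeOff [.alive] M₅ (RAM.set M₅ .alive 0 0) := agreeOff_set (by simp) _ _ _
      exact ⟨h1.of_agreeOff hA₆ (by simp), by simp [hne],
        (hA₆ .code (by simp) _).trans hcode₅⟩
    · have hne : A.Nonempty := by
        by_contra hne
        rw [bit_of_not hne] at h2
        simp [h2] at h
      exact ⟨h1, by simp [h3, hne], hcode₅⟩

/-- All `k + 1` candidate sets are refilled, because the previous guess has left its own sets in
memory. -/
lemma wp_startBranching (hX : I.Enough X) (hI : I.Ready M) {g : ℕ} (hg : g ≤ X)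
    (ht : get M .t 0 = g) : wp X startBranching M (HoldsState (I := I) (branchInit g)) := by
  refine wp_assign_seq (z := g) (by simpa using ht) (fits_natCast hg) ?_
  refine wp_assign_seq (z := 1) (by simp) hX.fits_one ?_
  refine wp_forLoop (J := [.cand]) (N := (I.k + 1) * I.n) hX.cand
    (fun j M' => ∀ i < j, get M' .cand i = 1) (by simp) (by simp) ?_ ?_ ?_ ?_
  · intro M' h'
    simp [h' .n (by simp), h' .k (by simp), hI.inst.n, hI.inst.k]
  · simp
  · intro j hj M' h' hi h1
    refine wp_put hX.fits_one fun _ i hij => ?_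
    by_cases h : i = j
    · subst h
      simp [hi]
    · simpa [h, hi] using h1 i (by omega)
  · intro M' h' h1
    refine ⟨fun i hi x => ?_, ?_, ?_⟩
    · have h2 : (i + 1) * I.n ≤ (I.k + 1) * I.n := Nat.mul_le_mul_right _ hi
      have := x.2
      rw [add_mul] at h2
      have h3 := h1 (i * I.n + x) (by omega)
      simpa [branchInit] using h3
    · rw [h' .alive (by simp)]
      simp [branchInit]
    · rw [h' .code (by simp)]
      simp [branchInit]

lemma code_iterate_nextState_le (σ : BranchState (Fin I.n)) (r : ℕ) :
    (I.nextState^[r] σ).code ≤ σ.code := by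
  induction r with
  | zero => exact le_rfl
  | succ r ih =>
    rw [Function.iterate_succ_apply']
    exact (code_nextState_le _).trans ih

lemma wp_tryGuess (hX : I.Enough X) (hI : I.Ready M) (hlen : get M .len 0 = I.rounds) {g : ℕ}
    (hg : g ≤ X) (ht : get M .t 0 = g) {A : Prop} (hans : get M .ans 0 = bit A) :
    wp X tryGuess M fun M' => get M' .ans 0 = bit (A ∨ I.GoodGuess g) := by
  refine wp_seq (wp_mono (wp_agreeOff (J := [.code, .alive, .i, .cand]) (by simp [startBranching])
    (wp_startBranching hX hI hg ht)) ?_)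
  rintro M₁ ⟨hA₁, hσ₁⟩
  have hI₁ := hI.of_agreeOff hA₁ (by simp [readyRegs])
  refine wp_seq (wp_mono (wp_agreeOff (J := [.round, .found, .e, .s, .j, .m, .x, .c, .i, .a, .code,
    .b, .u, .v, .cand, .alive]) (by simp [branchRound, findUnmet, metLoop, subsetLoop,
      decodeDigits, decodeVertices, restrictLoop])
    (wp_forLoop (Q := HoldsState (I.nextState^[I.rounds] (branchInit g)))
      (J := [.found, .e, .s, .j, .m, .x, .c, .i, .a, .code, .b, .u, .v, .cand, .alive])
      (N := I.rounds) hX.rounds (fun j M' => HoldsState (I.nextState^[j] (branchInit g)) M')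
      (by simp [branchRound, findUnmet, metLoop, subsetLoop, decodeDigits, decodeVertices,
        restrictLoop]) (by simp) ?_ ?_ ?_ ?_)) ?_)
  · intro M' h'
    rw [eval_reg, h' .len (by simp), hA₁ .len (by simp), hlen]
  · exact hσ₁.of_agreeOff (agreeOff_set (J := [.round]) (by simp) _ _ _) (by simp)
  · intro j hj M' h' _ hσ
    refine wp_mono (wp_branchRound hX (hI₁.of_agreeOff h' (by simp [readyRegs])) hσ
      ((code_iterate_nextState_le _ _).trans hg)) fun M'' h'' _ => ?_
    rw [Function.iterate_succ_apply']
    exact h''.of_agreeOff (agreeOff_set (J := [.round]) (by simp) _ _ _) (by simp)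
  · intro M' _ hσ
    exact hσ
  rintro M₂ ⟨hA₂, hσ₂⟩
  have hI₂ := hI₁.of_agreeOff hA₂ (by simp [readyRegs])
  have hans₂ := ((hA₂ .ans (by simp) 0).trans (hA₁ .ans (by simp) 0)).trans hans
  refine wp_seq (wp_mono (wp_agreeOff (J := [.found, .e, .s, .j, .m, .x])
    (by simp [findUnmet, metLoop, subsetLoop]) (wp_findUnmet hX hI₂ hσ₂.cand)) ?_)
  rintro M₃ ⟨hA₃, hf⟩
  have hal₃ := (hA₃ .alive (by simp) 0).trans hσ₂.alive
  have hans₃ := (hA₃ .ans (by simp) 0).trans hans₂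
  have htest : (reg .alive * (reg .found).eq 0).eval M₃ = bit (I.GoodGuess g) := by
    rw [eval_mul, eval_eq, eval_reg, eval_reg, hal₃, hf, ite_eq_bit, bit_mul_bit, eval_zero,
      Nat.cast_eq_zero]
    rfl
  refine wp_ifThen (fun h => wp_assign hX.fits_one ?_) fun h => ?_
  · rw [htest, ne_eq, bit_eq_zero_iff, not_not] at h
    rw [bit_of (Or.inr h)]
    simp
  · rw [htest, bit_eq_zero_iff] at h
    rw [hans₃, or_iff_left h]

lemma wp_countGuesses (hX : I.Enough X) (hI : I.Ready M) :
    wp X countGuesses M fun M' => get M' .len 0 = I.rounds ∧ get M' .total 0 = I.guesses := by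
  set base := (I.k + 1) * (I.p + 1) * (I.p + 1) with hbase
  -- All intermediate powers fit since the final one is the number of guesses, which `X` bounds.
  have hpow : ∀ j ≤ I.rounds, base ^ j ≤ X := fun j hj =>
    (Nat.pow_le_pow_right (by positivity) hj).trans hX.guesses
  refine wp_assign_seq (z := I.rounds) ?_ (fits_natCast hX.rounds) ?_
  · simp [rounds, hI.inst.k, hI.inst.p, hI.inst.q]
  refine wp_assign_seq (z := base) ?_ (fits_natCast ?_) ?_
  · simp [hbase, hI.inst.k, hI.inst.p]
  · have := hpow 1 (Nat.succ_pos _)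
    rwa [pow_one] at this
  refine wp_assign_seq (z := 1) (by simp) hX.fits_one ?_
  refine wp_forLoop (J := [.total]) (N := I.rounds) hX.rounds
    (fun j M' => get M' .total 0 = (base ^ j : ℕ)) (by simp) (by simp) ?_ ?_ ?_ ?_
  · intro M' h'
    rw [eval_reg, h' .len (by simp)]
    simp
  · simp
  · intro j hj M' h' _ h1
    have h2 : (reg .total * reg .base : Term).eval M' = (base ^ (j + 1) : ℕ) := by
      rw [eval_mul, eval_reg, eval_reg, h1, h' .base (by simp), pow_succ]
      simp
    refine wp_assign ?_ fun _ => ?_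
    · rw [h2]
      exact fits_natCast (hpow _ hj)
    · rw [h2]
      simp
  · intro M' h' h1
    refine ⟨?_, h1⟩
    rw [h' .len (by simp)]
    simp

lemma wp_tryGuesses (hX : I.Enough X) (hI : I.Ready M) :
    wp X tryGuesses M fun M' => get M' .ans 0 = bit I.IsYes := by
  refine wp_seq (wp_mono (wp_agreeOff (J := [.len, .base, .total, .i]) (by simp [countGuesses])
    (wp_countGuesses hX hI)) ?_)
  rintro M₁ ⟨hA₁, hlen, htotal⟩
  have hI₁ := hI.of_agreeOff hA₁ (by simp [readyRegs])
  have hA₂ : AgreeOff [.ans] M₁ (RAM.set M₁ .ans 0 0) := agreeOff_set (by simp) _ _ _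
  refine wp_assign_seq (z := 0) (by simp) fits_zero ?_
  refine wp_forLoop (J := [.round, .found, .e, .s, .j, .m, .x, .c, .i, .a, .code,
    .b, .u, .v, .cand, .alive, .ans]) (N := I.guesses) hX.guesses
    (fun j M' => get M' .ans 0 = bit (∃ g < j, I.GoodGuess g))
    (by simp [tryGuess, startBranching, branchRound, findUnmet, metLoop, subsetLoop,
      decodeDigits, decodeVertices, restrictLoop]) (by simp) ?_ ?_ ?_ ?_
  · intro M' h'
    rw [eval_reg, h' .total (by simp), hA₂ .total (by simp), htotal]
  · simp
  · intro j hj M' h' ht h1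
    have hA' := (hA₂.mono (by simp)).trans h'
    refine wp_mono (wp_tryGuess hX (hI₁.of_agreeOff hA' (by simp [readyRegs]))
      ((hA' .len (by simp) _).trans hlen) (g := j) (by have := hX.guesses; omega) ht h1)
      fun M'' h'' _ => ?_
    rw [exists_lt_succ_iff, ← h'']
    simp
  · intro M' _ h1
    rw [h1, I.exists_goodGuess_iff]

end SeparatedInstance

/-! ### The complete program -/

namespace RAM

/-- Reads the instance. -/
def readInput : Program :=
  readHeader ;; readScale ;; readInf ;; readWeights ;; readPairs ;; readSeparator

/-- Decides whether the instance is a yes-instance. -/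
def solve : Program :=
  readInput ;; computeDist ;; computeIntervals ;; tryGuesses ;; .store 0 (reg .ans)

end RAM

namespace SeparatedInstance

open RAM

variable {I : SeparatedInstance} {X : ℕ} {M : Mem}

lemma wp_readInput (hX : I.Enough X) (h : I.HoldsInput M) :
    wp X readInput M I.HoldsInstance := by
  refine wp_seq (wp_mono (wp_readHeader hX h) ?_)
  rintro M₁ ⟨h₁, hh₁⟩
  refine wp_seq (wp_mono (wp_agreeOff (J := [.i, .pd]) (by simp [readScale])
    (wp_readScale hX h₁ hh₁)) ?_)
  rintro M₂ ⟨hA₂, h₂, hpd₂⟩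
  have hh₂ := hh₁.of_agreeOff hA₂ (by simp)
  refine wp_seq (wp_mono (wp_agreeOff (J := [.i, .sum, .inf]) (by simp [readInf])
    (wp_readInf hX h₂ hh₂ hpd₂)) ?_)
  rintro M₃ ⟨hA₃, h₃, hinf₃⟩
  have hh₃ := hh₂.of_agreeOff hA₃ (by simp)
  have hpd₃ := (hA₃ .pd (by simp) 0).trans hpd₂
  refine wp_seq (wp_mono (wp_agreeOff (J := [.i, .w]) (by simp [readWeights])
    (wp_readWeights hX h₃ hh₃ hpd₃ hinf₃)) ?_)
  rintro M₄ ⟨hA₄, h₄, hw₄⟩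
  have hh₄ := hh₃.of_agreeOff hA₄ (by simp)
  refine wp_seq (wp_mono (wp_agreeOff (J := [.i, .tm]) (by simp [readPairs])
    (wp_readPairs hX h₄ hh₄)) ?_)
  rintro M₅ ⟨hA₅, h₅, htm₅⟩
  have hh₅ := hh₄.of_agreeOff hA₅ (by simp)
  refine wp_mono (wp_agreeOff (J := [.i, .zf, .zl, .zc]) (by simp [readSeparator])
    (wp_readSeparator hX h₅ hh₅)) ?_
  rintro M₆ ⟨hA₆, hz₆⟩
  refine ⟨hh₅.of_agreeOff hA₆ (by simp), hz₆, ?_, fun u v => ?_, fun i hi => ?_⟩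
  · rw [hA₆ .inf (by simp), hA₅ .inf (by simp), hA₄ .inf (by simp), hinf₃]
  · rw [hA₆ .w (by simp), hA₅ .w (by simp), hw₄ _ (pairIndex_lt u v)]
  · rw [hA₆ .tm (by simp), htm₅ i hi]

lemma wp_solve (hX : I.Enough X) :
    wp X solve (inputMem I.encode) fun M => M 0 = bit I.IsYes := by
  refine wp_seq (wp_mono (wp_readInput hX I.holdsInput_inputMem) fun M₁ hI₁ => ?_)
  refine wp_seq (wp_mono (wp_agreeOff (J := [.i, .s, .e, .t, .b, .a, .c, .u, .d, .round])
    (by simp [computeDist, initDist, relaxDist]) (wp_computeDist hX hI₁)) ?_)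
  rintro M₂ ⟨hA₂, hD₂⟩
  have hI₂ := hI₁.of_agreeOff hA₂ (by simp [instanceRegs])
  refine wp_seq (wp_mono (wp_agreeOff (J := [.i, .s, .x, .u, .v, .m, .c, .itv])
    (by simp [computeIntervals]) (wp_computeIntervals hX hI₂ hD₂)) ?_)
  rintro M₃ ⟨hA₃, hE₃⟩
  have hI₃ := hI₂.of_agreeOff hA₃ (by simp [instanceRegs])
  refine wp_seq (wp_mono (wp_tryGuesses hX ⟨hI₃, hD₂.of_agreeOff hA₃ (by simp), hE₃⟩)
    fun M₄ h₄ => wp_store ?_ ?_)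
  · rw [eval_reg, h₄]
    exact hX.fits_bit _
  · rw [eval_reg, h₄, eval_zero, Function.update_self]

/-- A bound on the number of guesses in terms of the parameter. -/
def guessBound (κ : ℕ) : ℕ := ((κ + 1) * (κ + 1) * (κ + 1)) ^ (κ * (κ * κ) + 1)

lemma primrec_guessBound : Primrec guessBound := by
  have hpow : Primrec₂ ((· ^ ·) : ℕ → ℕ → ℕ) := Primrec₂.unpaired'.1 Nat.Primrec.pow
  have h1 : Primrec fun κ : ℕ => κ + 1 := Primrec.succ
  have h2 : Primrec fun κ : ℕ => (κ + 1) * (κ + 1) * (κ + 1) :=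
    Primrec.nat_mul.comp (Primrec.nat_mul.comp h1 h1) h1
  have h3 : Primrec fun κ : ℕ => κ * (κ * κ) + 1 :=
    Primrec.succ.comp (Primrec.nat_mul.comp .id (Primrec.nat_mul.comp .id .id))
  exact hpow.comp h2 h3

lemma cube_le_guessBound (κ : ℕ) : (κ + 1) * (κ + 1) * (κ + 1) ≤ guessBound κ :=
  Nat.le_self_pow (Nat.succ_ne_zero _) _

lemma guesses_le (I : SeparatedInstance) : I.guesses ≤ guessBound I.parameter := by
  have hk : I.k ≤ I.parameter := by simp only [parameter]; omega
  have hp : I.p ≤ I.parameter := by simp only [parameter]; omega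
  have hpq : I.p + I.q ≤ I.parameter := by simp only [parameter]; omega
  have hr : I.rounds ≤ I.parameter * (I.parameter * I.parameter) + 1 := by
    unfold rounds
    gcongr
  calc I.guesses
      ≤ ((I.parameter + 1) * (I.parameter + 1) * (I.parameter + 1)) ^ I.rounds := by
        unfold guesses
        gcongr
    _ ≤ _ := Nat.pow_le_pow_right (by positivity) hr

/-- The factor `guessBound` dominates the quantities that depend only on the parameter, and `(size +
1) ^ 3` the loops over the tables, since `n + 2`, `n * n` and `n` are each at most `size`. The
factor `4` pays for the `4 * size + 4` bits of `inf` and of sums with it. -/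
lemma enough (I : SeparatedInstance) :
    I.Enough (4 * guessBound I.parameter * (I.size + 1) ^ 3) := by
  set g := guessBound I.parameter with hg
  set s := I.size with hs
  have hcube := cube_le_guessBound I.parameter
  have hk : I.k ≤ I.parameter := by simp only [parameter]; omega
  have hpq : I.p + I.q ≤ I.parameter := by simp only [parameter]; omega
  have hsize := I.sq_le_size
  have hg1 : 1 ≤ g := le_trans (Nat.succ_le_of_lt (by positivity)) hcube
  have hn : I.n + 2 ≤ s := by omega
  have hn2 : I.n * I.n ≤ s := by omega
  have hs3 : s + 1 ≤ (s + 1) ^ 3 := Nat.le_self_pow (by norm_num) _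
  have hle : ∀ {a : ℕ}, a ≤ (s + 1) ^ 3 → a ≤ 4 * g * (s + 1) ^ 3 := fun h =>
    h.trans (Nat.le_mul_of_pos_left _ (by positivity))
  have hgle : ∀ {a : ℕ}, a ≤ g → a ≤ 4 * g * (s + 1) ^ 3 := fun h => by
    have : 1 ≤ (s + 1) ^ 3 := by omega
    nlinarith
  refine ⟨?_, hle ?_, hle ?_, hgle ?_, hgle I.guesses_le, ?_⟩
  · calc 4 * s + 4 = 4 * 1 * (s + 1) := by ring
      _ ≤ 4 * g * (s + 1) ^ 3 := by gcongr
  · calc (I.n + 2) * (I.n * I.n) ≤ (s + 1) * (s + 1) * 1 := by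
          rw [mul_one]
          exact Nat.mul_le_mul (by omega) (by omega)
      _ ≤ (s + 1) * (s + 1) * (s + 1) := by gcongr; omega
      _ = (s + 1) ^ 3 := by ring
  · calc (I.n + 2) * (I.n * I.n) * I.n ≤ (s + 1) * (s + 1) * (s + 1) :=
          Nat.mul_le_mul (Nat.mul_le_mul (by omega) (by omega)) (by omega)
      _ = (s + 1) ^ 3 := by ring
  · refine le_trans ?_ hcube
    calc I.rounds ≤ I.parameter * (I.parameter * I.parameter) + 1 := by
          unfold rounds
          gcongr
      _ ≤ _ := by nlinarith
  · have hkg : I.k + 1 ≤ g := by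
      refine le_trans ?_ hcube
      nlinarith [Nat.zero_le (I.parameter * I.parameter)]
    calc (I.k + 1) * I.n ≤ g * (s + 1) ^ 3 := 
          Nat.mul_le_mul hkg (le_trans (by omega) hs3)
      _ ≤ 4 * g * (s + 1) ^ 3 := by
        gcongr
        omega

lemma bounded_inputMem (hX : I.Enough X) : Bounded X (inputMem I.encode) := by
  intro a
  unfold inputMem
  split_ifs
  · exact hX.fits_inputEntry a.toNat
  · exact fits_zero

end SeparatedInstance

theorem mainTheorem2 :
    RAM.FixedParameterTractable SeparatedInstance.encode SeparatedInstance.parameter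
      SeparatedInstance.IsYes := by
  obtain ⟨c, d, hcd⟩ := RAM.solve.polyBounded_timeBound
  refine ⟨RAM.solve, fun κ => c * (33 * SeparatedInstance.guessBound κ) ^ d, 3 * d, ?_,
    fun I => ?_⟩
  · have hpow : Primrec₂ ((· ^ ·) : ℕ → ℕ → ℕ) := Primrec₂.unpaired'.1 Nat.Primrec.pow
    exact (Primrec.nat_mul.comp (.const c) (hpow.comp (Primrec.nat_mul.comp (.const 33)
      SeparatedInstance.primrec_guessBound) (.const d))).to_comp
  · have hX := I.enough
    obtain ⟨M, t, hexec, ht, -, hM⟩ :=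
      SeparatedInstance.wp_solve hX (SeparatedInstance.bounded_inputMem hX)
    refine ⟨M, t, hexec, ?_, fun h => by rw [hM, RAM.bit_of h],
      fun h => by rw [hM, RAM.bit_of_not h]⟩
    set g := SeparatedInstance.guessBound I.parameter with hg
    have hg1 : 1 ≤ g :=
      le_trans (Nat.succ_le_of_lt (by positivity)) (SeparatedInstance.cube_le_guessBound _)
    change t ≤ c * (33 * g) ^ d * I.size ^ (3 * d)
    have hs : 1 ≤ I.size := le_trans (by omega) I.sq_le_size
    have h1 : (I.size + 1) ^ 3 ≤ (2 * I.size) ^ 3 := Nat.pow_le_pow_left (by omega) 3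
    have h2 : 1 ≤ g * I.size ^ 3 := Nat.succ_le_of_lt (by positivity)
    -- Here `33 = 4 * 2 ^ 3 + 1`: the size is positive, so `size + 1 ≤ 2 * size`, and the last
    -- summand `1` is at most `g * size ^ 3`. This separates the parameter from the input size.
    have h3 : 4 * g * (I.size + 1) ^ 3 + 1 ≤ 33 * g * I.size ^ 3 := by
      calc 4 * g * (I.size + 1) ^ 3 + 1 ≤ 4 * g * (2 * I.size) ^ 3 + g * I.size ^ 3 := by gcongr
        _ = 33 * g * I.size ^ 3 := by ring
    calc t ≤ c * (4 * g * (I.size + 1) ^ 3 + 1) ^ d := ht.trans (hcd _)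
      _ ≤ c * (33 * g * I.size ^ 3) ^ d := by gcongr
      _ = c * (33 * g) ^ d * I.size ^ (3 * d) := by rw [mul_pow, ← pow_mul]; ring
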